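/- For $n=0,1,2,\dots$ let $$R_n(t)=\frac{((t-1)(t-2)\cdots(t-n))^3}{n!^2\,t(t+1)\cdots(t+n)},\qquad a_n=(-1)^n\sum_{k=0}^n(-1)^k\binom nk\binom{n+k}k^3 ,$$ and for $0<z<1$ let $$r_n(z)=\sum_{\nu\ge1}z^\nu R_n(\nu),\qquad \tilde r_n(z)=-\sum_{\nu\ge1}z^\nu R_n'(\nu),\qquad \tilde{\tilde r}_n(z)=\frac12\sum_{\nu\ge1}z^\nu R_n''(\nu).$$ At $z=1$ these series are given a sense by the Barnes integrals $$\tilde r_n=\frac1{2\pi i}\int_{1/2-i\infty}^{1/2+i\infty}R_n(t)\Bigl(\frac{\pi}{\sin\pi t}\Bigr)^2dt,\qquad \tilde{\tilde r}_n=-\frac1{2\pi i}\int_{1/2-i\infty}^{1/2+i\infty}R_n(t)\,\frac{\pi^3\cos\pi t}{\sin^3\pi t}\,dt .$$ Theorem 2. The integrals converge absolutely, and $$\tilde r_n=\lim_{z\to1^-}\bigl(\tilde r_n(z)-r_n(z)\log z\bigr),\qquad \tilde{\tilde r}_n=\lim_{z\to1^-}\bigl(\tilde{\tilde r}_n(z)-\tilde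 r_n(z)\log z+\tfrac12r_n(z)\log^2z\bigr).$$ There are rational numbers $\tilde b_n,\tilde{\tilde b}_n$ with $$\tilde r_n=a_n\zeta(2)-\tilde b_n,\qquad \tilde{\tilde r}_n=a_n\zeta(3)-\tilde{\tilde b}_n\qquad(n\ge0).$$ Each of the sequences $u=\tilde r,\ \tilde{\tilde r},\ a,\ \tilde b,\ \tilde{\tilde b}$ satisfies, for $n=2,3,\dots$, $$\begin{aligned} &2(946n^2-731n+153)(2n+1)(n+1)^3u_{n+1}\\ &\quad-2(104060n^6+127710n^5+12788n^4-34525n^3-8482n^2+3298n+1071)u_n\\ &\quad+2(3784n^5-1032n^4-1925n^3+853n^2+328n-184)\,n\,u_{n-1}\\ &\quad-(946n^2+1161n+368)\,n(n-1)^3u_{n-2}=0, \end{aligned}$$ with the initial data $$a_0=1,\ a_1=7,\ a_2=163;\qquad \tilde b_0=0,\ \tilde b_1=\tfrac{23}2,\ \tilde b_2=\tfrac{2145}8;\qquad \tilde{\tilde b}_0=0,\ \tilde{\tilde b}_1=\tfrac{17}2,\ \tilde{\tilde b}_2=\tfrac{3135}{16}.$$ In addition, $$\limsup_{n\to\infty}|\tilde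 r_n|^{1/n}=\limsup_{n\to\infty}|\tilde{\tilde r}_n|^{1/n}=|\lambda_{1,2}|=0.067442248\dots,$$ $$\lim_{n\to\infty}|a_n|^{1/n}=\lim_{n\to\infty}|\tilde b_n|^{1/n}=\lim_{n\to\infty}|\tilde{\tilde b}_n|^{1/n}=\lambda_3=54.96369509\dots,$$ where $\lambda_{1,2}=0.018152450\ldots\pm i\,0.064953409\ldots$ and $\lambda_3$ are the zeros of $4\lambda^3-220\lambda^2+8\lambda-1$. -/

import Mathlib

open Filter Topology MeasureTheory
open scoped Nat

noncomputable section

namespace SimApprox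

/-- The rational function `((t-1)(t-2)⋯(t-n))³ / (n!² · t(t+1)⋯(t+n))`. -/
def R (n : ℕ) (t : ℂ) : ℂ :=
  (∏ j ∈ Finset.Icc 1 n, (t - j)) ^ 3 /
    ((n ! : ℂ) ^ 2 * ∏ j ∈ Finset.range (n + 1), (t + j))

/-- The series `r_n(z) = ∑_{ν ≥ 1} z^ν R_n(ν)` (convergent for `|z| < 1`). -/
def rSeries (n : ℕ) (z : ℝ) : ℂ :=
  ∑' ν : ℕ, (z : ℂ) ^ (ν + 1) * R n ((ν + 1 : ℕ) : ℂ)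

/-- The series `r̃_n(z) = - ∑_{ν ≥ 1} z^ν R_n'(ν)` (convergent for `|z| < 1`). -/
def rtSeries (n : ℕ) (z : ℝ) : ℂ :=
  -∑' ν : ℕ, (z : ℂ) ^ (ν + 1) * deriv (R n) ((ν + 1 : ℕ) : ℂ)

/-- The series `r̃̃_n(z) = (1/2) ∑_{ν ≥ 1} z^ν R_n''(ν)` (convergent for `|z| < 1`). -/
def rttSeries (n : ℕ) (z : ℝ) : ℂ :=
  (1 / 2) * ∑' ν : ℕ, (z : ℂ) ^ (ν + 1) * iteratedDeriv 2 (R n) ((ν + 1 : ℕ) : ℂ)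

/-- The integrand `R_n(t) (π / sin πt)²` of the first Barnes integral at `z = 1`. -/
def kernelTwo (n : ℕ) (t : ℂ) : ℂ :=
  R n t * ((Real.pi : ℂ) / Complex.sin (Real.pi * t)) ^ 2

/-- The integrand `- R_n(t) π³ cos πt / sin³ πt` of the second Barnes integral at `z = 1`. -/
def kernelThree (n : ℕ) (t : ℂ) : ℂ :=
  -(R n t * ((Real.pi : ℂ) ^ 3 * Complex.cos (Real.pi * t) / Complex.sin (Real.pi * t) ^ 3))

/-- The point `1/2 + iy` of the line of integration. The integrands above are holomorphic in the
strip `0 < Re t < n + 1` up to removable singularities, so every other vertical line in that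
strip gives the same integrals. -/
def line (y : ℝ) : ℂ := 1 / 2 + y * Complex.I

/-- `(1 / 2πi) ∫_{1/2 - i∞}^{1/2 + i∞} f(t) dt`. -/
def barnes (f : ℂ → ℂ) : ℂ :=
  1 / (2 * Real.pi * Complex.I) * ∫ y : ℝ, f (line y) * Complex.I

/-- `r̃_n = r̃_n(1)`: the value at `z = 1` of the first construction. -/
def rt (n : ℕ) : ℂ := barnes (kernelTwo n)

/-- `r̃̃_n = r̃̃_n(1)`: the value at `z = 1` of the second construction. -/
def rtt (n : ℕ) : ℂ := barnes (kernelThree n)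

/-- The common leading coefficient `a_n` (the sum of the residues of `R_n` at its poles). -/
def a (n : ℕ) : ℤ :=
  (-1) ^ n * ∑ k ∈ Finset.range (n + 1),
    (-1) ^ k * (n.choose k : ℤ) * ((n + k).choose k : ℤ) ^ 3

/-- The third-order recurrence, for all `n ≥ 2`. -/
def Recurrence {K : Type*} [CommRing K] (u : ℕ → K) : Prop :=
  ∀ n : ℕ, 2 ≤ n →
    2 * (946 * (n : K) ^ 2 - 731 * n + 153) * (2 * n + 1) * (n + 1) ^ 3 * u (n + 1)
    - 2 * (104060 * (n : K) ^ 6 + 127710 * n ^ 5 + 12788 * n ^ 4 - 34525 * n ^ 3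
        - 8482 * n ^ 2 + 3298 * n + 1071) * u n
    + 2 * (3784 * (n : K) ^ 5 - 1032 * n ^ 4 - 1925 * n ^ 3 + 853 * n ^ 2
        + 328 * n - 184) * n * u (n - 1)
    - (946 * (n : K) ^ 2 + 1161 * n + 368) * n * (n - 1) ^ 3 * u (n - 2) = 0

/-- The characteristic polynomial `4λ³ - 220λ² + 8λ - 1`. -/
def charPoly : Polynomial ℂ :=
  4 * Polynomial.X ^ 3 - 220 * Polynomial.X ^ 2 + 8 * Polynomial.X - 1

end SimApprox

end

/-!
The two sequences are values of one functional. Put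
`J h = (1/2πi) ∫ h(t) (π / sin πt)² dt` over `Re t = 1/2`, for `h` holomorphic and of polynomial growth
on `Re t > 0` (`Tempered`). Then `r̃_n = J(R_n)` by definition, and integration by parts gives
`r̃̃_n = -J(R_n')/2` (`rtt_eq_J`). Since the kernel has period `1` and its Laurent expansion at `t = 1`
is `1/(t-1)² + O(1)`, moving the line by one unit gives the shift formula
`J(h(t + 1)) = J(h) + h'(1)` (`J_shift`), which carries the whole argument.

* Iterated for `h(t) = z ^ t f(t)` it expresses `J(z ^ t f)` by the power series, and dominated
  convergence lets `z → 1` (`tendsto_rt`, `tendsto_rtt`).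
* For `h(t) = t ^ m` it is the recursion of the Bernoulli numbers, and for `h(t) = 1/t` and
  `h(t) = 1/t²` it yields `ζ(2)` and `ζ(3)`. With the partial fractions of `R_n`, whose residues add up
  to `a_n`, this gives the linear forms (`exists_isZetaForm_R`) and the initial data.
* Creative telescoping: the recurrence operator maps `R_n` to `S(t + 1) - S(t)` with an explicit
  rational `S` that has a triple zero at `t = 1` (`telescoping`), so that the shift formula annihilates
  both sequences. The same certificate at the poles `t = -k` gives the recurrence of `a_n`, and those of
  the rational parts follow by linearity.

For the growth, an elementary theorem of Poincaré–Perron type (`poincare_perron`) says that a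
nonzero solution has either `limsup |u_n|^{1/n} = |λ₁|` or `lim |u_n|^{1/n} = λ₃`. On `Re t = 1/2` two
of the four products in `|R_n(t)|` cancel and Euler's product for the sine bounds the rest by a
multiple of `cosh πy`, uniformly in `n`. So the integrals are bounded in `n`, and as `λ₃ > 1` they
belong to the first case. A solution in the first case tends to zero; the integers `a_n` cannot, and
then neither can the rational parts, so these belong to the second case.
-/

noncomputable section

namespace SimApprox

/-! ### Holomorphic functions of polynomial growth on the right half-plane -/

/-- The open right half-plane `Re t > 0`. -/
def rightHalfPlane : Set ℂ := {t | 0 < t.re}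

lemma isOpen_rightHalfPlane : IsOpen rightHalfPlane :=
  isOpen_lt continuous_const Complex.continuous_re

/-- Functions that are holomorphic on `Re t > 0` and of polynomial growth on every closed half-plane
`Re t ≥ δ > 0`. Letting the constants depend on `δ` makes the class stable under
differentiation. -/
structure Tempered (f : ℂ → ℂ) : Prop where
  diff : DifferentiableOn ℂ f rightHalfPlane
  growth : ∀ δ : ℝ, 0 < δ → ∃ (C : ℝ) (m : ℕ), 0 ≤ C ∧
    ∀ t : ℂ, δ ≤ t.re → ‖f t‖ ≤ C * (1 + ‖t‖) ^ m

namespace Tempered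

variable {f g : ℂ → ℂ}

lemma differentiableAt (hf : Tempered f) {t : ℂ} (ht : 0 < t.re) : DifferentiableAt ℂ f t :=
  hf.diff.differentiableAt (isOpen_rightHalfPlane.mem_nhds ht)

lemma congr (hf : Tempered f) (h : ∀ t : ℂ, 0 < t.re → g t = f t) : Tempered g where
  diff := hf.diff.congr h
  growth δ hδ := by
    obtain ⟨C, m, hC, hb⟩ := hf.growth δ hδ
    exact ⟨C, m, hC, fun t ht => by rw [h t (hδ.trans_le ht)]; exact hb t ht⟩

lemma const (c : ℂ) : Tempered fun _ => c where
  diff := differentiableOn_const c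
  growth _ _ := ⟨‖c‖, 0, norm_nonneg _, fun t _ => by simp⟩

lemma id : Tempered fun t => t where
  diff := differentiableOn_id
  growth _ _ := ⟨1, 1, zero_le_one, fun t _ => by simp⟩

lemma add (hf : Tempered f) (hg : Tempered g) : Tempered fun t => f t + g t where
  diff := hf.diff.add hg.diff
  growth δ hδ := by
    obtain ⟨C, m, hC, hb⟩ := hf.growth δ hδ
    obtain ⟨C', m', hC', hb'⟩ := hg.growth δ hδ
    refine ⟨C + C', max m m', by positivity, fun t ht => (norm_add_le _ _).trans ?_⟩
    have h1 : 1 ≤ 1 + ‖t‖ := by linarith [norm_nonneg t]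
    rw [add_mul]
    exact add_le_add
      ((hb t ht).trans (mul_le_mul_of_nonneg_left (pow_le_pow_right₀ h1 (le_max_left _ _)) hC))
      ((hb' t ht).trans (mul_le_mul_of_nonneg_left (pow_le_pow_right₀ h1 (le_max_right _ _)) hC'))

lemma mul (hf : Tempered f) (hg : Tempered g) : Tempered fun t => f t * g t where
  diff := hf.diff.mul hg.diff
  growth δ hδ := by
    obtain ⟨C, m, hC, hb⟩ := hf.growth δ hδ
    obtain ⟨C', m', hC', hb'⟩ := hg.growth δ hδ
    refine ⟨C * C', m + m', by positivity, fun t ht => ?_⟩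
    calc ‖f t * g t‖ = ‖f t‖ * ‖g t‖ := norm_mul _ _
      _ ≤ (C * (1 + ‖t‖) ^ m) * (C' * (1 + ‖t‖) ^ m') :=
        mul_le_mul (hb t ht) (hb' t ht) (norm_nonneg _) (by positivity)
      _ = _ := by ring

lemma const_mul (c : ℂ) (hf : Tempered f) : Tempered fun t => c * f t := (const c).mul hf

lemma neg (hf : Tempered f) : Tempered fun t => -f t :=
  (hf.const_mul (-1)).congr fun t _ => by ring

lemma sub (hf : Tempered f) (hg : Tempered g) : Tempered fun t => f t - g t :=
  (hf.add hg.neg).congr fun t _ => by ring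

lemma pow (hf : Tempered f) (k : ℕ) : Tempered fun t => f t ^ k := by
  induction k with
  | zero => simpa using const 1
  | succ k ih => exact (ih.mul hf).congr fun t _ => pow_succ _ _

lemma sum {ι : Type*} (s : Finset ι) {F : ι → ℂ → ℂ} (hF : ∀ i ∈ s, Tempered (F i)) :
    Tempered fun t => ∑ i ∈ s, F i t := by
  classical
  induction s using Finset.induction_on with
  | empty => simpa using const 0
  | insert i s hi ih =>
    refine ((hF i (Finset.mem_insert_self _ _)).add
      (ih fun j hj => hF j (Finset.mem_insert_of_mem hj))).congr fun t _ => ?_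
    rw [Finset.sum_insert hi]

lemma prod {ι : Type*} (s : Finset ι) {F : ι → ℂ → ℂ} (hF : ∀ i ∈ s, Tempered (F i)) :
    Tempered fun t => ∏ i ∈ s, F i t := by
  classical
  induction s using Finset.induction_on with
  | empty => simpa using const 1
  | insert i s hi ih =>
    refine ((hF i (Finset.mem_insert_self _ _)).mul
      (ih fun j hj => hF j (Finset.mem_insert_of_mem hj))).congr fun t _ => ?_
    rw [Finset.prod_insert hi]

lemma add_natCast_ne_zero (k : ℕ) {t : ℂ} (ht : 0 < t.re) : t + k ≠ 0 := by
  intro h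
  have := congrArg Complex.re h
  simp at this
  linarith [Nat.cast_nonneg (α := ℝ) k]

lemma inv_add_natCast (k : ℕ) : Tempered fun t => (t + k)⁻¹ where
  diff t ht := by
    have := add_natCast_ne_zero k ht
    exact DifferentiableAt.differentiableWithinAt (by fun_prop (disch := assumption))
  growth δ hδ := by
    refine ⟨δ⁻¹, 0, by positivity, fun t ht => ?_⟩
    rw [norm_inv, pow_zero, mul_one]
    refine inv_anti₀ hδ (le_trans ?_ (Complex.re_le_norm _))
    simp
    linarith [Nat.cast_nonneg (α := ℝ) k]

/-- Translation to the right by a nonnegative amount. -/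
lemma comp_add (hf : Tempered f) {a : ℝ} (ha : 0 ≤ a) : Tempered fun t => f (t + a) where
  diff := hf.diff.comp (differentiableOn_id.add_const _) fun t (ht : 0 < t.re) => by
    change 0 < (t + a).re
    simp
    linarith
  growth δ hδ := by
    obtain ⟨C, m, hC, hb⟩ := hf.growth δ hδ
    refine ⟨C * (1 + a) ^ m, m, by positivity, fun t ht => (hb (t + a) (by simp; linarith)).trans ?_⟩
    rw [mul_assoc, ← mul_pow]
    refine mul_le_mul_of_nonneg_left (pow_le_pow_left₀ (by positivity) ?_ _) hC
    have := norm_add_le t (a : ℂ)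
    rw [Complex.norm_real, Real.norm_of_nonneg ha] at this
    nlinarith [norm_nonneg t, mul_nonneg ha (norm_nonneg t)]

lemma comp_add_natCast (hf : Tempered f) (k : ℕ) : Tempered fun t => f (t + k) := by
  simpa using hf.comp_add (Nat.cast_nonneg (α := ℝ) k)

/-- Cauchy's estimate on a disc of radius `δ / 2` keeps the growth polynomial. -/
lemma deriv (hf : Tempered f) : Tempered (deriv f) where
  diff := hf.diff.deriv isOpen_rightHalfPlane
  growth δ hδ := by
    obtain ⟨C, m, hC, hb⟩ := hf.growth (δ / 2) (by positivity)
    refine ⟨C * (1 + δ / 2) ^ m / (δ / 2), m, by positivity, fun t ht => ?_⟩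
    have hre : ∀ z ∈ Metric.closedBall t (δ / 2), δ / 2 ≤ z.re := fun z hz => by
      have h1 := Complex.abs_re_le_norm (z - t)
      rw [Metric.mem_closedBall, dist_eq_norm] at hz
      rw [Complex.sub_re] at h1
      linarith [(abs_le.mp (h1.trans hz)).1]
    have hd : DiffContOnCl ℂ f (Metric.ball t (δ / 2)) := by
      refine DifferentiableOn.diffContOnCl (hf.diff.mono fun z hz => ?_)
      rw [closure_ball _ (by positivity)] at hz
      exact lt_of_lt_of_le (by positivity) (hre z hz)
    refine (Complex.norm_deriv_le_of_forall_mem_sphere_norm_le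
      (C := C * (1 + δ / 2) ^ m * (1 + ‖t‖) ^ m) (by positivity) hd fun z hz => ?_).trans
      (le_of_eq (by ring))
    refine (hb z (hre z (Metric.sphere_subset_closedBall hz))).trans ?_
    rw [mul_assoc, ← mul_pow]
    refine mul_le_mul_of_nonneg_left (pow_le_pow_left₀ (by positivity) ?_ _) hC
    have h2 : ‖z‖ ≤ ‖t‖ + δ / 2 := by
      rw [mem_sphere_iff_norm] at hz
      linarith [norm_le_norm_add_norm_sub' z t]
    nlinarith [norm_nonneg t, mul_nonneg hδ.le (norm_nonneg t)]

/-- Multiplication by `z ^ t` with `0 < z ≤ 1`. -/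
lemma cpow_mul (hf : Tempered f) {z : ℝ} (hz0 : 0 < z) (hz1 : z ≤ 1) :
    Tempered fun t => (z : ℂ) ^ t * f t := by
  refine Tempered.mul ⟨fun t _ => ?_, fun δ hδ => ⟨1, 0, zero_le_one, fun t ht => ?_⟩⟩ hf
  · exact (differentiableAt_id.const_cpow
      (Or.inl (by exact_mod_cast hz0.ne'))).differentiableWithinAt
  · rw [Complex.norm_cpow_eq_rpow_re_of_pos hz0]
    simpa using Real.rpow_le_one hz0.le hz1 (hδ.le.trans ht)

end Tempered

/-- `R n` as a product of functions that are visibly tempered. -/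
lemma R_eq (n : ℕ) (t : ℂ) : R n t = ((n ! : ℂ) ^ 2)⁻¹ *
    ((∏ j ∈ Finset.Icc 1 n, (t - j)) ^ 3 * ∏ j ∈ Finset.range (n + 1), (t + j)⁻¹) := by
  rw [R, Finset.prod_inv_distrib, div_eq_mul_inv, mul_inv]
  ring

lemma tempered_R (n : ℕ) : Tempered (R n) :=
  (((Tempered.prod (Finset.Icc 1 n) fun j _ => Tempered.id.sub (.const (j : ℂ))).pow 3).mul
    (Tempered.prod (Finset.range (n + 1)) fun j _ => .inv_add_natCast j)).const_mul _
    |>.congr fun t _ => R_eq n t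

/-! ### The kernel `(π / sin πt)²` and its functional on the line `Re t = 1/2` -/

/-- The restriction `π² / cosh² πy` of `(π / sin πt)²` to `t = 1/2 + iy`. -/
def sechSq (y : ℝ) : ℝ := Real.pi ^ 2 / Real.cosh (Real.pi * y) ^ 2

/-- The functional `h ↦ (1/2πi) ∫ h(t) (π / sin πt)² dt` over the line `Re t = 1/2`. -/
def J (h : ℂ → ℂ) : ℂ := 1 / (2 * Real.pi) * ∫ y : ℝ, h (line y) * (sechSq y : ℂ)

lemma sechSq_nonneg (y : ℝ) : 0 ≤ sechSq y := by unfold sechSq; positivity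

lemma continuous_sechSq : Continuous sechSq := by
  unfold sechSq
  exact continuous_const.div (by fun_prop) fun y => pow_ne_zero 2 (Real.cosh_pos _).ne'

lemma continuous_line : Continuous line := by unfold line; fun_prop

lemma line_re (y : ℝ) : (line y).re = 1 / 2 := by simp [line]

lemma line_re_pos (y : ℝ) : 0 < (line y).re := by rw [line_re]; norm_num

lemma pow_mul_exp_neg_abs_le (m : ℕ) :
    ∃ C : ℝ, 0 ≤ C ∧ ∀ y : ℝ, (1 + |y|) ^ m * Real.exp (-|y|) ≤ C * (1 + y ^ 2)⁻¹ := by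
  refine ⟨(m + 2) ! * Real.exp 1, by positivity, fun y => ?_⟩
  have h1 : (1 + |y|) ^ (m + 2) / (m + 2) ! ≤ Real.exp (1 + |y|) :=
    Real.pow_div_factorial_le_exp (1 + |y|) (by positivity) (m + 2)
  rw [div_le_iff₀ (by positivity), Real.exp_add] at h1
  rw [← div_eq_mul_inv, le_div_iff₀ (by positivity), Real.exp_neg]
  have h2 : 1 + y ^ 2 ≤ (1 + |y|) ^ 2 := by nlinarith [sq_abs y, abs_nonneg y]
  calc (1 + |y|) ^ m * (Real.exp |y|)⁻¹ * (1 + y ^ 2)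
      ≤ (1 + |y|) ^ m * (Real.exp |y|)⁻¹ * (1 + |y|) ^ 2 := by gcongr
    _ = (1 + |y|) ^ (m + 2) * (Real.exp |y|)⁻¹ := by ring
    _ ≤ (Real.exp 1 * Real.exp |y| * (m + 2) !) * (Real.exp |y|)⁻¹ := by gcongr
    _ = _ := by field_simp

lemma exp_half_le_cosh (x : ℝ) : Real.exp |x| / 2 ≤ Real.cosh x := by
  rw [← Real.cosh_abs, Real.cosh_eq]
  linarith [Real.exp_pos (-|x|)]

lemma sechSq_le (y : ℝ) : sechSq y ≤ 4 * Real.pi ^ 2 * Real.exp (-|y|) := by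
  unfold sechSq
  rw [div_le_iff₀ (by positivity)]
  have h1 : Real.exp |y| / 2 ≤ Real.cosh (Real.pi * y) := by
    refine le_trans ?_ (exp_half_le_cosh _)
    refine div_le_div_of_nonneg_right (Real.exp_le_exp.mpr ?_) zero_le_two
    rw [abs_mul, abs_of_pos Real.pi_pos]
    nlinarith [Real.pi_gt_three, abs_nonneg y]
  have h2 : 1 ≤ Real.exp |y| := Real.one_le_exp (abs_nonneg y)
  have h3 : Real.exp |y| ≤ 4 * Real.cosh (Real.pi * y) ^ 2 := by nlinarith
  calc Real.pi ^ 2 = Real.pi ^ 2 * Real.exp (-|y|) * Real.exp |y| := by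
        rw [mul_assoc, ← Real.exp_add]; simp
    _ ≤ Real.pi ^ 2 * Real.exp (-|y|) * (4 * Real.cosh (Real.pi * y) ^ 2) := by gcongr
    _ = _ := by ring

lemma integrable_pow_mul_sechSq (m : ℕ) : Integrable fun y : ℝ => (1 + |y|) ^ m * sechSq y := by
  obtain ⟨C, hC, hb⟩ := pow_mul_exp_neg_abs_le m
  refine Integrable.mono' (integrable_inv_one_add_sq.const_mul (4 * Real.pi ^ 2 * C))
    (Continuous.aestronglyMeasurable (by have := continuous_sechSq; fun_prop))
    (Eventually.of_forall fun y => ?_)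
  rw [Real.norm_of_nonneg (mul_nonneg (by positivity) (sechSq_nonneg y))]
  calc (1 + |y|) ^ m * sechSq y ≤ (1 + |y|) ^ m * (4 * Real.pi ^ 2 * Real.exp (-|y|)) := by
        gcongr; exact sechSq_le y
    _ = 4 * Real.pi ^ 2 * ((1 + |y|) ^ m * Real.exp (-|y|)) := by ring
    _ ≤ 4 * Real.pi ^ 2 * (C * (1 + y ^ 2)⁻¹) := mul_le_mul_of_nonneg_left (hb y) (by positivity)
    _ = _ := by ring

lemma norm_line_le (y : ℝ) : 1 + ‖line y‖ ≤ 2 * (1 + |y|) := by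
  have : ‖line y‖ ≤ 1 / 2 + |y| := by
    refine (norm_add_le _ _).trans ?_
    simp
  linarith [abs_nonneg y]

lemma Tempered.continuous_line {f : ℂ → ℂ} (hf : Tempered f) :
    Continuous fun y : ℝ => f (line y) :=
  hf.diff.continuousOn.comp_continuous SimApprox.continuous_line line_re_pos

lemma Tempered.growth_line {f : ℂ → ℂ} (hf : Tempered f) :
    ∃ (C : ℝ) (m : ℕ), 0 ≤ C ∧ ∀ y : ℝ, ‖f (line y)‖ ≤ C * (1 + |y|) ^ m := by
  obtain ⟨C, m, hC, hb⟩ := hf.growth (1 / 2) (by norm_num)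
  refine ⟨C * 2 ^ m, m, by positivity, fun y => (hb _ (line_re y).ge).trans ?_⟩
  rw [mul_assoc, ← mul_pow]
  gcongr
  exact norm_line_le y

lemma Tempered.integrable_line {f : ℂ → ℂ} (hf : Tempered f) :
    Integrable fun y : ℝ => f (line y) * (sechSq y : ℂ) := by
  obtain ⟨C, m, hC, hb⟩ := hf.growth_line
  refine Integrable.mono' ((integrable_pow_mul_sechSq m).const_mul C)
    (hf.continuous_line.mul
      (Complex.continuous_ofReal.comp continuous_sechSq)).aestronglyMeasurable
    (Eventually.of_forall fun y => ?_)
  rw [norm_mul, Complex.norm_real, Real.norm_of_nonneg (sechSq_nonneg y), ← mul_assoc]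
  exact mul_le_mul_of_nonneg_right (hb y) (sechSq_nonneg y)

/-- The constant in the estimate of `J` on functions of growth `(1 + |y|) ^ m`. -/
def Jconst (m : ℕ) : ℝ := 1 / (2 * Real.pi) * ∫ y : ℝ, (1 + |y|) ^ m * sechSq y

lemma norm_J_le {f : ℂ → ℂ} {B : ℝ} {m : ℕ} (hb : ∀ y : ℝ, ‖f (line y)‖ ≤ B * (1 + |y|) ^ m) :
    ‖J f‖ ≤ B * Jconst m := by
  rw [J, Jconst, norm_mul]
  have h1 : ‖(1 / (2 * Real.pi) : ℂ)‖ = 1 / (2 * Real.pi) := by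
    simp [abs_of_pos Real.pi_pos]
  rw [h1, mul_left_comm, ← integral_const_mul]
  gcongr
  refine norm_integral_le_of_norm_le ((integrable_pow_mul_sechSq m).const_mul B)
    (Eventually.of_forall fun y => ?_)
  rw [norm_mul, Complex.norm_real, Real.norm_of_nonneg (sechSq_nonneg y), ← mul_assoc]
  exact mul_le_mul_of_nonneg_right (hb y) (sechSq_nonneg y)

lemma J_congr {f g : ℂ → ℂ} (h : ∀ t : ℂ, 0 < t.re → f t = g t) : J f = J g := by
  unfold J
  simp_rw [h _ (line_re_pos _)]

lemma J_add {f g : ℂ → ℂ} (hf : Tempered f) (hg : Tempered g) :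
    J (fun t => f t + g t) = J f + J g := by
  simp only [J, add_mul]
  rw [integral_add hf.integrable_line hg.integrable_line, mul_add]

lemma J_const_mul (c : ℂ) (f : ℂ → ℂ) : J (fun t => c * f t) = c * J f := by
  simp only [J, mul_assoc]
  rw [integral_const_mul]
  ring

lemma J_sum {ι : Type*} (s : Finset ι) {F : ι → ℂ → ℂ} (hF : ∀ i ∈ s, Tempered (F i)) :
    J (fun t => ∑ i ∈ s, F i t) = ∑ i ∈ s, J (F i) := by
  simp only [J, Finset.sum_mul]
  rw [integral_finsetSum _ fun i hi => (hF i hi).integrable_line, Finset.mul_sum]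

/-! ### Moving the line of integration across a double pole -/

/-- The strip `0 < Re t < 2`. -/
def strip : Set ℂ := {t | 0 < t.re ∧ t.re < 2}

lemma isOpen_strip : IsOpen strip :=
  (isOpen_lt continuous_const Complex.continuous_re).inter
    (isOpen_lt Complex.continuous_re continuous_const)

lemma one_mem_strip : (1 : ℂ) ∈ strip := by simp [strip]

/-- The second-order Taylor quotient at `1`. -/
lemma dslope_dslope_one (Φ : ℂ → ℂ) {t : ℂ} (ht : t ≠ 1) :
    dslope (dslope Φ 1) 1 t
      = Φ t / (t - 1) ^ 2 - Φ 1 * ((t - 1) ^ 2)⁻¹ - deriv Φ 1 * (t - 1)⁻¹ := by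
  have h : t - 1 ≠ 0 := sub_ne_zero.mpr ht
  rw [dslope_of_ne _ ht, slope_def_field, dslope_of_ne _ ht, slope_def_field, dslope_same]
  field_simp

lemma integral_inv_quarter_add_sq : ∫ y : ℝ, (1 / 4 + y ^ 2)⁻¹ = 2 * Real.pi := by
  have h : ∀ y : ℝ, (1 / 4 + y ^ 2)⁻¹ = 4 * (1 + (2 * y) ^ 2)⁻¹ := fun y => by
    have : 1 / 4 + y ^ 2 ≠ 0 := by positivity
    have : 1 + (2 * y) ^ 2 ≠ 0 := by positivity
    field_simp
    ring
  simp_rw [h]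
  rw [integral_const_mul, Measure.integral_comp_mul_left (fun y => (1 + y ^ 2)⁻¹) 2,
    integral_univ_inv_one_add_sq]
  norm_num
  ring

lemma integrable_inv_quarter_add_sq : Integrable fun y : ℝ => (1 / 4 + y ^ 2)⁻¹ := by
  refine Integrable.mono' (integrable_inv_one_add_sq.const_mul 4)
    (Continuous.aestronglyMeasurable (Continuous.inv₀ (by fun_prop) fun y => by positivity))
    (Eventually.of_forall fun y => ?_)
  rw [Real.norm_of_nonneg (by positivity), ← div_eq_mul_inv, inv_eq_one_div,
    div_le_div_iff₀ (by positivity) (by positivity)]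
  nlinarith [sq_nonneg y]

lemma half_add_mul_I_ne_zero (y : ℝ) : (1 / 2 : ℂ) + y * Complex.I ≠ 0 := fun h => by
  simpa using congrArg Complex.re h

lemma neg_half_add_mul_I_ne_zero (y : ℝ) : (-(1 / 2) : ℂ) + y * Complex.I ≠ 0 := fun h => by
  simpa using congrArg Complex.re h

lemma ofReal_quarter_add_sq (y : ℝ) : ((1 / 4 + y ^ 2 : ℝ) : ℂ)
    = -((1 / 2 + y * Complex.I) * (-(1 / 2) + y * Complex.I)) := by
  push_cast
  linear_combination (y : ℂ) ^ 2 * Complex.I_sq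

lemma ofReal_inv_quarter_add_sq (y : ℝ) : (((1 / 4 + y ^ 2)⁻¹ : ℝ) : ℂ)
    = (1 / 2 + y * Complex.I)⁻¹ - (-(1 / 2) + y * Complex.I)⁻¹ := by
  have hp := half_add_mul_I_ne_zero y
  have hq := neg_half_add_mul_I_ne_zero y
  rw [Complex.ofReal_inv, ofReal_quarter_add_sq, inv_sub_inv hp hq, inv_neg,
    show (-(1 / 2) + y * Complex.I) - (1 / 2 + y * Complex.I) = (-1 : ℂ) by ring, neg_div, inv_eq_one_div]

/-- The polar part of order two contributes an odd function to the difference of the integrals over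
`Re t = 3/2` and `Re t = 1/2`. -/
lemma integral_inv_sq_sub :
    Integrable (fun y : ℝ => (((1 / 2 : ℂ) + y * Complex.I) ^ 2)⁻¹
      - ((-(1 / 2) + y * Complex.I) ^ 2)⁻¹) ∧
    ∫ y : ℝ, ((((1 / 2 : ℂ) + y * Complex.I) ^ 2)⁻¹ - ((-(1 / 2) + y * Complex.I) ^ 2)⁻¹) = 0 := by
  have key : ∀ y : ℝ, (((1 / 2 : ℂ) + y * Complex.I) ^ 2)⁻¹ - ((-(1 / 2) + y * Complex.I) ^ 2)⁻¹
      = ((-2 * y * ((1 / 4 + y ^ 2)⁻¹) ^ 2 : ℝ) : ℂ) * Complex.I := fun y => by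
    have hp := half_add_mul_I_ne_zero y
    have hq := neg_half_add_mul_I_ne_zero y
    rw [Complex.ofReal_mul, Complex.ofReal_pow, Complex.ofReal_inv, ofReal_quarter_add_sq,
      inv_sub_inv (pow_ne_zero 2 hp) (pow_ne_zero 2 hq), inv_neg, neg_sq, ← mul_pow, inv_pow,
      div_eq_mul_inv]
    push_cast
    ring
  have hint : Integrable fun y : ℝ => -2 * y * ((1 / 4 + y ^ 2)⁻¹) ^ 2 := by
    refine Integrable.mono' (integrable_inv_quarter_add_sq.const_mul 2)
      (Continuous.aestronglyMeasurable (Continuous.mul (by fun_prop)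
        ((Continuous.inv₀ (by fun_prop) fun y => by positivity).pow 2)))
      (Eventually.of_forall fun y => ?_)
    have hp : 0 < 1 / 4 + y ^ 2 := by positivity
    rw [norm_mul, Real.norm_of_nonneg (by positivity : 0 ≤ ((1 / 4 + y ^ 2)⁻¹) ^ 2), sq, ← mul_assoc]
    refine mul_le_mul_of_nonneg_right ?_ (by positivity)
    rw [← div_eq_mul_inv, div_le_iff₀ hp, Real.norm_eq_abs, abs_mul]
    norm_num
    nlinarith [sq_nonneg (|y| - 1 / 2), sq_abs y]
  have hodd : ∫ y : ℝ, -2 * y * ((1 / 4 + y ^ 2)⁻¹) ^ 2 = 0 := by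
    have h := integral_neg_eq_self (fun y : ℝ => -2 * y * ((1 / 4 + y ^ 2)⁻¹) ^ 2) volume
    have h2 : ∀ y : ℝ, -2 * (-y) * ((1 / 4 + (-y) ^ 2)⁻¹) ^ 2
        = -(-2 * y * ((1 / 4 + y ^ 2)⁻¹) ^ 2) := fun y => by
      rw [neg_sq]; ring
    simp_rw [h2] at h
    rw [integral_neg] at h
    linarith
  simp_rw [key]
  refine ⟨hint.ofReal.mul_const _, ?_⟩
  rw [integral_mul_const, integral_complex_ofReal, hodd]
  simp

/-- The residue theorem for a double pole at `1` in the strip between the lines `Re t = 1/2` and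
`Re t = 3/2`. -/
theorem integral_sub_integral_of_double_pole {Φ : ℂ → ℂ} (hΦ : DifferentiableOn ℂ Φ strip)
    (h1 : Integrable fun y : ℝ => Φ (1 / 2 + y * Complex.I) / (1 / 2 + y * Complex.I - 1) ^ 2)
    (h3 : Integrable fun y : ℝ => Φ (3 / 2 + y * Complex.I) / (3 / 2 + y * Complex.I - 1) ^ 2)
    {B : ℝ → ℝ} (hB : Tendsto B atTop (𝓝 0))
    (hdec : ∀ y x : ℝ, 1 ≤ |y| → 1 / 2 ≤ x → x ≤ 3 / 2 →
      ‖Φ (x + y * Complex.I) / (x + y * Complex.I - 1) ^ 2‖ ≤ B |y|) :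
    (∫ y : ℝ, Φ (3 / 2 + y * Complex.I) / (3 / 2 + y * Complex.I - 1) ^ 2)
      - ∫ y : ℝ, Φ (1 / 2 + y * Complex.I) / (1 / 2 + y * Complex.I - 1) ^ 2
      = 2 * Real.pi * deriv Φ 1 := by
  set g := dslope (dslope Φ 1) 1 with hg
  have hs : strip ∈ 𝓝 (1 : ℂ) := isOpen_strip.mem_nhds one_mem_strip
  have hgd : DifferentiableOn ℂ g strip :=
    (Complex.differentiableOn_dslope hs).mpr ((Complex.differentiableOn_dslope hs).mpr hΦ)
  -- the difference of `g` on the two lines, integrated, vanishes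
  set D : ℝ → ℂ := fun y => g (3 / 2 + y * Complex.I) - g (1 / 2 + y * Complex.I) with hD
  have hDeq : ∀ y : ℝ, D y = (Φ (3 / 2 + y * Complex.I) / (3 / 2 + y * Complex.I - 1) ^ 2
      - Φ (1 / 2 + y * Complex.I) / (1 / 2 + y * Complex.I - 1) ^ 2)
      - (Φ 1 * ((((1 / 2 : ℂ) + y * Complex.I) ^ 2)⁻¹ - ((-(1 / 2) + y * Complex.I) ^ 2)⁻¹)
      + deriv Φ 1 * (((1 / 4 + y ^ 2)⁻¹ : ℝ) : ℂ)) := fun y => by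
    have e1 : (3 / 2 : ℂ) + y * Complex.I ≠ 1 := fun h => by
      have := congrArg Complex.re h
      norm_num at this
    have e2 : (1 / 2 : ℂ) + y * Complex.I ≠ 1 := fun h => by
      have := congrArg Complex.re h
      norm_num at this
    have e3 : (3 / 2 : ℂ) + y * Complex.I - 1 = 1 / 2 + y * Complex.I := by ring
    have e4 : (1 / 2 : ℂ) + y * Complex.I - 1 = -(1 / 2) + y * Complex.I := by ring
    rw [hD]
    simp only [hg]
    rw [dslope_dslope_one Φ e1, dslope_dslope_one Φ e2, e3, e4, ofReal_inv_quarter_add_sq]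
    ring
  have hI1 : Integrable fun y : ℝ => Φ (3 / 2 + y * Complex.I) / (3 / 2 + y * Complex.I - 1) ^ 2
      - Φ (1 / 2 + y * Complex.I) / (1 / 2 + y * Complex.I - 1) ^ 2 := h3.sub h1
  have hI2 := integral_inv_sq_sub.1.const_mul (Φ 1)
  have hI3 : Integrable fun y : ℝ => deriv Φ 1 * (((1 / 4 + y ^ 2)⁻¹ : ℝ) : ℂ) :=
    integrable_inv_quarter_add_sq.ofReal.const_mul (deriv Φ 1)
  have hI23 : Integrable fun y : ℝ => Φ 1 * ((((1 / 2 : ℂ) + y * Complex.I) ^ 2)⁻¹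
      - ((-(1 / 2) + y * Complex.I) ^ 2)⁻¹) + deriv Φ 1 * (((1 / 4 + y ^ 2)⁻¹ : ℝ) : ℂ) :=
    hI2.add hI3
  have hDint : Integrable D :=
    (hI1.sub hI23).congr (Eventually.of_forall fun y => (hDeq y).symm)
  have hDval : ∫ y, D y = ((∫ y : ℝ, Φ (3 / 2 + y * Complex.I) / (3 / 2 + y * Complex.I - 1) ^ 2)
      - ∫ y : ℝ, Φ (1 / 2 + y * Complex.I) / (1 / 2 + y * Complex.I - 1) ^ 2)
      - 2 * Real.pi * deriv Φ 1 := by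
    simp_rw [hDeq]
    rw [integral_sub hI1 hI23, integral_sub h3 h1, integral_add hI2 hI3, integral_const_mul,
      integral_const_mul, integral_inv_sq_sub.2, integral_complex_ofReal,
      integral_inv_quarter_add_sq]
    push_cast
    ring
  -- on the horizontal sides `g` is small
  have hgb : ∀ y x : ℝ, 1 ≤ |y| → 1 / 2 ≤ x → x ≤ 3 / 2 →
      ‖g (x + y * Complex.I)‖ ≤ B |y| + ‖Φ 1‖ * (|y|⁻¹) ^ 2 + ‖deriv Φ 1‖ * |y|⁻¹ := by
    intro y x hy hx1 hx2
    have hy0 : 0 < |y| := by linarith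
    have hne : (x : ℂ) + y * Complex.I ≠ 1 := fun h => by
      have := congrArg Complex.im h
      simp at this
      simp [this] at hy0
    have hn : ‖((x : ℂ) + y * Complex.I - 1)⁻¹‖ ≤ |y|⁻¹ := by
      rw [norm_inv]
      refine inv_anti₀ hy0 ?_
      simpa using Complex.abs_im_le_norm ((x : ℂ) + y * Complex.I - 1)
    rw [hg, dslope_dslope_one Φ hne]
    refine (norm_sub_le _ _).trans (add_le_add ((norm_sub_le _ _).trans (add_le_add
      (hdec y x hy hx1 hx2) ?_)) ?_)
    · rw [norm_mul, ← inv_pow, norm_pow]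
      gcongr
    · rw [norm_mul]
      gcongr
  have hB' : Tendsto (fun T : ℝ => 2 * (B T + ‖Φ 1‖ * T⁻¹ ^ 2 + ‖deriv Φ 1‖ * T⁻¹)) atTop (𝓝 0) := by
    have h := tendsto_inv_atTop_zero (𝕜 := ℝ)
    simpa using ((hB.add ((h.pow 2).const_mul ‖Φ 1‖)).add (h.const_mul ‖deriv Φ 1‖)).const_mul 2
  have hlim0 : Tendsto (fun T : ℝ => ∫ y in (-T)..T, D y) atTop (𝓝 0) := by
    refine squeeze_zero_norm' ?_ hB'
    filter_upwards [eventually_ge_atTop 1] with T hT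
    have hline : ∀ c : ℝ, 0 < c → c < 2 →
        Continuous fun y : ℝ => g (c + y * Complex.I) := fun c hc0 hc2 =>
      hgd.continuousOn.comp_continuous (by fun_prop) fun y => by simp [strip, hc0, hc2]
    have hrect := Complex.integral_boundary_rect_eq_zero_of_differentiableOn g
      (⟨1 / 2, -T⟩ : ℂ) (⟨3 / 2, T⟩ : ℂ) (hgd.mono fun t ht => by
        have h1 : t.re ∈ Set.uIcc (1 / 2 : ℝ) (3 / 2) := ht.1
        rw [Set.uIcc_of_le (by norm_num)] at h1
        exact ⟨by linarith [h1.1], by linarith [h1.2]⟩)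
    simp only [smul_eq_mul] at hrect
    have hsplit : ∫ y in (-T)..T, D y = (∫ y in (-T)..T, g (((3 / 2 : ℝ) : ℂ) + y * Complex.I))
        - ∫ y in (-T)..T, g (((1 / 2 : ℝ) : ℂ) + y * Complex.I) := by
      rw [← intervalIntegral.integral_sub
        ((hline (3 / 2) (by norm_num) (by norm_num)).intervalIntegrable _ _)
        ((hline (1 / 2) (by norm_num) (by norm_num)).intervalIntegrable _ _)]
      simp [hD]
    have hval : ∫ y in (-T)..T, D y = -Complex.I * ((∫ x in (1 / 2 : ℝ)..(3 / 2), g (x + T * Complex.I))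
        - ∫ x in (1 / 2 : ℝ)..(3 / 2), g (x + (-T : ℝ) * Complex.I)) := by
      rw [hsplit]
      linear_combination (-Complex.I) * hrect + (((∫ y in (-T)..T, g (((3 / 2 : ℝ) : ℂ)
        + y * Complex.I)) - ∫ y in (-T)..T, g (((1 / 2 : ℝ) : ℂ) + y * Complex.I))) * Complex.I_sq
    have hT0 : 0 ≤ T := by linarith
    have hbd : ∀ s : ℝ, |s| = T → ‖∫ x in (1 / 2 : ℝ)..(3 / 2), g (x + s * Complex.I)‖
        ≤ B T + ‖Φ 1‖ * T⁻¹ ^ 2 + ‖deriv Φ 1‖ * T⁻¹ := fun s hs => by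
      have := intervalIntegral.norm_integral_le_of_norm_le_const (a := (1 / 2 : ℝ)) (b := 3 / 2)
        (f := fun x : ℝ => g (x + s * Complex.I))
        (C := B T + ‖Φ 1‖ * T⁻¹ ^ 2 + ‖deriv Φ 1‖ * T⁻¹) fun x hx => by
          rw [Set.uIoc_of_le (by norm_num)] at hx
          have := hgb s x (by rw [hs]; exact hT) hx.1.le hx.2
          rwa [hs] at this
      norm_num at this
      simpa using this
    rw [hval, norm_mul, norm_neg, Complex.norm_I, one_mul]
    refine (norm_sub_le _ _).trans ?_
    linarith [hbd T (abs_of_nonneg hT0), hbd (-T) (by rw [abs_neg, abs_of_nonneg hT0])]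
  have hlim1 := intervalIntegral_tendsto_integral hDint tendsto_neg_atTop_atBot tendsto_id
  have h0 : ∫ y, D y = 0 := tendsto_nhds_unique hlim1 hlim0
  rw [h0] at hDval
  linear_combination -hDval

/-! ### The shift formula -/

/-- The kernel `(π / sin πt)²`. -/
def cscSq (t : ℂ) : ℂ := ((Real.pi : ℂ) / Complex.sin (Real.pi * t)) ^ 2

lemma sin_line (y : ℝ) : Complex.sin (Real.pi * line y) = (Real.cosh (Real.pi * y) : ℂ) := by
  rw [line, mul_add, show (Real.pi : ℂ) * (1 / 2) = Real.pi / 2 by ring, add_comm,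
    Complex.sin_add_pi_div_two, ← mul_assoc, Complex.cos_mul_I]
  push_cast
  rfl

lemma cos_line (y : ℝ) :
    Complex.cos (Real.pi * line y) = -((Real.sinh (Real.pi * y) : ℂ) * Complex.I) := by
  rw [line, mul_add, show (Real.pi : ℂ) * (1 / 2) = Real.pi / 2 by ring, add_comm,
    Complex.cos_add_pi_div_two, ← mul_assoc, Complex.sin_mul_I]
  push_cast
  rfl

lemma cscSq_line (y : ℝ) : cscSq (line y) = (sechSq y : ℂ) := by
  rw [cscSq, sin_line, sechSq]
  push_cast
  rw [div_pow]

lemma cscSq_add_one (t : ℂ) : cscSq (t + 1) = cscSq t := by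
  rw [cscSq, cscSq, mul_add, mul_one, Complex.sin_add_pi, div_neg, neg_sq]

/-- `|sin (a + ib)|² = sin² a + sinh² b`, so the sine is at least `|sinh b|` in modulus. -/
lemma abs_sinh_le_norm_sin (a b : ℝ) :
    |Real.sinh b| ≤ ‖Complex.sin (a + b * Complex.I)‖ := by
  rw [Complex.sin_add_mul_I, ← Complex.ofReal_sin, ← Complex.ofReal_cos, ← Complex.ofReal_sinh,
    ← Complex.ofReal_cosh, ← Complex.ofReal_mul, ← Complex.ofReal_mul, Complex.norm_add_mul_I]
  refine Real.le_sqrt_of_sq_le ?_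
  have h1 := Real.sin_sq_add_cos_sq a
  have h2 := Real.cosh_sq b
  rw [sq_abs, mul_pow, mul_pow, h2]
  nlinarith [sq_nonneg (Real.sin a), sq_nonneg (Real.sinh b)]

lemma norm_cscSq_le (x y : ℝ) (hy : 1 ≤ |y|) :
    ‖cscSq (x + y * Complex.I)‖ ≤ 4 * Real.pi ^ 2 * Real.exp (-|y|) := by
  have h0 := abs_sinh_le_norm_sin (Real.pi * x) (Real.pi * y)
  have h1 : Real.exp |y| / 2 ≤ |Real.sinh (Real.pi * y)| := by
    rw [Real.abs_sinh, abs_mul, abs_of_pos Real.pi_pos, Real.sinh_eq]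
    have e1 : Real.exp (2 * |y|) ≤ Real.exp (Real.pi * |y|) :=
      Real.exp_le_exp.mpr (by nlinarith [Real.pi_gt_three])
    have e2 : Real.exp (2 * |y|) = Real.exp |y| * Real.exp |y| := by rw [← Real.exp_add]; ring_nf
    have e3 : 2 ≤ Real.exp |y| := by linarith [Real.add_one_le_exp |y|]
    have e4 : Real.exp (-(Real.pi * |y|)) ≤ 1 :=
      Real.exp_le_one_iff.mpr (by nlinarith [Real.pi_gt_three])
    nlinarith
  have h2 : Real.exp |y| / 2 ≤ ‖Complex.sin (Real.pi * (x + y * Complex.I))‖ := by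
    refine h1.trans (h0.trans (le_of_eq ?_))
    push_cast
    ring_nf
  have hp : 0 < Real.exp |y| := Real.exp_pos _
  have h3 : 1 ≤ Real.exp |y| := Real.one_le_exp (abs_nonneg y)
  rw [cscSq, norm_pow, norm_div, Complex.norm_real, Real.norm_of_nonneg Real.pi_pos.le, div_pow,
    div_le_iff₀ (by nlinarith [norm_nonneg (Complex.sin (Real.pi * (x + y * Complex.I)))])]
  calc Real.pi ^ 2 = 4 * Real.pi ^ 2 * Real.exp (-|y|) * (Real.exp |y| / 4) := by
        rw [Real.exp_neg]; field_simp
    _ ≤ _ := by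
        gcongr
        nlinarith

/-- The regular factor `(t - 1)² (π / sin πt)²` of the kernel at its double pole `t = 1`. -/
def cscSqReg (t : ℂ) : ℂ :=
  ((Real.pi : ℂ) / dslope (fun w : ℂ => Complex.sin (Real.pi * w)) 1 t) ^ 2

lemma dslope_sin_of_ne {t : ℂ} (ht : t ≠ 1) :
    dslope (fun w : ℂ => Complex.sin (Real.pi * w)) 1 t
      = Complex.sin (Real.pi * t) / (t - 1) := by
  rw [dslope_of_ne _ ht, slope_def_field]
  simp

lemma dslope_sin_one :
    dslope (fun w : ℂ => Complex.sin (Real.pi * w)) 1 1 = -(Real.pi : ℂ) := by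
  rw [dslope_same]
  have h : HasDerivAt (fun w : ℂ => Complex.sin (Real.pi * w))
      (Complex.cos (Real.pi * 1) * (Real.pi * 1)) 1 :=
    (Complex.hasDerivAt_sin _).comp 1 ((hasDerivAt_id (1 : ℂ)).const_mul _)
  rw [h.deriv]
  simp

lemma dslope_sin_ne_zero {t : ℂ} (ht : t ∈ strip) :
    dslope (fun w : ℂ => Complex.sin (Real.pi * w)) 1 t ≠ 0 := by
  have hpi : (Real.pi : ℂ) ≠ 0 := by exact_mod_cast Real.pi_ne_zero
  by_cases h1 : t = 1
  · rw [h1, dslope_sin_one]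
    exact neg_ne_zero.mpr hpi
  · rw [dslope_sin_of_ne h1]
    refine div_ne_zero (fun h => ?_) (sub_ne_zero.mpr h1)
    obtain ⟨k, hk⟩ := Complex.sin_eq_zero_iff.mp h
    have hk' : t = k := mul_left_cancel₀ hpi (by rw [hk]; ring)
    obtain ⟨ha, hb⟩ := ht
    rw [hk', Complex.intCast_re] at ha hb
    have h3 : 0 < k := by exact_mod_cast ha
    have h4 : k < 2 := by exact_mod_cast hb
    have h5 : k = 1 := by omega
    exact h1 (by rw [hk', h5]; simp)

lemma differentiableOn_cscSqReg : DifferentiableOn ℂ cscSqReg strip := by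
  have h : DifferentiableOn ℂ (dslope (fun w : ℂ => Complex.sin (Real.pi * w)) 1) strip :=
    (Complex.differentiableOn_dslope (isOpen_strip.mem_nhds one_mem_strip)).mpr
      (Differentiable.differentiableOn (by fun_prop))
  exact ((differentiableOn_const _).div h fun t ht => dslope_sin_ne_zero ht).pow 2

lemma cscSqReg_one : cscSqReg 1 = 1 := by
  have hpi : (Real.pi : ℂ) ≠ 0 := by exact_mod_cast Real.pi_ne_zero
  rw [cscSqReg, dslope_sin_one, div_neg, div_self hpi]
  norm_num

lemma cscSqReg_div {t : ℂ} (ht : t ≠ 1) : cscSqReg t / (t - 1) ^ 2 = cscSq t := by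
  have h := sub_ne_zero.mpr ht
  rw [cscSqReg, dslope_sin_of_ne ht, cscSq]
  field_simp

/-- The kernel is symmetric about `t = 1`, hence has no residue there. -/
lemma deriv_cscSqReg_one : deriv cscSqReg 1 = 0 := by
  have hsymm : ∀ t, cscSqReg (2 - t) = cscSqReg t := fun t => by
    by_cases ht : t = 1
    · rw [ht]; norm_num
    · have ht' : 2 - t ≠ 1 := fun h => ht (by linear_combination -h)
      have e : Complex.sin (Real.pi * (2 - t)) = -Complex.sin (Real.pi * t) := by
        rw [show (Real.pi : ℂ) * (2 - t) = -(Real.pi * t) + 2 * Real.pi by ring,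
          Complex.sin_add_two_pi, Complex.sin_neg]
      rw [cscSqReg, cscSqReg, dslope_sin_of_ne ht, dslope_sin_of_ne ht', e,
        show 2 - t - 1 = -(t - 1) by ring, neg_div_neg_eq]
  have hd : HasDerivAt cscSqReg (deriv cscSqReg 1) 1 :=
    (differentiableOn_cscSqReg.differentiableAt
      (isOpen_strip.mem_nhds one_mem_strip)).hasDerivAt
  have hd' : HasDerivAt (fun t => cscSqReg (2 - t)) (deriv cscSqReg 1 * -1) 1 := by
    refine HasDerivAt.comp (h₂ := cscSqReg) (h := fun t : ℂ => 2 - t) (1 : ℂ) ?_ ?_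
    · change HasDerivAt cscSqReg _ (2 - 1 : ℂ)
      rw [show (2 - 1 : ℂ) = 1 by norm_num]
      exact hd
    · simpa using (hasDerivAt_id (1 : ℂ)).const_sub 2
  simp_rw [hsymm] at hd'
  have := hd.unique hd'
  linear_combination this / 2

/-- **The shift formula.** Moving the line of integration from `Re t = 1/2` to `Re t = 3/2` picks up
the residue `h'(1)` of `h(t) (π / sin πt)²` at `t = 1`; the kernel has period `1`. -/
theorem J_shift {h : ℂ → ℂ} (hh : Tempered h) :
    J (fun t => h (t + 1)) = J h + deriv h 1 := by
  set Φ : ℂ → ℂ := fun t => h t * cscSqReg t with hΦ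
  have hΦd : DifferentiableOn ℂ Φ strip :=
    (hh.diff.mono fun t ht => ht.1).mul differentiableOn_cscSqReg
  have hq : ∀ {t : ℂ}, t ≠ 1 → Φ t / (t - 1) ^ 2 = h t * cscSq t := fun ht => by
    rw [← cscSqReg_div ht, hΦ, mul_div_assoc]
  have e1 : ∀ y : ℝ, Φ (1 / 2 + y * Complex.I) / (1 / 2 + y * Complex.I - 1) ^ 2
      = h (line y) * sechSq y := fun y => by
    rw [hq, ← cscSq_line, line]
    exact fun h => by
      have := congrArg Complex.re h
      norm_num at this
  have e3 : ∀ y : ℝ, Φ (3 / 2 + y * Complex.I) / (3 / 2 + y * Complex.I - 1) ^ 2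
      = h (line y + 1) * sechSq y := fun y => by
    have e : (3 / 2 : ℂ) + y * Complex.I = line y + 1 := by rw [line]; ring
    rw [hq, e, ← cscSq_line, cscSq_add_one]
    exact fun h => by
      have := congrArg Complex.re h
      norm_num at this
  have hder : deriv Φ 1 = deriv h 1 := by
    have hd : DifferentiableAt ℂ cscSqReg 1 := differentiableOn_cscSqReg.differentiableAt
      (isOpen_strip.mem_nhds one_mem_strip)
    rw [hΦ, deriv_fun_mul (hh.differentiableAt (by simp)) hd, cscSqReg_one, deriv_cscSqReg_one]
    ring
  obtain ⟨C, m, hC, hb⟩ := hh.growth (1 / 2) (by norm_num)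
  obtain ⟨C', hC', hb'⟩ := pow_mul_exp_neg_abs_le m
  have hB : Tendsto (fun T : ℝ => C * 3 ^ m * (4 * Real.pi ^ 2) * (C' * (1 + T ^ 2)⁻¹)) atTop
      (𝓝 0) := by
    have h1 : Tendsto (fun T : ℝ => 1 + T ^ 2) atTop atTop :=
      tendsto_atTop_add_const_left _ _ (tendsto_pow_atTop two_ne_zero)
    simpa using (h1.inv_tendsto_atTop.const_mul C').const_mul (C * 3 ^ m * (4 * Real.pi ^ 2))
  have hsh : Tempered fun t => h (t + 1) := by simpa using hh.comp_add_natCast 1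
  have key := integral_sub_integral_of_double_pole hΦd (by simp_rw [e1]; exact hh.integrable_line)
    (by simp_rw [e3]; exact hsh.integrable_line) hB fun y x hy hx1 hx2 => by
      have hne : (x : ℂ) + y * Complex.I ≠ 1 := fun h => by
        have := congrArg Complex.im h
        simp at this
        rw [this] at hy
        norm_num at hy
      have hn : 1 + ‖(x : ℂ) + y * Complex.I‖ ≤ 3 * (1 + |y|) := by
        have := norm_add_le (x : ℂ) (y * Complex.I)
        simp only [norm_mul, Complex.norm_I, mul_one, Complex.norm_real, Real.norm_eq_abs] at this
        rw [abs_of_nonneg (by linarith)] at this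
        linarith [abs_nonneg y]
      rw [hq hne, norm_mul, sq_abs]
      calc ‖h (x + y * Complex.I)‖ * ‖cscSq (x + y * Complex.I)‖
          ≤ (C * (3 * (1 + |y|)) ^ m) * (4 * Real.pi ^ 2 * Real.exp (-|y|)) := by
            refine mul_le_mul ((hb _ (by simpa using hx1)).trans ?_) (norm_cscSq_le x y hy)
              (norm_nonneg _) (by positivity)
            gcongr
        _ = C * 3 ^ m * (4 * Real.pi ^ 2) * ((1 + |y|) ^ m * Real.exp (-|y|)) := by
            rw [mul_pow]; ring
        _ ≤ _ := mul_le_mul_of_nonneg_left (hb' y) (by positivity)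
  simp_rw [e1, e3] at key
  rw [hder] at key
  have hpi : (Real.pi : ℂ) ≠ 0 := by exact_mod_cast Real.pi_ne_zero
  unfold J
  rw [sub_eq_iff_eq_add.mp key]
  field_simp
  ring

lemma deriv_comp_add_natCast (h : ℂ → ℂ) (k : ℕ) :
    deriv (fun t => h (t + k)) = fun t => deriv h (t + k) := by
  funext t
  exact deriv_comp_add_const _ _ _

lemma J_comp_add_natCast {h : ℂ → ℂ} (hh : Tempered h) (N : ℕ) :
    J (fun t => h (t + N)) = J h + ∑ ν ∈ Finset.range N, deriv h ((ν + 1 : ℕ) : ℂ) := by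
  induction N with
  | zero => simp
  | succ N ih =>
    have h1 := J_shift (hh.comp_add_natCast N)
    rw [deriv_comp_add_natCast, ih] at h1
    rw [Finset.sum_range_succ, ← add_assoc]
    have e : (fun t : ℂ => h (t + ((N + 1 : ℕ) : ℂ))) = fun t => h (t + 1 + N) := by
      funext t; push_cast; ring_nf
    rw [e, h1]
    push_cast
    ring_nf

/-- If the integrals over the lines `Re t = N + 1/2` tend to zero, then the functional is minus the
sum of the residues at the positive integers. -/
lemma tendsto_sum_deriv {h : ℂ → ℂ} (hh : Tempered h)
    (h0 : Tendsto (fun N : ℕ => J (fun t => h (t + N))) atTop (𝓝 0)) :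
    Tendsto (fun N : ℕ => ∑ ν ∈ Finset.range N, deriv h ((ν + 1 : ℕ) : ℂ)) atTop (𝓝 (-J h)) := by
  have h1 := h0.sub_const (J h)
  simp_rw [J_comp_add_natCast hh] at h1
  simpa using h1

/-! ### The Barnes integrals -/

lemma kernelTwo_line (n : ℕ) (y : ℝ) : kernelTwo n (line y) = R n (line y) * sechSq y := by
  rw [← cscSq_line]
  rfl

lemma barnes_eq (f : ℂ → ℂ) : barnes f = 1 / (2 * Real.pi) * ∫ y : ℝ, f (line y) := by
  have hpi : (Real.pi : ℂ) ≠ 0 := by exact_mod_cast Real.pi_ne_zero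
  rw [barnes, integral_mul_const]
  field_simp

lemma rt_eq_J (n : ℕ) : rt n = J (R n) := by
  rw [rt, barnes_eq, J]
  simp_rw [kernelTwo_line]

lemma integrable_kernelTwo (n : ℕ) : Integrable fun y : ℝ => kernelTwo n (line y) := by
  simp_rw [kernelTwo_line]
  exact (tempered_R n).integrable_line

lemma kernelThree_line (n : ℕ) (y : ℝ) : kernelThree n (line y)
    = R n (line y) * ((Real.pi * (Real.sinh (Real.pi * y) / Real.cosh (Real.pi * y)) : ℝ)
      * Complex.I * sechSq y) := by
  rw [kernelThree, sin_line, cos_line, sechSq]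
  push_cast
  ring

lemma norm_pi_mul_tanh_le (y : ℝ) :
    ‖((Real.pi * (Real.sinh (Real.pi * y) / Real.cosh (Real.pi * y)) : ℝ) : ℂ) * Complex.I‖
      ≤ Real.pi := by
  rw [norm_mul, Complex.norm_I, mul_one, Complex.norm_real, Real.norm_eq_abs, abs_mul, abs_div,
    abs_of_pos Real.pi_pos, abs_of_pos (Real.cosh_pos _)]
  refine mul_le_of_le_one_right Real.pi_pos.le ((div_le_one (Real.cosh_pos _)).mpr ?_)
  rw [Real.abs_sinh, ← Real.cosh_abs]
  exact (Real.sinh_lt_cosh _).le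

lemma norm_kernelThree_line_le (n : ℕ) (y : ℝ) :
    ‖kernelThree n (line y)‖ ≤ Real.pi * ‖R n (line y) * (sechSq y : ℂ)‖ := by
  rw [kernelThree_line, mul_left_comm, norm_mul]
  exact mul_le_mul_of_nonneg_right (norm_pi_mul_tanh_le y) (norm_nonneg _)

lemma integrable_kernelThree (n : ℕ) : Integrable fun y : ℝ => kernelThree n (line y) := by
  simp_rw [kernelThree_line]
  have hc : Continuous fun y : ℝ => Real.pi * (Real.sinh (Real.pi * y) / Real.cosh (Real.pi * y)) :=
    continuous_const.mul ((Real.continuous_sinh.comp (by fun_prop)).div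
      (Real.continuous_cosh.comp (by fun_prop)) fun y => (Real.cosh_pos _).ne')
  have h := (tempered_R n).integrable_line.bdd_mul (c := Real.pi)
    (f := fun y : ℝ => ((Real.pi * (Real.sinh (Real.pi * y) / Real.cosh (Real.pi * y)) : ℝ) : ℂ)
      * Complex.I) ((Complex.continuous_ofReal.comp hc).mul continuous_const).aestronglyMeasurable
    (Eventually.of_forall norm_pi_mul_tanh_le)
  exact h.congr (Eventually.of_forall fun y => by ring)

lemma hasDerivAt_line (y : ℝ) : HasDerivAt line Complex.I y := by
  have := ((Complex.ofRealCLM.hasDerivAt (x := y)).mul_const Complex.I).const_add (1 / 2 : ℂ)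
  exact this.congr_deriv (by simp)

lemma hasDerivAt_cscSq_line (y : ℝ) : HasDerivAt (fun y : ℝ => cscSq (line y))
    (-2 * Real.pi * (Real.sinh (Real.pi * y) / Real.cosh (Real.pi * y) : ℝ) * sechSq y : ℂ) y := by
  simp_rw [cscSq_line]
  have hne := (Real.cosh_pos (Real.pi * y)).ne'
  have h1 : HasDerivAt (fun y : ℝ => Real.cosh (Real.pi * y))
      (Real.sinh (Real.pi * y) * (Real.pi * 1)) y :=
    (Real.hasDerivAt_cosh _).comp y ((hasDerivAt_id y).const_mul _)
  have h2 := ((h1.pow 2).inv (pow_ne_zero 2 hne)).const_mul (Real.pi ^ 2)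
  have h3 := h2.ofReal_comp
  refine HasDerivAt.congr_deriv (h3.congr_of_eventuallyEq (Eventually.of_forall fun y => ?_)) ?_
  · simp [sechSq, div_eq_mul_inv]
  · rw [sechSq]
    push_cast
    have : Complex.cosh (Real.pi * y) ≠ 0 := by
      rw [← Complex.ofReal_mul, ← Complex.ofReal_cosh]
      exact_mod_cast hne
    simp
    field_simp

/-- Integration by parts: `-π³ cos πt / sin³ πt` is half the derivative of `(π / sin πt)²`. -/
lemma rtt_eq_J (n : ℕ) : rtt n = -(1 / 2) * J (deriv (R n)) := by
  have hu : ∀ y : ℝ, HasDerivAt (fun y : ℝ => R n (line y)) (deriv (R n) (line y) * Complex.I) y :=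
    fun y => (((tempered_R n).differentiableAt (line_re_pos y)).hasDerivAt).comp y
      (hasDerivAt_line y)
  have hd := (tempered_R n).deriv.integrable_line
  have h3 := integrable_kernelThree n
  have e : ∀ y : ℝ, R n (line y) * (-2 * Real.pi * (Real.sinh (Real.pi * y) /
      Real.cosh (Real.pi * y) : ℝ) * sechSq y : ℂ) = 2 * Complex.I * kernelThree n (line y) :=
    fun y => by
      rw [kernelThree_line]
      push_cast
      linear_combination (-2 * R n (line y) * Real.pi * (Complex.sinh (Real.pi * y)
        / Complex.cosh (Real.pi * y)) * sechSq y) * Complex.I_sq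
  have key := integral_mul_deriv_eq_deriv_mul_of_integrable
    (u := fun y : ℝ => R n (line y)) (v := fun y : ℝ => cscSq (line y))
    (fun y _ => hu y) (fun y _ => hasDerivAt_cscSq_line y)
    ((h3.const_mul (2 * Complex.I)).congr (Eventually.of_forall fun y => (e y).symm))
    ((hd.const_mul Complex.I).congr (Eventually.of_forall fun y => by
      simp only [Pi.mul_apply, cscSq_line]; ring))
    ((tempered_R n).integrable_line.congr (Eventually.of_forall fun y => by
      simp only [Pi.mul_apply, cscSq_line]))
  simp_rw [e, cscSq_line] at key
  rw [integral_const_mul] at key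
  have e2 : ∀ y : ℝ, deriv (R n) (line y) * Complex.I * (sechSq y : ℂ)
      = Complex.I * (deriv (R n) (line y) * sechSq y) := fun y => by ring
  simp_rw [e2] at key
  rw [integral_const_mul] at key
  have key2 : ∫ y : ℝ, kernelThree n (line y)
      = -(1 / 2) * ∫ y : ℝ, deriv (R n) (line y) * sechSq y := by
    refine mul_left_cancel₀ Complex.I_ne_zero ?_
    linear_combination key / 2
  rw [rtt, barnes_eq, key2, J]
  ring

/-! ### The limits at `z = 1` -/

/-- The power series `∑_{ν ≥ 1} z^ν f(ν)`. -/
def powSum (f : ℂ → ℂ) (z : ℝ) : ℂ := ∑' ν : ℕ, (z : ℂ) ^ (ν + 1) * f ((ν + 1 : ℕ) : ℂ)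

lemma Tempered.summable_pow_mul {f : ℂ → ℂ} (hf : Tempered f) {z : ℝ} (hz0 : 0 < z) (hz1 : z < 1) :
    Summable fun ν : ℕ => (z : ℂ) ^ (ν + 1) * f ((ν + 1 : ℕ) : ℂ) := by
  obtain ⟨C, m, hC, hb⟩ := hf.growth 1 one_pos
  have hs : Summable fun ν : ℕ => C * 2 ^ m * (((ν + 1 : ℕ) : ℝ) ^ m * z ^ (ν + 1)) :=
    ((summable_nat_add_iff 1).mpr (summable_pow_mul_geometric_of_norm_lt_one (r := z) m
      (by rwa [Real.norm_of_nonneg hz0.le]))).mul_left _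
  refine Summable.of_norm_bounded hs fun ν => ?_
  have h1 : (1 : ℝ) ≤ ((ν + 1 : ℕ) : ℝ) := by push_cast; linarith [Nat.cast_nonneg (α := ℝ) ν]
  have h2 := hb ((ν + 1 : ℕ) : ℂ) (by rw [Complex.natCast_re]; exact h1)
  rw [Complex.norm_natCast] at h2
  rw [norm_mul, norm_pow, Complex.norm_real, Real.norm_of_nonneg hz0.le]
  calc z ^ (ν + 1) * ‖f ((ν + 1 : ℕ) : ℂ)‖
      ≤ z ^ (ν + 1) * (C * (2 * ((ν + 1 : ℕ) : ℝ)) ^ m) := by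
        refine mul_le_mul_of_nonneg_left (h2.trans ?_) (by positivity)
        gcongr
        linarith
    _ = _ := by rw [mul_pow]; ring

lemma hasDerivAt_cpow_mul {f : ℂ → ℂ} (hf : Tempered f) {z : ℝ} (hz : 0 < z) {t : ℂ}
    (ht : 0 < t.re) : HasDerivAt (fun t => (z : ℂ) ^ t * f t)
      ((z : ℂ) ^ t * (deriv f t + (Real.log z : ℂ) * f t)) t := by
  have h1 : HasDerivAt (fun t : ℂ => (z : ℂ) ^ t) ((z : ℂ) ^ t * Complex.log z * 1) t :=
    (hasDerivAt_id t).const_cpow (Or.inl (by exact_mod_cast hz.ne'))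
  refine (h1.mul (hf.differentiableAt ht).hasDerivAt).congr_deriv ?_
  rw [Complex.ofReal_log hz.le]
  ring

/-- Shifting the line of integration of `z ^ t f(t) (π / sin πt)²` to the right across all the
positive integers. -/
lemma J_cpow_mul {f : ℂ → ℂ} (hf : Tempered f) {z : ℝ} (hz0 : 0 < z) (hz1 : z < 1) :
    J (fun t => (z : ℂ) ^ t * f t) = -(powSum (deriv f) z + Real.log z * powSum f z) := by
  have hh := hf.cpow_mul hz0 hz1.le
  obtain ⟨C, m, hC, hb⟩ := hf.growth (1 / 2) (by norm_num)
  have h0 : Tendsto (fun N : ℕ => J (fun t => (z : ℂ) ^ (t + N) * f (t + N))) atTop (𝓝 0) := by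
    have hlim : Tendsto (fun N : ℕ => C * 2 ^ m * z⁻¹ * (((N + 1 : ℕ) : ℝ) ^ m * z ^ (N + 1))
        * Jconst m) atTop (𝓝 0) := by
      have := (tendsto_add_atTop_iff_nat 1).mpr
        (tendsto_pow_const_mul_const_pow_of_lt_one m hz0.le hz1)
      simpa using (this.const_mul (C * 2 ^ m * z⁻¹)).mul_const (Jconst m)
    refine squeeze_zero_norm (fun N => norm_J_le fun y => ?_) hlim
    have hre : (line y + N).re = 1 / 2 + N := by simp [line_re]
    have hN : (0 : ℝ) ≤ N := Nat.cast_nonneg N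
    have h1 : ‖(z : ℂ) ^ (line y + N)‖ ≤ z ^ N := by
      rw [Complex.norm_cpow_eq_rpow_re_of_pos hz0, hre, ← Real.rpow_natCast]
      exact Real.rpow_le_rpow_of_exponent_ge hz0 hz1.le (by linarith)
    have h2 : 1 + ‖line y + N‖ ≤ 2 * ((N + 1 : ℕ) : ℝ) * (1 + |y|) := by
      have := norm_add_le (line y) (N : ℂ)
      rw [Complex.norm_natCast] at this
      have h3 := norm_line_le y
      push_cast
      nlinarith [abs_nonneg y, mul_nonneg hN (abs_nonneg y)]
    rw [norm_mul]
    calc ‖(z : ℂ) ^ (line y + N)‖ * ‖f (line y + N)‖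
        ≤ z ^ N * (C * (2 * ((N + 1 : ℕ) : ℝ) * (1 + |y|)) ^ m) := by
          refine mul_le_mul h1 ((hb _ (by rw [hre]; linarith)).trans ?_) (norm_nonneg _)
            (by positivity)
          gcongr
      _ = _ := by
          rw [mul_pow, mul_pow, pow_succ]
          field_simp
  have h1 := tendsto_sum_deriv hh h0
  have hterm : ∀ ν : ℕ, deriv (fun t => (z : ℂ) ^ t * f t) ((ν + 1 : ℕ) : ℂ)
      = (z : ℂ) ^ (ν + 1) * deriv f ((ν + 1 : ℕ) : ℂ)
        + Real.log z * ((z : ℂ) ^ (ν + 1) * f ((ν + 1 : ℕ) : ℂ)) := fun ν => by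
    rw [(hasDerivAt_cpow_mul hf hz0 (by rw [Complex.natCast_re]; positivity)).deriv,
      Complex.cpow_natCast]
    ring
  simp_rw [hterm] at h1
  have h2 := ((hf.deriv.summable_pow_mul hz0 hz1).hasSum.add
    ((hf.summable_pow_mul hz0 hz1).hasSum.mul_left (Real.log z : ℂ))).tendsto_sum_nat
  have := tendsto_nhds_unique h1 h2
  rw [powSum, powSum, ← this, neg_neg]

/-- Dominated convergence: on the line of integration `|z ^ t| = z ^ (1/2) ≤ 1`. -/
lemma tendsto_J_cpow_mul {f : ℂ → ℂ} (hf : Tempered f) :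
    Tendsto (fun z : ℝ => J (fun t => (z : ℂ) ^ t * f t)) (𝓝[<] 1) (𝓝 (J f)) := by
  have hev : ∀ᶠ z : ℝ in 𝓝[<] 1, 0 < z ∧ z < 1 := Ioo_mem_nhdsLT zero_lt_one
  refine Tendsto.const_mul _ ?_
  refine tendsto_integral_filter_of_dominated_convergence
    (fun y => ‖f (line y) * (sechSq y : ℂ)‖) ?_ ?_ hf.integrable_line.norm ?_
  · filter_upwards [hev] with z hz
    exact (hf.cpow_mul hz.1 hz.2.le).integrable_line.aestronglyMeasurable
  · filter_upwards [hev] with z hz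
    refine Eventually.of_forall fun y => ?_
    rw [mul_assoc, norm_mul]
    refine mul_le_of_le_one_left (norm_nonneg _) ?_
    rw [Complex.norm_cpow_eq_rpow_re_of_pos hz.1, line_re]
    exact Real.rpow_le_one hz.1.le hz.2.le (by norm_num)
  · refine Eventually.of_forall fun y => ?_
    have h1 : Tendsto (fun z : ℝ => (z : ℂ) ^ line y) (𝓝[<] 1) (𝓝 1) := by
      have h2 : ContinuousAt (fun w : ℂ => w ^ line y) 1 :=
        (hasStrictDerivAt_id (1 : ℂ)).hasDerivAt.cpow_const (c := line y)
          (Or.inl (by simp)) |>.continuousAt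
      have h3 : Tendsto (fun z : ℝ => (z : ℂ)) (𝓝[<] 1) (𝓝 1) :=
        (Complex.continuous_ofReal.tendsto' 1 1 (by simp)).mono_left nhdsWithin_le_nhds
      simpa [Function.comp_def] using h2.tendsto.comp h3
    simpa using (h1.mul_const (f (line y))).mul_const (sechSq y : ℂ)

lemma rSeries_eq (n : ℕ) : rSeries n = powSum (R n) := rfl

lemma rtSeries_eq (n : ℕ) (z : ℝ) : rtSeries n z = -powSum (deriv (R n)) z := rfl

lemma rttSeries_eq (n : ℕ) (z : ℝ) :
    rttSeries n z = 1 / 2 * powSum (deriv (deriv (R n))) z := by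
  rw [rttSeries, powSum, iteratedDeriv_succ, iteratedDeriv_one]

theorem tendsto_rt (n : ℕ) :
    Tendsto (fun z : ℝ => rtSeries n z - rSeries n z * (Real.log z : ℂ)) (𝓝[<] 1) (𝓝 (rt n)) := by
  rw [rt_eq_J]
  refine (tendsto_J_cpow_mul (tempered_R n)).congr' ?_
  filter_upwards [Ioo_mem_nhdsLT zero_lt_one] with z hz
  rw [J_cpow_mul (tempered_R n) hz.1 hz.2, rtSeries_eq, rSeries_eq]
  ring

theorem tendsto_rtt (n : ℕ) :
    Tendsto (fun z : ℝ => rttSeries n z - rtSeries n z * (Real.log z : ℂ)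
      + (1 / 2) * rSeries n z * (Real.log z : ℂ) ^ 2) (𝓝[<] 1) (𝓝 (rtt n)) := by
  have hlog : Tendsto (fun z : ℝ => (Real.log z : ℂ)) (𝓝[<] 1) (𝓝 0) := by
    have h := (Real.continuousAt_log one_ne_zero).tendsto
    rw [Real.log_one] at h
    exact (Complex.continuous_ofReal.tendsto' 0 0 (by simp)).comp
      (h.mono_left nhdsWithin_le_nhds)
  have h := ((tendsto_J_cpow_mul (tempered_R n).deriv).add
    (hlog.mul (tendsto_J_cpow_mul (tempered_R n)))).const_mul (-(1 / 2) : ℂ)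
  rw [zero_mul, add_zero, ← rtt_eq_J] at h
  refine h.congr' ?_
  filter_upwards [Ioo_mem_nhdsLT zero_lt_one] with z hz
  rw [J_cpow_mul (tempered_R n) hz.1 hz.2, J_cpow_mul (tempered_R n).deriv hz.1 hz.2, rtSeries_eq,
    rSeries_eq, rttSeries_eq]
  ring

/-! ### Values of the functional -/

/-- The recursion given by the shift formula for `t ^ (m + 1)` is that of the Bernoulli numbers. -/
lemma J_pow (m : ℕ) : J (fun t => t ^ m) = (bernoulli' m : ℂ) := by
  induction m using Nat.strong_induction_on with
  | _ m ih =>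
  have h1 := J_shift (Tempered.id.pow (m + 1))
  have e : (fun t : ℂ => (t + 1) ^ (m + 1))
      = fun t => ∑ j ∈ Finset.range (m + 2), ((m + 1).choose j : ℂ) * t ^ j := by
    funext t
    rw [add_pow]
    refine Finset.sum_congr rfl fun j _ => ?_
    rw [one_pow, mul_one, mul_comm]
  rw [e, J_sum _ fun j _ => (Tempered.id.pow j).const_mul _] at h1
  simp_rw [J_const_mul] at h1
  rw [Finset.sum_range_succ, Nat.choose_self, Nat.cast_one, one_mul, add_comm,
    add_right_inj] at h1
  have h2 := congrArg (Rat.cast : ℚ → ℂ) (sum_bernoulli' (m + 1))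
  push_cast at h2
  rw [Finset.sum_range_succ] at h1 h2
  rw [Finset.sum_congr rfl fun j hj => by rw [ih j (Finset.mem_range.mp hj)]] at h1
  have hd : deriv (fun t : ℂ => t ^ (m + 1)) 1 = m + 1 := by simp
  rw [hd, ← h2, add_right_inj] at h1
  exact mul_left_cancel₀ (by
    rw [Nat.choose_succ_self_right]
    exact_mod_cast Nat.succ_ne_zero m) h1

lemma deriv_inv_eq : deriv (fun t : ℂ => t⁻¹) = fun t => -(t ^ 2)⁻¹ := deriv_inv'

lemma deriv_deriv_inv_natCast (ν : ℕ) :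
    deriv (deriv fun t : ℂ => t⁻¹) ((ν + 1 : ℕ) : ℂ) = 2 * (1 / ((ν + 1 : ℕ) : ℂ) ^ 3) := by
  have hne : ((ν + 1 : ℕ) : ℂ) ≠ 0 := by exact_mod_cast Nat.succ_ne_zero ν
  rw [deriv_inv_eq]
  have := (((hasDerivAt_pow 2 ((ν + 1 : ℕ) : ℂ)).inv (pow_ne_zero 2 hne)).neg).deriv
  refine Eq.trans (by rfl) (this.trans ?_)
  field_simp
  ring

lemma tempered_inv : Tempered fun t => t⁻¹ := by simpa using Tempered.inv_add_natCast 0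

lemma norm_inv_line_add_le (y : ℝ) (N : ℕ) : ‖(line y + ((N + 1 : ℕ) : ℂ))⁻¹‖ ≤ 1 / ((N : ℝ) + 1) := by
  rw [norm_inv, one_div]
  refine inv_anti₀ (by positivity) (le_trans ?_ (Complex.re_le_norm _))
  simp [line_re]

lemma tendsto_J_zero_of_norm_le {F : ℕ → ℂ → ℂ}
    (hF : ∀ N y, ‖F (N + 1) (line y)‖ ≤ 1 / ((N : ℝ) + 1)) :
    Tendsto (fun N => J (F N)) atTop (𝓝 0) := by
  rw [← tendsto_add_atTop_iff_nat 1]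
  have h := (tendsto_one_div_add_atTop_nhds_zero_nat (𝕜 := ℝ)).mul_const (Jconst 0)
  rw [zero_mul] at h
  exact squeeze_zero_norm (fun N => norm_J_le fun y => by simpa using hF N y) h

lemma summable_one_div_natCast_pow {p : ℕ} (hp : 1 < p) :
    Summable fun n : ℕ => 1 / (n : ℂ) ^ p := by
  have := (Complex.hasSum_ofReal.mpr (Real.summable_one_div_nat_pow.mpr hp).hasSum).summable
  simpa using this

lemma J_inv : J (fun t => t⁻¹) = riemannZeta 2 := by
  have h := tendsto_sum_deriv tempered_inv (tendsto_J_zero_of_norm_le fun N y =>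
    norm_inv_line_add_le y N)
  have h2 := (summable_nat_add_iff 1 (f := fun n : ℕ => 1 / (n : ℂ) ^ 2)).mpr
    (summable_one_div_natCast_pow one_lt_two)
  have h3 := h2.hasSum.tendsto_sum_nat.neg
  rw [show (2 : ℂ) = ((2 : ℕ) : ℂ) by norm_num, zeta_nat_eq_tsum_of_gt_one one_lt_two,
    ← (summable_nat_add_iff 1 (f := fun n : ℕ => 1 / (n : ℂ) ^ 2)).mp h2 |>.sum_add_tsum_nat_add 1]
  simp_rw [← Finset.sum_neg_distrib] at h3
  simp only [deriv_inv_eq] at h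
  simp only [one_div] at h3
  have := neg_injective (tendsto_nhds_unique h h3)
  simpa using this

lemma J_deriv_inv : J (deriv fun t => t⁻¹) = -2 * riemannZeta 3 := by
  have h := tendsto_sum_deriv tempered_inv.deriv (tendsto_J_zero_of_norm_le fun N y => by
    rw [deriv_inv_eq, norm_neg, ← inv_pow, norm_pow]
    refine (pow_le_of_le_one (norm_nonneg _) ?_ two_ne_zero).trans (norm_inv_line_add_le y N)
    refine (norm_inv_line_add_le y N).trans ((div_le_one (by positivity)).mpr ?_)
    linarith [Nat.cast_nonneg (α := ℝ) N])
  have h2 := (summable_nat_add_iff 1 (f := fun n : ℕ => 1 / (n : ℂ) ^ 3)).mpr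
    (summable_one_div_natCast_pow (by norm_num))
  have h3 := h2.hasSum.tendsto_sum_nat.const_mul 2
  rw [show (3 : ℂ) = ((3 : ℕ) : ℂ) by norm_num, zeta_nat_eq_tsum_of_gt_one (by norm_num),
    ← (summable_nat_add_iff 1 (f := fun n : ℕ => 1 / (n : ℂ) ^ 3)).mp h2 |>.sum_add_tsum_nat_add 1]
  simp_rw [deriv_deriv_inv_natCast, ← Finset.mul_sum] at h
  have := tendsto_nhds_unique h h3
  rw [Finset.sum_range_one, Nat.cast_zero, zero_pow three_ne_zero, div_zero, zero_add]
  linear_combination -this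

/-! ### Linear forms in `1`, `ζ(2)` and in `1`, `ζ(3)` -/

/-- `f` is tempered, and its two normalized Barnes integrals are linear forms with the same rational
leading coefficient `c`: `J f = c ζ(2) - b` for the kernel `(π / sin πt)²`, and
`-J f' / 2 = c ζ(3) - d`, which by parts is the integral against `-π³ cos πt / sin³ πt`. -/
structure IsZetaForm (f : ℂ → ℂ) (c b d : ℚ) : Prop where
  tempered : Tempered f
  two : J f = c * riemannZeta 2 - b
  three : -(1 / 2) * J (deriv f) = c * riemannZeta 3 - d

lemma deriv_congr_rightHalfPlane {f g : ℂ → ℂ} (h : ∀ t : ℂ, 0 < t.re → f t = g t) {t : ℂ}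
    (ht : 0 < t.re) : deriv f t = deriv g t :=
  Filter.EventuallyEq.deriv_eq <| by
    filter_upwards [isOpen_rightHalfPlane.mem_nhds ht] with s hs using h s hs

namespace IsZetaForm

variable {f g : ℂ → ℂ} {c b d c' b' d' : ℚ}

lemma congr (hf : IsZetaForm f c b d) (h : ∀ t : ℂ, 0 < t.re → g t = f t) :
    IsZetaForm g c b d where
  tempered := hf.tempered.congr h
  two := by rw [J_congr h, hf.two]
  three := by rw [J_congr fun t ht => deriv_congr_rightHalfPlane h ht, hf.three]

lemma add (hf : IsZetaForm f c b d) (hg : IsZetaForm g c' b' d') :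
    IsZetaForm (fun t => f t + g t) (c + c') (b + b') (d + d') where
  tempered := hf.tempered.add hg.tempered
  two := by
    rw [J_add hf.tempered hg.tempered, hf.two, hg.two]
    push_cast
    ring
  three := by
    rw [J_congr (g := fun t => deriv f t + deriv g t) fun t ht =>
      deriv_fun_add (hf.tempered.differentiableAt ht) (hg.tempered.differentiableAt ht),
      J_add hf.tempered.deriv hg.tempered.deriv, mul_add, hf.three, hg.three]
    push_cast
    ring

lemma const_mul (hf : IsZetaForm f c b d) (q : ℚ) :
    IsZetaForm (fun t => (q : ℂ) * f t) (q * c) (q * b) (q * d) where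
  tempered := hf.tempered.const_mul _
  two := by
    rw [J_const_mul, hf.two]
    push_cast
    ring
  three := by
    rw [J_congr (g := fun t => (q : ℂ) * deriv f t) fun t ht =>
      deriv_const_mul _ (hf.tempered.differentiableAt ht), J_const_mul, mul_left_comm, hf.three]
    push_cast
    ring

lemma zero : IsZetaForm (fun _ => 0) 0 0 0 where
  tempered := .const 0
  two := by simp [J]
  three := by simp [J]

lemma sum {ι : Type*} (s : Finset ι) {F : ι → ℂ → ℂ} {c b d : ι → ℚ}
    (hF : ∀ i ∈ s, IsZetaForm (F i) (c i) (b i) (d i)) :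
    IsZetaForm (fun t => ∑ i ∈ s, F i t) (∑ i ∈ s, c i) (∑ i ∈ s, b i) (∑ i ∈ s, d i) := by
  classical
  induction s using Finset.induction_on with
  | empty => simpa using zero
  | insert i s hi ih =>
    simp_rw [Finset.sum_insert hi]
    exact (hF i (Finset.mem_insert_self _ _)).add
      (ih fun j hj => hF j (Finset.mem_insert_of_mem hj))

lemma pow (m : ℕ) :
    IsZetaForm (fun t => t ^ m) 0 (-bernoulli' m) (m / 2 * bernoulli' (m - 1)) where
  tempered := Tempered.id.pow m
  two := by rw [J_pow]; push_cast; ring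
  three := by
    have h : (deriv fun t : ℂ => t ^ m) = fun t => (m : ℂ) * t ^ (m - 1) := by
      funext t; simp
    rw [h, J_const_mul, J_pow]
    push_cast
    ring

lemma inv_add_natCast (k : ℕ) : IsZetaForm (fun t => (t + k)⁻¹) 1
    (∑ ν ∈ Finset.range k, 1 / ((ν : ℚ) + 1) ^ 2) (∑ ν ∈ Finset.range k, 1 / ((ν : ℚ) + 1) ^ 3) where
  tempered := .inv_add_natCast k
  two := by
    rw [J_comp_add_natCast tempered_inv, J_inv, deriv_inv_eq, Finset.sum_neg_distrib]
    push_cast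
    simp only [one_div]
    ring
  three := by
    rw [deriv_comp_add_natCast (fun t : ℂ => t⁻¹), J_comp_add_natCast tempered_inv.deriv,
      J_deriv_inv]
    simp_rw [deriv_deriv_inv_natCast]
    rw [← Finset.mul_sum]
    push_cast
    ring

end IsZetaForm

lemma isZetaForm_polynomial (P : Polynomial ℚ) :
    ∃ b d : ℚ, IsZetaForm (fun t => Polynomial.aeval t P) 0 b d := by
  have h := IsZetaForm.sum (Finset.range (P.natDegree + 1)) fun i _ =>
    (IsZetaForm.pow i).const_mul (P.coeff i)
  simp only [mul_zero, Finset.sum_const_zero] at h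
  refine ⟨_, _, h.congr fun t _ => ?_⟩
  rw [Polynomial.aeval_eq_sum_range]
  exact Finset.sum_congr rfl fun i _ => by rw [Algebra.smul_def]; rfl

/-- Partial fractions for a denominator `t (t + 1) ⋯ (t + n)` with simple zeros. -/
lemma exists_partial_fraction (N : Polynomial ℚ) (n : ℕ) (c : ℕ → ℚ)
    (hc : ∀ k ∈ Finset.range (n + 1),
      c k * ∏ j ∈ (Finset.range (n + 1)).erase k, ((j : ℚ) - k) = N.eval (-(k : ℚ))) :
    ∃ P : Polynomial ℚ, ∀ t : ℂ, 0 < t.re →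
      Polynomial.aeval t N * ∏ j ∈ Finset.range (n + 1), (t + j)⁻¹
        = Polynomial.aeval t P + ∑ k ∈ Finset.range (n + 1), (c k : ℂ) * (t + k)⁻¹ := by
  set s := Finset.range (n + 1)
  let q : ℕ → Polynomial ℚ := fun j => Polynomial.X - Polynomial.C (-(j : ℚ))
  set E : Polynomial ℚ := N - ∑ k ∈ s, Polynomial.C (c k) * ∏ j ∈ s.erase k, q j with hE
  have hdvd : ∏ j ∈ s, q j ∣ E := by
    refine Finset.prod_dvd_of_coprime (fun i _ j _ hij => ?_) fun i hi => ?_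
    · exact Polynomial.isCoprime_X_sub_C_of_isUnit_sub
        (by rw [isUnit_iff_ne_zero, neg_sub_neg, sub_ne_zero]; exact_mod_cast hij.symm)
    · rw [Polynomial.dvd_iff_isRoot, Polynomial.IsRoot.def, hE, Polynomial.eval_sub,
        Polynomial.eval_finsetSum, Finset.sum_eq_single_of_mem i hi, ← hc i hi, sub_eq_zero]
      · simp [q, Polynomial.eval_prod, sub_eq_add_neg, add_comm]
      · intro k _ hki
        rw [Polynomial.eval_mul, Polynomial.eval_prod,
          Finset.prod_eq_zero (Finset.mem_erase.mpr ⟨hki.symm, hi⟩) (by simp [q]), mul_zero]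
  obtain ⟨P, hP⟩ := hdvd
  refine ⟨P, fun t ht => ?_⟩
  have hne : ∀ j : ℕ, t + j ≠ 0 := fun j => Tempered.add_natCast_ne_zero j ht
  have hq : ∀ j, Polynomial.aeval t (q j) = t + j := fun j => by simp [q]
  have hN := congrArg (Polynomial.aeval t) (sub_eq_iff_eq_add.mp (hE.symm.trans hP))
  simp only [map_add, map_mul, map_sum, map_prod, hq, Polynomial.aeval_C] at hN
  have hprod : ∏ j ∈ s, (t + (j : ℂ)) ≠ 0 := Finset.prod_ne_zero_iff.mpr fun j _ => hne j
  rw [hN, Finset.prod_inv_distrib, ← div_eq_mul_inv, div_eq_iff hprod, add_mul, mul_comm (∏ j ∈ s, _),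
    add_right_inj, Finset.sum_mul]
  refine Finset.sum_congr rfl fun k hk => ?_
  rw [← Finset.mul_prod_erase s _ hk, mul_assoc, inv_mul_cancel_left₀ (hne k)]
  rfl

/-- The residue of `R n` at `t = -k`. -/
def residue (n k : ℕ) : ℚ :=
  (-1) ^ (n + k) * (n.choose k : ℚ) * ((n + k).choose k : ℚ) ^ 3

lemma sum_residue (n : ℕ) : ∑ k ∈ Finset.range (n + 1), residue n k = a n := by
  rw [a]
  push_cast
  rw [Finset.mul_sum]
  refine Finset.sum_congr rfl fun k _ => ?_
  rw [residue, pow_add]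
  ring

lemma prod_erase_sub (k d : ℕ) :
    ∏ j ∈ (Finset.range (k + d + 1)).erase k, ((j : ℚ) - k) = (-1) ^ k * k ! * d ! := by
  induction d with
  | zero =>
    rw [add_zero, Finset.range_add_one, Finset.erase_insert Finset.notMem_range_self,
      ← Finset.prod_range_reflect]
    have h : ∀ j ∈ Finset.range k, (((k - 1 - j : ℕ) : ℚ) - k) = -1 * ((j + 1 : ℕ) : ℚ) := by
      intro j hj
      have := Finset.mem_range.mp hj
      rw [show k - 1 - j = k - (j + 1) by omega, Nat.cast_sub (by omega)]
      ring
    rw [Finset.prod_congr rfl h, Finset.prod_mul_distrib, Finset.prod_const, Finset.card_range,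
      ← Nat.cast_prod, Finset.prod_range_add_one_eq_factorial]
    simp
  | succ d ih =>
    rw [← add_assoc, Finset.range_add_one, Finset.erase_insert_of_ne (by omega),
      Finset.prod_insert (by simp), ih, Nat.factorial_succ]
    push_cast
    ring

lemma prod_Icc_neg_sub (n k : ℕ) :
    ∏ j ∈ Finset.Icc 1 n, (-(k : ℚ) - j) = (-1) ^ n * ((n + k) ! / k !) := by
  induction n with
  | zero => simp [Nat.factorial_ne_zero]
  | succ n ih =>
    rw [Finset.prod_Icc_succ_top (by omega), ih, show n + 1 + k = (n + k) + 1 by omega,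
      Nat.factorial_succ]
    push_cast
    ring

lemma exists_isZetaForm_R (n : ℕ) : ∃ b d : ℚ, IsZetaForm (R n) (a n) b d := by
  obtain ⟨P, hP⟩ := exists_partial_fraction (Polynomial.C (((n ! : ℚ) ^ 2)⁻¹) *
    (∏ j ∈ Finset.Icc 1 n, (Polynomial.X - Polynomial.C (j : ℚ))) ^ 3) n (residue n) fun k hk => by
      obtain ⟨d, rfl⟩ := Nat.exists_eq_add_of_le (Nat.lt_succ_iff.mp (Finset.mem_range.mp hk))
      have h1 := Nat.cast_add_choose ℚ (a := k) (b := d)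
      have h2 := Nat.cast_add_choose ℚ (a := k) (b := k + d)
      have e0 : ∀ m : ℕ, (m ! : ℚ) ≠ 0 := fun m => by exact_mod_cast Nat.factorial_ne_zero m
      simp only [Polynomial.eval_mul, Polynomial.eval_C, Polynomial.eval_pow, Polynomial.eval_prod,
        Polynomial.eval_sub, Polynomial.eval_X]
      rw [prod_erase_sub, prod_Icc_neg_sub, residue, add_comm (k + d) k, h1, h2]
      have e1 := e0 k
      have e2 := e0 d
      have e3 := e0 (k + d)
      have e5 : ((-1 : ℚ) ^ d) ^ 2 = 1 := by rw [← pow_mul, mul_comm, pow_mul]; norm_num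
      field_simp
      simp only [pow_add]
      linear_combination (-((-1 : ℚ) ^ k) ^ 3 * (-1) ^ d) * e5
  obtain ⟨b, d, hbd⟩ := isZetaForm_polynomial P
  have h := hbd.add (IsZetaForm.sum (Finset.range (n + 1)) fun k _ =>
    (IsZetaForm.inv_add_natCast k).const_mul (residue n k))
  simp only [mul_one, zero_add, sum_residue] at h
  refine ⟨_, _, h.congr fun t ht => ?_⟩
  rw [← hP t ht, R_eq, ← mul_assoc]
  simp

/-- The rational part of the linear form in `1` and `ζ(2)`. -/
def bTwo (n : ℕ) : ℚ := (exists_isZetaForm_R n).choose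

/-- The rational part of the linear form in `1` and `ζ(3)`. -/
def bThree (n : ℕ) : ℚ := (exists_isZetaForm_R n).choose_spec.choose

lemma isZetaForm_R (n : ℕ) : IsZetaForm (R n) (a n) (bTwo n) (bThree n) :=
  (exists_isZetaForm_R n).choose_spec.choose_spec

lemma rt_eq (n : ℕ) : rt n = (a n : ℂ) * riemannZeta 2 - (bTwo n : ℂ) := by
  rw [rt_eq_J, (isZetaForm_R n).two]
  push_cast
  rfl

lemma rtt_eq (n : ℕ) : rtt n = (a n : ℂ) * riemannZeta 3 - (bThree n : ℂ) := by
  rw [rtt_eq_J, (isZetaForm_R n).three]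
  push_cast
  rfl

lemma IsZetaForm.unique {f : ℂ → ℂ} {c b d b' d' : ℚ} (h : IsZetaForm f c b d)
    (h' : IsZetaForm f c b' d') : b = b' ∧ d = d' := by
  have h2 := h.two.symm.trans h'.two
  have h3 := h.three.symm.trans h'.three
  rw [sub_right_inj] at h2 h3
  exact ⟨by exact_mod_cast h2, by exact_mod_cast h3⟩

lemma a_zero : a 0 = 1 := by decide

lemma a_one : a 1 = 7 := by decide

lemma a_two : a 2 = 163 := by decide

lemma b_zero : bTwo 0 = 0 ∧ bThree 0 = 0 := by
  have h := isZetaForm_R 0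
  rw [a_zero] at h
  refine h.unique ((IsZetaForm.inv_add_natCast 0).congr fun t _ => ?_)
  simp [R]

/-- `R₁(t) = t - 4 - 1/t + 8/(t + 1)`. -/
lemma b_one : bTwo 1 = 23 / 2 ∧ bThree 1 = 17 / 2 := by
  have h := isZetaForm_R 1
  rw [a_one] at h
  have h' := (((IsZetaForm.pow 1).add ((IsZetaForm.pow 0).const_mul (-4))).add
    ((IsZetaForm.inv_add_natCast 0).const_mul (-1))).add ((IsZetaForm.inv_add_natCast 1).const_mul 8)
  norm_num at h h'
  refine h.unique (h'.congr fun t ht => ?_)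
  have h0 : t ≠ 0 := by simpa using Tempered.add_natCast_ne_zero 0 ht
  have h1 : t + 1 ≠ 0 := by simpa using Tempered.add_natCast_ne_zero 1 ht
  simp [R, Finset.prod_range_succ]
  field_simp
  ring

/-- `R₂(t) = t³/4 - 3t² + 67t/4 - 60 + 1/t - 54/(t + 1) + 216/(t + 2)`. -/
lemma b_two : bTwo 2 = 2145 / 8 ∧ bThree 2 = 3135 / 16 := by
  have h := isZetaForm_R 2
  rw [a_two] at h
  have h' := ((((((IsZetaForm.pow 3).const_mul (1 / 4)).add ((IsZetaForm.pow 2).const_mul (-3))).add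
    ((IsZetaForm.pow 1).const_mul (67 / 4))).add ((IsZetaForm.pow 0).const_mul (-60))).add
    (IsZetaForm.inv_add_natCast 0)).add (((IsZetaForm.inv_add_natCast 1).const_mul (-54)).add
    ((IsZetaForm.inv_add_natCast 2).const_mul 216))
  norm_num [Finset.sum_range_succ] at h h'
  refine h.unique (h'.congr fun t ht => ?_)
  have h0 : t ≠ 0 := by simpa using Tempered.add_natCast_ne_zero 0 ht
  have h1 : t + 1 ≠ 0 := by simpa using Tempered.add_natCast_ne_zero 1 ht
  have h2 : t + 2 ≠ 0 := by simpa using Tempered.add_natCast_ne_zero 2 ht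
  simp [R, Finset.prod_range_succ, Finset.prod_Icc_succ_top]
  field_simp
  ring

/-! ### Creative telescoping and the recurrence -/

/-- The polynomial `s(n, t)` of the telescoping certificate. -/
def cert {K : Type*} [CommRing K] (n t : K) : K :=
  (-2448 * n ^ 3 - 5928 * n ^ 4 + 19029 * n ^ 5 + 67467 * n ^ 6 - 28855 * n ^ 7
    - 261999 * n ^ 8 - 220418 * n ^ 9)
  + (7344 * n ^ 2 + 21952 * n ^ 3 - 61907 * n ^ 4 - 226361 * n ^ 5 + 110585 * n ^ 6
    + 830029 * n ^ 7 + 638550 * n ^ 8) * t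
  + (-7344 * n - 23664 * n ^ 2 + 58126 * n ^ 3 + 246350 * n ^ 4 - 85043 * n ^ 5
    - 893927 * n ^ 6 - 719906 * n ^ 7) * t ^ 2
  + (2448 + 10336 * n - 16058 * n ^ 2 - 105382 * n ^ 3 - 1651 * n ^ 4 + 373197 * n ^ 5
    + 343398 * n ^ 6) * t ^ 3
  + (-1224 + 943 * n + 7434 * n ^ 2 + 4253 * n ^ 3 - 27606 * n ^ 4 - 34056 * n ^ 5) * t ^ 4
  + (-1377 + 2907 * n + 6276 * n ^ 2 - 9546 * n ^ 3 - 17028 * n ^ 4) * t ^ 5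
  + (153 - 425 * n - 516 * n ^ 2 + 1892 * n ^ 3) * t ^ 6

/-- Coefficient of `u (n + 1)` in the recurrence. -/
def coeffA {K : Type*} [CommRing K] (n : K) : K :=
  2 * (946 * n ^ 2 - 731 * n + 153) * (2 * n + 1) * (n + 1) ^ 3

/-- Minus the coefficient of `u n` in the recurrence. -/
def coeffB {K : Type*} [CommRing K] (n : K) : K :=
  2 * (104060 * n ^ 6 + 127710 * n ^ 5 + 12788 * n ^ 4 - 34525 * n ^ 3
    - 8482 * n ^ 2 + 3298 * n + 1071)

/-- Coefficient of `u (n - 1)` in the recurrence. -/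
def coeffC {K : Type*} [CommRing K] (n : K) : K :=
  2 * (3784 * n ^ 5 - 1032 * n ^ 4 - 1925 * n ^ 3 + 853 * n ^ 2 + 328 * n - 184) * n

/-- Minus the coefficient of `u (n - 2)` in the recurrence. -/
def coeffD {K : Type*} [CommRing K] (n : K) : K :=
  (946 * n ^ 2 + 1161 * n + 368) * n * (n - 1) ^ 3

lemma recurrence_iff {K : Type*} [CommRing K] (u : ℕ → K) : Recurrence u ↔
    ∀ m : ℕ, coeffA (m + 2 : K) * u (m + 3) - coeffB (m + 2 : K) * u (m + 2)
      + coeffC (m + 2 : K) * u (m + 1) - coeffD (m + 2 : K) * u m = 0 := by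
  constructor
  · intro h m
    have := h (m + 2) (by omega)
    simpa [coeffA, coeffB, coeffC, coeffD] using this
  · intro h n hn
    obtain ⟨m, rfl⟩ := Nat.exists_eq_add_of_le' hn
    have := h m
    simpa [coeffA, coeffB, coeffC, coeffD] using this

section

variable {K L : Type*} [CommRing K] [CommRing L] (f : K →+* L)

lemma map_recurrence (u : ℕ → K) (m : ℕ) :
    f (coeffA (m + 2 : K) * u (m + 3) - coeffB (m + 2 : K) * u (m + 2)
      + coeffC (m + 2 : K) * u (m + 1) - coeffD (m + 2 : K) * u m)
    = coeffA (m + 2 : L) * f (u (m + 3)) - coeffB (m + 2 : L) * f (u (m + 2))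
      + coeffC (m + 2 : L) * f (u (m + 1)) - coeffD (m + 2 : L) * f (u m) := by
  simp only [coeffA, coeffB, coeffC, coeffD, map_sub, map_add, map_mul, map_pow, map_natCast,
    map_one, map_ofNat]

lemma Recurrence.map {u : ℕ → K} (h : Recurrence u) : Recurrence fun n => f (u n) := by
  rw [recurrence_iff] at *
  exact fun m => by rw [← map_recurrence, h m, map_zero]

lemma Recurrence.of_map {u : ℕ → K} (hf : Function.Injective f)
    (h : Recurrence fun n => f (u n)) : Recurrence u := by
  rw [recurrence_iff] at *
  exact fun m => hf (by rw [map_recurrence, h m, map_zero])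

end

/-- The polynomial identity behind the telescoping, after division by the common factor of
`R (n + 1), R n, R (n - 1), R (n - 2)`. -/
lemma cert_identity {K : Type*} [CommRing K] (n t : K) :
    2 * (946 * n ^ 2 - 731 * n + 153) * (2 * n + 1) * (n + 1)
        * ((t - (n - 1)) * (t - n) * (t - (n + 1))) ^ 3
      - coeffB n * (((t - (n - 1)) * (t - n)) ^ 3 * (t + n + 1))
      + coeffC n * (n ^ 2 * (t - (n - 1)) ^ 3 * (t + n) * (t + n + 1))
      - coeffD n * (n ^ 2 * (n - 1) ^ 2 * (t + (n - 1)) * (t + n) * (t + n + 1))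
      = t ^ 4 * cert n (t + 1) - (t - (n - 1)) ^ 3 * (t + n + 1) * cert n t := by
  unfold coeffB coeffC coeffD cert
  ring

/-- The certificate `S(t)`: the recurrence operator applied to `R` at `n = m + 2` gives
`S(t + 1) - S(t)`. -/
def telescoper (m : ℕ) (t : ℂ) : ℂ :=
  (∏ j ∈ Finset.Icc 1 (m + 1), (t - j)) ^ 3 * cert (m + 2 : ℂ) t
    * ((((m + 2) ! : ℂ) ^ 2)⁻¹ * ∏ j ∈ Finset.range (m + 3), (t + j)⁻¹)

lemma prod_Icc_add_one_sub (m : ℕ) (t : ℂ) :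
    ∏ j ∈ Finset.Icc 1 (m + 1), (t + 1 - j) = t * ∏ j ∈ Finset.Icc 1 m, (t - j) := by
  induction m with
  | zero => simp
  | succ m ih =>
    rw [Finset.prod_Icc_succ_top (by omega), ih, Finset.prod_Icc_succ_top (by omega)]
    push_cast
    ring

lemma mul_prod_range_add_one (m : ℕ) (t : ℂ) :
    t * ∏ j ∈ Finset.range m, (t + 1 + j) = (∏ j ∈ Finset.range m, (t + j)) * (t + m) := by
  induction m with
  | zero => simp
  | succ m ih =>
    rw [Finset.prod_range_succ, ← mul_assoc, ih, Finset.prod_range_succ]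
    push_cast
    ring

lemma telescoping (m : ℕ) {t : ℂ} (ht : 0 < t.re) :
    coeffA (m + 2 : ℂ) * R (m + 3) t - coeffB (m + 2 : ℂ) * R (m + 2) t
      + coeffC (m + 2 : ℂ) * R (m + 1) t - coeffD (m + 2 : ℂ) * R m t
      = telescoper m (t + 1) - telescoper m t := by
  have hne : ∀ j : ℕ, t + j ≠ 0 := fun j => Tempered.add_natCast_ne_zero j ht
  have h0 : t ≠ 0 := by simpa using hne 0
  have hm1 : t + (m + 1) ≠ 0 := by simpa using hne (m + 1)
  have hm2 : t + (m + 2) ≠ 0 := by simpa using hne (m + 2)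
  have hm3 : t + (m + 3) ≠ 0 := by simpa using hne (m + 3)
  have hf : (m ! : ℂ) ≠ 0 := by exact_mod_cast Nat.factorial_ne_zero m
  have k1 : ((m : ℂ) + 1) ≠ 0 := by exact_mod_cast Nat.succ_ne_zero m
  have k2 : ((m : ℂ) + 2) ≠ 0 := by exact_mod_cast Nat.succ_ne_zero (m + 1)
  have k3 : ((m : ℂ) + 3) ≠ 0 := by exact_mod_cast Nat.succ_ne_zero (m + 2)
  have hD : ∏ j ∈ Finset.range (m + 1), (t + (j : ℂ)) ≠ 0 :=
    Finset.prod_ne_zero_iff.mpr fun j _ => hne j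
  have hS1 : ∏ j ∈ Finset.range (m + 3), (t + 1 + (j : ℂ))
      = (∏ j ∈ Finset.range (m + 1), (t + (j : ℂ))) * (t + (m + 1)) * (t + (m + 2)) * (t + (m + 3))
        / t := by
    rw [eq_div_iff h0, mul_comm, mul_prod_range_add_one, Finset.prod_range_succ,
      Finset.prod_range_succ]
    push_cast
    ring
  have hid := cert_identity (m + 2 : ℂ) t
  have e1 : (t + (m + 2 - 1)) = t + (m + 1) := by ring
  have e3 : (t + (m + 2) + 1) = t + (m + 3) := by ring
  have e1' : (t - (m + 2 - 1)) = t - (m + 1) := by ring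
  have e3' : (t - (m + 2 + 1)) = t - (m + 3) := by ring
  have e2 : (m + 2 - 1 : ℂ) = m + 1 := by ring
  rw [e1, e3, e1', e3', e2] at hid
  simp only [R, telescoper, prod_Icc_add_one_sub, Finset.prod_inv_distrib, hS1]
  simp only [Finset.prod_range_succ _ (m + 3), Finset.prod_range_succ _ (m + 2),
    Finset.prod_range_succ _ (m + 1), Finset.prod_Icc_succ_top (show 1 ≤ m + 2 + 1 by omega),
    Finset.prod_Icc_succ_top (show 1 ≤ m + 1 + 1 by omega),
    Finset.prod_Icc_succ_top (show 1 ≤ m + 1 by omega), Nat.factorial_succ]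
  have c1 : ((m + 1 : ℕ) : ℂ) = m + 1 := by push_cast; rfl
  have c2 : ((m + 1 + 1 : ℕ) : ℂ) = m + 2 := by push_cast; ring
  have c3 : ((m + 2 + 1 : ℕ) : ℂ) = m + 3 := by push_cast; ring
  simp only [Nat.cast_mul, c1, c2, c3]
  generalize ∏ j ∈ Finset.Icc 1 m, (t - (j : ℂ)) = Q
  generalize ∏ j ∈ Finset.range (m + 1), (t + (j : ℂ)) = D at hD ⊢
  have hA : coeffA (m + 2 : ℂ) = 2 * (946 * (m + 2 : ℂ) ^ 2 - 731 * (m + 2) + 153)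
      * (2 * (m + 2) + 1) * (m + 2 + 1) * (m + 3) ^ 2 := by rw [coeffA]; ring
  rw [hA]
  generalize 2 * (946 * (m + 2 : ℂ) ^ 2 - 731 * (m + 2) + 153) * (2 * (m + 2) + 1) * (m + 2 + 1) = A'
    at hid ⊢
  generalize coeffB (m + 2 : ℂ) = B' at hid ⊢
  generalize coeffC (m + 2 : ℂ) = C' at hid ⊢
  generalize coeffD (m + 2 : ℂ) = D' at hid ⊢
  generalize cert (m + 2 : ℂ) t = s0 at hid ⊢
  generalize cert (m + 2 : ℂ) (t + 1) = s1 at hid ⊢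
  generalize (m ! : ℂ) = F at hf ⊢
  generalize t - ((m : ℂ) + 1) = q1 at hid ⊢
  generalize t - ((m : ℂ) + 2) = q2 at hid ⊢
  generalize t - ((m : ℂ) + 3) = q3 at hid ⊢
  generalize t + ((m : ℂ) + 1) = d1 at hid hm1 ⊢
  generalize t + ((m : ℂ) + 2) = d2 at hid hm2 ⊢
  generalize t + ((m : ℂ) + 3) = d3 at hid hm3 ⊢
  generalize (m : ℂ) + 1 = n1 at hid k1 ⊢
  generalize (m : ℂ) + 2 = n2 at hid k2 ⊢
  generalize (m : ℂ) + 3 = n3 at k3 ⊢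
  trans Q ^ 3 / ((F * n1 * n2) ^ 2 * D * d1 * d2 * d3) * (t ^ 4 * s1 - q1 ^ 3 * d3 * s0)
  · rw [← hid]
    field_simp
  · field_simp

/-- The certificate has a triple zero at `t = 1`, so neither it nor its derivative contributes a
residue there. -/
lemma deriv_eq_zero_of_triple_zero {S G : ℂ → ℂ} (hG : Tempered G)
    (hS : ∀ t : ℂ, 0 < t.re → S t = (t - 1) ^ 3 * G t) :
    deriv S 1 = 0 ∧ deriv (deriv S) 1 = 0 := by
  have h1 : ∀ t : ℂ, 0 < t.re →
      deriv S t = (t - 1) ^ 2 * (3 * G t + (t - 1) * deriv G t) := fun t ht => by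
    rw [deriv_congr_rightHalfPlane hS ht]
    have h := (((hasDerivAt_id t).sub_const 1).pow 3).mul (hG.differentiableAt ht).hasDerivAt
    refine Eq.trans (by rfl) (h.deriv.trans ?_)
    simp
    ring
  refine ⟨by rw [h1 1 (by simp)]; simp, ?_⟩
  have hH : Tempered fun t => 3 * G t + (t - 1) * deriv G t :=
    (hG.const_mul 3).add ((Tempered.id.sub (.const 1)).mul hG.deriv)
  rw [deriv_congr_rightHalfPlane h1 (by simp)]
  have h := (((hasDerivAt_id (1 : ℂ)).sub_const 1).pow 2).mul
    (hH.differentiableAt (t := 1) (by simp)).hasDerivAt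
  refine Eq.trans (by rfl) (h.deriv.trans ?_)
  simp

lemma tempered_cert (n : ℂ) : Tempered fun t => cert n t := by
  have h : ∀ c₀ c₁ c₂ c₃ c₄ c₅ c₆ : ℂ, Tempered fun t => c₀ + c₁ * t + c₂ * t ^ 2 + c₃ * t ^ 3
      + c₄ * t ^ 4 + c₅ * t ^ 5 + c₆ * t ^ 6 := fun c₀ c₁ c₂ c₃ c₄ c₅ c₆ =>
    ((((((Tempered.const c₀).add (Tempered.id.const_mul c₁)).add
      ((Tempered.id.pow 2).const_mul c₂)).add ((Tempered.id.pow 3).const_mul c₃)).add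
      ((Tempered.id.pow 4).const_mul c₄)).add ((Tempered.id.pow 5).const_mul c₅)).add
      ((Tempered.id.pow 6).const_mul c₆)
  exact h _ _ _ _ _ _ _

lemma telescoper_spec (m : ℕ) : Tempered (telescoper m) ∧
    deriv (telescoper m) 1 = 0 ∧ deriv (deriv (telescoper m)) 1 = 0 := by
  have hG1 : Tempered fun t => (∏ j ∈ Finset.Icc 2 (m + 1), (t - (j : ℂ))) ^ 3 :=
    (Tempered.prod (Finset.Icc 2 (m + 1)) fun j _ => Tempered.id.sub (.const (j : ℂ))).pow 3
  have hG2 : Tempered fun t =>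
      (((m + 2) ! : ℂ) ^ 2)⁻¹ * ∏ j ∈ Finset.range (m + 3), (t + (j : ℂ))⁻¹ :=
    (Tempered.prod (Finset.range (m + 3)) fun j _ => .inv_add_natCast j).const_mul _
  have hG : Tempered fun t => (∏ j ∈ Finset.Icc 2 (m + 1), (t - (j : ℂ))) ^ 3 * cert (m + 2 : ℂ) t
      * ((((m + 2) ! : ℂ) ^ 2)⁻¹ * ∏ j ∈ Finset.range (m + 3), (t + (j : ℂ))⁻¹) :=
    (hG1.mul (tempered_cert (m + 2 : ℂ))).mul hG2
  have hS : ∀ t : ℂ, 0 < t.re → telescoper m t = (t - 1) ^ 3 *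
      ((∏ j ∈ Finset.Icc 2 (m + 1), (t - (j : ℂ))) ^ 3 * cert (m + 2 : ℂ) t
      * ((((m + 2) ! : ℂ) ^ 2)⁻¹ * ∏ j ∈ Finset.range (m + 3), (t + (j : ℂ))⁻¹)) := fun t _ => by
    rw [telescoper, ← Finset.mul_prod_Ioc_eq_prod_Icc (by omega : 1 ≤ m + 1),
      show Finset.Ioc 1 (m + 1) = Finset.Icc 2 (m + 1) from rfl]
    push_cast
    ring
  exact ⟨(((Tempered.id.sub (.const 1)).pow 3).mul hG).congr hS,
    deriv_eq_zero_of_triple_zero hG hS⟩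

lemma J_four {f₁ f₂ f₃ f₄ : ℂ → ℂ} (h₁ : Tempered f₁) (h₂ : Tempered f₂) (h₃ : Tempered f₃)
    (h₄ : Tempered f₄) (c₁ c₂ c₃ c₄ : ℂ) :
    J (fun t => c₁ * f₁ t - c₂ * f₂ t + c₃ * f₃ t - c₄ * f₄ t)
      = c₁ * J f₁ - c₂ * J f₂ + c₃ * J f₃ - c₄ * J f₄ := by
  have e : (fun t => c₁ * f₁ t - c₂ * f₂ t + c₃ * f₃ t - c₄ * f₄ t)
      = fun t => ((c₁ * f₁ t + -c₂ * f₂ t) + c₃ * f₃ t) + -c₄ * f₄ t := by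
    funext t; ring
  have g₁ := h₁.const_mul c₁
  have g₂ := h₂.const_mul (-c₂)
  have g₃ := h₃.const_mul c₃
  rw [e, J_add ((g₁.add g₂).add g₃) (h₄.const_mul _), J_add (g₁.add g₂) g₃, J_add g₁ g₂]
  simp only [J_const_mul]
  ring

lemma J_telescoper_sub {S : ℂ → ℂ} (hS : Tempered S) (h : deriv S 1 = 0) :
    J (fun t => S (t + 1) - S t) = 0 := by
  have h1 : Tempered fun t => S (t + 1) := by simpa using hS.comp_add_natCast 1
  have e : (fun t => S (t + 1) - S t) = fun t => S (t + 1) + -1 * S t := by funext t; ring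
  rw [e, J_add h1 (hS.const_mul _), J_const_mul, J_shift hS, h]
  ring

theorem recurrence_rt : Recurrence rt := by
  refine (recurrence_iff _).mpr fun m => ?_
  simp only [rt_eq_J]
  rw [← J_four (tempered_R _) (tempered_R _) (tempered_R _) (tempered_R _),
    J_congr fun t ht => telescoping m ht]
  exact J_telescoper_sub (telescoper_spec m).1 (telescoper_spec m).2.1

theorem recurrence_rtt : Recurrence rtt := by
  refine (recurrence_iff _).mpr fun m => ?_
  simp only [rtt_eq_J]
  have key : J (fun t => coeffA (m + 2 : ℂ) * deriv (R (m + 3)) t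
      - coeffB (m + 2 : ℂ) * deriv (R (m + 2)) t
      + coeffC (m + 2 : ℂ) * deriv (R (m + 1)) t - coeffD (m + 2 : ℂ) * deriv (R m) t) = 0 := by
    rw [← J_telescoper_sub (telescoper_spec m).1.deriv (telescoper_spec m).2.2]
    refine J_congr fun t ht => ?_
    have hd : ∀ k : ℕ, HasDerivAt (R k) (deriv (R k) t) t := fun k =>
      ((tempered_R k).differentiableAt ht).hasDerivAt
    have hT : HasDerivAt (fun t => telescoper m (t + 1) - telescoper m t)
        (deriv (telescoper m) (t + 1) - deriv (telescoper m) t) t :=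
      (((telescoper_spec m).1.differentiableAt (t := t + 1)
        (by simp; linarith)).hasDerivAt.comp_add_const t 1).sub
        ((telescoper_spec m).1.differentiableAt ht).hasDerivAt
    rw [← hT.deriv, ← deriv_congr_rightHalfPlane (fun t ht => telescoping m ht) ht]
    exact ((((((hd (m + 3)).const_mul _).sub ((hd (m + 2)).const_mul _)).add
      ((hd (m + 1)).const_mul _)).sub ((hd m).const_mul _)).deriv).symm
  rw [J_four (tempered_R _).deriv (tempered_R _).deriv (tempered_R _).deriv
    (tempered_R _).deriv] at key
  linear_combination (-(1 / 2) : ℂ) * key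

/-! The same certificate, read off at the poles `t = -k`, telescopes the sum of residues. -/

lemma residue_succ_left (N k : ℕ) :
    residue (N + 1) k * ((N + 1 - k) * (N + 1) ^ 2) = -(residue N k * (N + 1 + k) ^ 3) := by
  have h1 : ((N + 1).choose k : ℚ) * (N + 1 - k) = (N + 1) * N.choose k := by
    rcases le_or_gt k (N + 1) with h | h
    · have := Nat.choose_mul_succ_eq N k
      rw [← Nat.cast_succ, ← Nat.cast_sub h]
      exact_mod_cast (this.symm.trans (mul_comm _ _))
    · rw [Nat.choose_eq_zero_of_lt h, Nat.choose_eq_zero_of_lt (by omega)]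
      simp
  have h2 : ((N + 1 + k).choose k : ℚ) * (N + 1) = (N + 1 + k) * (N + k).choose k := by
    have := Nat.choose_mul_succ_eq (N + k) k
    rw [show N + k + 1 - k = N + 1 by omega, show N + k + 1 = N + 1 + k by omega] at this
    exact_mod_cast (this.symm.trans (mul_comm _ _))
  have h3 : (((N + 1 + k).choose k : ℚ) * (N + 1)) ^ 3 = ((N + 1 + k) * (N + k).choose k) ^ 3 := by
    rw [h2]
  have hN : ((N : ℚ) + 1) ≠ 0 := by positivity
  unfold residue
  refine mul_left_cancel₀ hN ?_
  rw [show N + 1 + k = (N + k) + 1 by omega] at h3 ⊢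
  rw [pow_succ]
  linear_combination (-(-1 : ℚ) ^ (N + k)) * (((N + 1).choose k : ℚ) * (N + 1 - k) * h3
    + (N + 1 + k) ^ 3 * ((N + k).choose k : ℚ) ^ 3 * h1)

lemma residue_succ_right (N k : ℕ) :
    residue N (k + 1) * (k + 1) ^ 4 = -(residue N k * ((N - k) * (N + k + 1) ^ 3)) := by
  have h1 : (N.choose (k + 1) : ℚ) * (k + 1) = N.choose k * (N - k) := by
    rcases le_or_gt k N with h | h
    · have := Nat.choose_succ_right_eq N k
      rw [← Nat.cast_sub h]
      exact_mod_cast this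
    · rw [Nat.choose_eq_zero_of_lt h, Nat.choose_eq_zero_of_lt (by omega)]
      simp
  have h2 : ((N + (k + 1)).choose (k + 1) : ℚ) * (k + 1) = (N + k + 1) * (N + k).choose k := by
    have := Nat.add_one_mul_choose_eq (N + k) k
    exact_mod_cast this.symm
  have h3 : (((N + (k + 1)).choose (k + 1) : ℚ) * (k + 1)) ^ 3
      = ((N + k + 1) * (N + k).choose k) ^ 3 := by rw [h2]
  unfold residue
  rw [show (-1 : ℚ) ^ (N + (k + 1)) = -(-1) ^ (N + k) by rw [← add_assoc, pow_succ]; ring]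
  linear_combination (-(-1 : ℚ) ^ (N + k)) * ((N.choose (k + 1) : ℚ) * (k + 1) * h3
    + (N + k + 1) ^ 3 * ((N + k).choose k : ℚ) ^ 3 * h1)

lemma sum_residue_of_le {N M : ℕ} (h : N ≤ M) :
    ∑ k ∈ Finset.range (M + 1), residue N k = a N := by
  rw [← sum_residue]
  refine (Finset.sum_subset (Finset.range_mono (by omega)) fun k _ hk => ?_).symm
  rw [residue, Nat.choose_eq_zero_of_lt (by simpa using hk)]
  simp

theorem recurrence_a : Recurrence a := by
  have hQ : Recurrence fun n => Int.castRingHom ℚ (a n) := by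
    simp only [eq_intCast]
    refine (recurrence_iff _).mpr fun m => ?_
    -- the residue at `-k` of the common factor of the four rational functions
    obtain ⟨w, hw⟩ : ∃ w : ℕ → ℚ, ∀ k, w k = -(residue (m + 3) k * (m + 3) ^ 2)
      / ((m + 1 + k) * (m + 2 + k) * (m + 3 + k)) ^ 3 := ⟨_, fun _ => rfl⟩
    have p1 : ∀ k : ℕ, (m + 1 + k : ℚ) ≠ 0 := fun k => by positivity
    have p2 : ∀ k : ℕ, (m + 2 + k : ℚ) ≠ 0 := fun k => by positivity
    have p3 : ∀ k : ℕ, (m + 3 + k : ℚ) ≠ 0 := fun k => by positivity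
    have r0 : ∀ k : ℕ, residue (m + 3) k * (m + 3) ^ 2
        = -(w k * ((m + 1 + k) * (m + 2 + k) * (m + 3 + k)) ^ 3) := fun k => by
      have := p1 k; have := p2 k; have := p3 k
      rw [hw]
      field_simp
    have r1 : ∀ k : ℕ, residue (m + 2) k = w k * ((m + 1 + k) * (m + 2 + k)) ^ 3 * (m + 3 - k) :=
      fun k => by
        have h := residue_succ_left (m + 2) k
        rw [show m + 2 + 1 = m + 3 from rfl] at h
        push_cast at h
        refine mul_right_cancel₀ (pow_ne_zero 3 (p3 k)) ?_
        linear_combination h - (m + 3 - k) * r0 k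
    have r2 : ∀ k : ℕ, residue (m + 1) k
        = -(w k * (m + 1 + k) ^ 3 * ((m + 3 - k) * (m + 2 - k) * (m + 2) ^ 2)) := fun k => by
      have h := residue_succ_left (m + 1) k
      rw [show m + 1 + 1 = m + 2 from rfl] at h
      push_cast at h
      refine mul_right_cancel₀ (pow_ne_zero 3 (p2 k)) ?_
      linear_combination h - (m + 2 - k) * (m + 2) ^ 2 * r1 k
    have r3 : ∀ k : ℕ, residue m k = w k * ((m + 3 - k) * (m + 2 - k) * (m + 1 - k)
        * (m + 2) ^ 2 * (m + 1) ^ 2) := fun k => by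
      have h := residue_succ_left m k
      refine mul_right_cancel₀ (pow_ne_zero 3 (p1 k)) ?_
      linear_combination h - (m + 1 - k) * (m + 1) ^ 2 * r2 k
    have hstep : ∀ k : ℕ, w (k + 1) * (k + 1) ^ 4 = -(w k * ((m + 3 - k) * (m + 1 + k) ^ 3)) :=
      fun k => by
        have h := residue_succ_right (m + 3) k
        push_cast at h
        have q1 := p1 k; have q2 := p2 k; have q3 := p3 k
        have q4 : (m + 3 + (k + 1) : ℚ) ≠ 0 := by positivity
        have e1 : (m + 1 + (k + 1) : ℚ) = m + 2 + k := by ring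
        have e2 : (m + 2 + (k + 1) : ℚ) = m + 3 + k := by ring
        simp only [hw]
        push_cast
        rw [e1, e2]
        field_simp
        linear_combination (-1 : ℚ) * h
    set G : ℕ → ℚ := fun k => w k * (k : ℚ) ^ 4 * cert (m + 2 : ℚ) (-(k : ℚ) + 1) with hG
    have hterm : ∀ k : ℕ, coeffA (m + 2 : ℚ) * residue (m + 3) k
        - coeffB (m + 2 : ℚ) * residue (m + 2) k + coeffC (m + 2 : ℚ) * residue (m + 1) k
        - coeffD (m + 2 : ℚ) * residue m k = G k - G (k + 1) := fun k => by
      have hid := cert_identity (m + 2 : ℚ) (-(k : ℚ))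
      have hA : coeffA (m + 2 : ℚ) = 2 * (946 * (m + 2 : ℚ) ^ 2 - 731 * (m + 2) + 153)
        * (2 * (m + 2) + 1) * (m + 2 + 1) * (m + 3) ^ 2 := by rw [coeffA]; ring
      have e : -((k + 1 : ℕ) : ℚ) + 1 = -k := by push_cast; ring
      simp only [hG]
      rw [e, hA, r1, r2, r3]
      push_cast
      generalize 2 * (946 * (m + 2 : ℚ) ^ 2 - 731 * (m + 2) + 153) * (2 * (m + 2) + 1)
        * (m + 2 + 1) = A' at hid ⊢
      generalize coeffB (m + 2 : ℚ) = B' at hid ⊢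
      generalize coeffC (m + 2 : ℚ) = C' at hid ⊢
      generalize coeffD (m + 2 : ℚ) = D' at hid ⊢
      generalize cert (m + 2 : ℚ) (-(k : ℚ)) = s0 at hid ⊢
      generalize cert (m + 2 : ℚ) (-(k : ℚ) + 1) = s1 at hid ⊢
      linear_combination w k * hid + A' * r0 k + s0 * hstep k
    have hend : w (m + 4) = 0 := by
      simp only [hw]
      rw [residue, Nat.choose_eq_zero_of_lt (by omega)]
      simp
    have htel := Finset.sum_range_sub' G (m + 4)
    simp_rw [← hterm, Finset.sum_sub_distrib, Finset.sum_add_distrib, Finset.sum_sub_distrib,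
      ← Finset.mul_sum] at htel
    rw [sum_residue, sum_residue_of_le (by omega : m + 2 ≤ m + 3),
      sum_residue_of_le (by omega : m + 1 ≤ m + 3), sum_residue_of_le (by omega : m ≤ m + 3)] at htel
    rw [htel]
    simp [hG, hend]
  exact hQ.of_map _ (Int.castRingHom ℚ).injective_int

lemma Recurrence.linear_sub {u v w : ℕ → ℂ} (c : ℂ) (hu : Recurrence u) (hv : Recurrence v)
    (h : ∀ n, v n = u n * c - w n) : Recurrence w := by
  rw [recurrence_iff] at *
  intro m
  have := hv m
  simp only [h] at this
  linear_combination c * hu m - this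

theorem recurrence_bTwo : Recurrence bTwo :=
  .of_map (algebraMap ℚ ℂ) (algebraMap ℚ ℂ).injective
    ((recurrence_a.map (Int.castRingHom ℂ)).linear_sub _ recurrence_rt rt_eq)

theorem recurrence_bThree : Recurrence bThree :=
  .of_map (algebraMap ℚ ℂ) (algebraMap ℚ ℂ).injective
    ((recurrence_a.map (Int.castRingHom ℂ)).linear_sub _ recurrence_rtt rtt_eq)

/-! ### The Barnes integrals are bounded in `n` -/

/-- The finite products increase to Euler's product for `sinh πy / πy`. -/
lemma mul_prod_le_sinh {y : ℝ} (hy : 0 ≤ y) (n : ℕ) :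
    Real.pi * y * ∏ j ∈ Finset.range n, (1 + y ^ 2 / ((j : ℝ) + 1) ^ 2) ≤ Real.sinh (Real.pi * y) := by
  have h := Complex.tendsto_euler_sin_prod (y * Complex.I)
  have h1 : ∀ n : ℕ, Real.pi * (y * Complex.I) * ∏ j ∈ Finset.range n,
      (1 - (y * Complex.I) ^ 2 / ((j : ℂ) + 1) ^ 2) = Complex.I *
      ((Real.pi * y * ∏ j ∈ Finset.range n, (1 + y ^ 2 / ((j : ℝ) + 1) ^ 2) : ℝ) : ℂ) := fun n => by
    have hj : ∀ j : ℕ, (1 - (y * Complex.I) ^ 2 / ((j : ℂ) + 1) ^ 2)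
        = 1 + (y : ℂ) ^ 2 / ((j : ℂ) + 1) ^ 2 := fun j => by rw [mul_pow, Complex.I_sq]; ring
    simp_rw [hj]
    push_cast
    ring
  have h2 : Complex.sin (Real.pi * (y * Complex.I))
      = Complex.I * (Real.sinh (Real.pi * y) : ℂ) := by
    rw [← mul_assoc, Complex.sin_mul_I]
    push_cast
    ring
  simp_rw [h1] at h
  rw [h2] at h
  have h3 := (Complex.continuous_im.tendsto _).comp h
  simp only [Function.comp_def, Complex.I_mul_im, Complex.ofReal_re] at h3
  refine Monotone.ge_of_tendsto (monotone_nat_of_le_succ fun k => ?_) h3 n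
  rw [Finset.prod_range_succ, ← mul_assoc]
  refine le_mul_of_one_le_right (by positivity) ?_
  have : 0 ≤ y ^ 2 / ((k : ℝ) + 1) ^ 2 := by positivity
  linarith

/-- Enlarging `|y|` to `|y| + 1` avoids dividing by a small `y`. -/
lemma prod_le_cosh (y : ℝ) (n : ℕ) :
    ∏ j ∈ Finset.range n, (1 + y ^ 2 / ((j : ℝ) + 1) ^ 2)
      ≤ 2 * Real.exp Real.pi * Real.cosh (Real.pi * y) := by
  have hY : 1 ≤ |y| + 1 := by linarith [abs_nonneg y]
  have h1 : ∏ j ∈ Finset.range n, (1 + y ^ 2 / ((j : ℝ) + 1) ^ 2)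
      ≤ ∏ j ∈ Finset.range n, (1 + (|y| + 1) ^ 2 / ((j : ℝ) + 1) ^ 2) := by
    refine Finset.prod_le_prod (fun j _ => by positivity) fun j _ => ?_
    gcongr 1 + ?_ / _
    rw [← sq_abs y]
    gcongr
    linarith
  have h2 := mul_prod_le_sinh (by linarith : 0 ≤ |y| + 1) n
  have h3 : 0 ≤ ∏ j ∈ Finset.range n, (1 + (|y| + 1) ^ 2 / ((j : ℝ) + 1) ^ 2) :=
    Finset.prod_nonneg fun j _ => by positivity
  have h4 : 1 ≤ Real.pi * (|y| + 1) := by nlinarith [Real.pi_gt_three]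
  have h5 : Real.sinh (Real.pi * (|y| + 1)) ≤ Real.exp (Real.pi * |y|) * Real.exp Real.pi := by
    rw [← Real.exp_add, Real.sinh_eq, mul_add, mul_one]
    linarith [Real.exp_pos (-(Real.pi * |y| + Real.pi)), Real.exp_pos (Real.pi * |y| + Real.pi)]
  have h6 := exp_half_le_cosh (Real.pi * y)
  rw [abs_mul, abs_of_pos Real.pi_pos] at h6
  nlinarith [Real.exp_pos Real.pi]

lemma norm_line_sub (y : ℝ) (j : ℕ) : ‖line y - ((j + 1 : ℕ) : ℂ)‖ = ‖line y + j‖ := by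
  have h : line y - ((j + 1 : ℕ) : ℂ) = -(starRingEnd ℂ) (line y + j) := by
    apply Complex.ext
    · simp [line]; ring
    · simp [line]
  rw [h, norm_neg, Complex.norm_conj]

lemma norm_prod_Icc_line_sub (y : ℝ) (n : ℕ) :
    ‖∏ j ∈ Finset.Icc 1 n, (line y - j)‖ = ∏ j ∈ Finset.range n, ‖line y + j‖ := by
  induction n with
  | zero => simp
  | succ n ih =>
    rw [Finset.prod_Icc_succ_top (by omega), norm_mul, ih, norm_line_sub, Finset.prod_range_succ]

lemma half_le_norm_line_add (y : ℝ) (j : ℕ) : 1 / 2 ≤ ‖line y + j‖ := by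
  refine le_trans ?_ (Complex.re_le_norm _)
  simp [line_re]

/-- On the line `Re t = 1/2` the factors `t - (j + 1)` and `t + j` have the same modulus, so two of the
four products cancel. -/
lemma norm_R_line_le (n : ℕ) (y : ℝ) :
    ‖R n (line y)‖ ≤ 4 * Real.exp Real.pi * Real.cosh (Real.pi * y) := by
  set P := ∏ j ∈ Finset.range n, ‖line y + j‖ with hP
  have hP0 : 0 < P := Finset.prod_pos fun j _ => lt_of_lt_of_le (by norm_num)
    (half_le_norm_line_add y j)
  have hfac : (n ! : ℝ) = ∏ j ∈ Finset.range n, ((j : ℝ) + 1) := by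
    rw [← Finset.prod_range_add_one_eq_factorial]; push_cast; rfl
  have hf0 : (0 : ℝ) < n ! := by positivity
  have h1 : P ^ 2 / (n ! : ℝ) ^ 2 ≤ ∏ j ∈ Finset.range n, (1 + y ^ 2 / ((j : ℝ) + 1) ^ 2) := by
    rw [hfac, ← div_pow, hP, ← Finset.prod_div_distrib, ← Finset.prod_pow]
    refine Finset.prod_le_prod (fun j _ => by positivity) fun j _ => ?_
    have h2 : ‖line y + j‖ ^ 2 = (1 / 2 + (j : ℝ)) ^ 2 + y ^ 2 := by
      rw [Complex.sq_norm, Complex.normSq_apply]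
      simp [line]
      ring
    rw [div_pow, h2, show 1 + y ^ 2 / ((j : ℝ) + 1) ^ 2
      = (((j : ℝ) + 1) ^ 2 + y ^ 2) / ((j : ℝ) + 1) ^ 2 by field_simp]
    refine div_le_div_of_nonneg_right ?_ (by positivity)
    nlinarith [Nat.cast_nonneg (α := ℝ) j]
  have hn : 0 < ‖line y + n‖ := lt_of_lt_of_le (by norm_num) (half_le_norm_line_add y n)
  have h2 : ‖R n (line y)‖ = P ^ 2 / (n ! : ℝ) ^ 2 / ‖line y + n‖ := by
    rw [R, norm_div, norm_mul, norm_pow, norm_pow, norm_prod_Icc_line_sub, Complex.norm_natCast,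
      Finset.prod_range_succ, norm_mul, norm_prod, ← hP]
    field_simp
  rw [h2, div_le_iff₀ hn]
  have h3 := h1.trans (prod_le_cosh y n)
  have h4 := half_le_norm_line_add y n
  have h5 : 0 < Real.exp Real.pi * Real.cosh (Real.pi * y) := by positivity
  nlinarith

lemma exists_integrable_bound : ∃ B : ℝ → ℝ, Integrable B ∧
    ∀ (n : ℕ) (y : ℝ), ‖R n (line y) * (sechSq y : ℂ)‖ ≤ B y := by
  obtain ⟨C, hC, hb⟩ := pow_mul_exp_neg_abs_le 0
  refine ⟨fun y => 8 * Real.exp Real.pi * Real.pi ^ 2 * (C * (1 + y ^ 2)⁻¹),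
    (integrable_inv_one_add_sq.const_mul C).const_mul _, fun n y => ?_⟩
  have hc := Real.cosh_pos (Real.pi * y)
  have h1 : (Real.cosh (Real.pi * y))⁻¹ ≤ 2 * Real.exp (-|y|) := by
    rw [Real.exp_neg, inv_le_comm₀ hc (by positivity), mul_inv, inv_inv]
    refine le_trans ?_ (exp_half_le_cosh _)
    have : Real.exp |y| ≤ Real.exp |Real.pi * y| := Real.exp_le_exp.mpr (by
      rw [abs_mul, abs_of_pos Real.pi_pos]
      nlinarith [Real.pi_gt_three, abs_nonneg y])
    linarith
  have h2 := hb y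
  rw [pow_zero, one_mul] at h2
  rw [norm_mul, Complex.norm_real, Real.norm_of_nonneg (sechSq_nonneg y)]
  calc ‖R n (line y)‖ * sechSq y
      ≤ (4 * Real.exp Real.pi * Real.cosh (Real.pi * y)) * sechSq y :=
        mul_le_mul_of_nonneg_right (norm_R_line_le n y) (sechSq_nonneg y)
    _ = 4 * Real.exp Real.pi * Real.pi ^ 2 * (Real.cosh (Real.pi * y))⁻¹ := by
        rw [sechSq]; field_simp
    _ ≤ 4 * Real.exp Real.pi * Real.pi ^ 2 * (2 * (C * (1 + y ^ 2)⁻¹)) := by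
        gcongr
        linarith
    _ = _ := by ring

lemma exists_bound_rt : ∃ C : ℝ, ∀ n, ‖rt n‖ ≤ C := by
  obtain ⟨B, hB, hb⟩ := exists_integrable_bound
  refine ⟨‖(1 / (2 * Real.pi) : ℂ)‖ * ∫ y, B y, fun n => ?_⟩
  rw [rt_eq_J, J, norm_mul]
  gcongr
  exact norm_integral_le_of_norm_le hB (Eventually.of_forall (hb n))

lemma exists_bound_rtt : ∃ C : ℝ, ∀ n, ‖rtt n‖ ≤ C := by
  obtain ⟨B, hB, hb⟩ := exists_integrable_bound
  refine ⟨‖(1 / (2 * Real.pi) : ℂ)‖ * ∫ y, Real.pi * B y, fun n => ?_⟩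
  rw [rtt, barnes_eq, norm_mul]
  gcongr
  refine norm_integral_le_of_norm_le (hB.const_mul _) (Eventually.of_forall fun y => ?_)
  exact (norm_kernelThree_line_le n y).trans (mul_le_mul_of_nonneg_left (hb n y) Real.pi_pos.le)

/-! ### Growth of solutions of linear recurrences of Poincaré type -/

lemma tendsto_zero_of_le_mul_add {q δ : ℕ → ℝ} {θ : ℝ} (hq : ∀ n, 0 ≤ q n) (hθ0 : 0 ≤ θ)
    (hθ : θ < 1) (hδ : Tendsto δ atTop (𝓝 0)) (h : ∀ᶠ n in atTop, q (n + 1) ≤ θ * q n + δ n) :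
    Tendsto q atTop (𝓝 0) := by
  rw [Metric.tendsto_atTop]
  intro e he
  have h1 : ∀ᶠ n in atTop, δ n < (1 - θ) * (e / 2) :=
    hδ.eventually_lt_const (by have : 0 < 1 - θ := by linarith
                               positivity)
  obtain ⟨N, hN⟩ := eventually_atTop.mp (h.and h1)
  have h2 : ∀ k, q (N + k) ≤ e / 2 + θ ^ k * q N := fun k => by
    induction k with
    | zero => simp; linarith
    | succ k ih =>
      have := hN (N + k) (by omega)
      rw [← add_assoc, pow_succ]
      nlinarith [this.1, this.2, mul_le_mul_of_nonneg_left ih hθ0]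
  have h3 : Tendsto (fun k => θ ^ k * q N) atTop (𝓝 0) := by
    simpa using (tendsto_pow_atTop_nhds_zero_of_lt_one hθ0 hθ).mul_const (q N)
  obtain ⟨M, hM⟩ := eventually_atTop.mp (h3.eventually_lt_const (by linarith : 0 < e / 2))
  refine ⟨N + M, fun n hn => ?_⟩
  have h4 := h2 (n - N)
  have h5 := hM (n - N) (by omega)
  rw [show N + (n - N) = n by omega] at h4
  rw [Real.dist_eq, sub_zero, abs_of_nonneg (hq n)]
  linarith

/-- The ratio test implies the root test, by Cesàro summation of logarithms. -/
lemma tendsto_root_of_tendsto_ratio {s : ℕ → ℝ} {r : ℝ} (hr : 0 < r)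
    (hs : ∀ᶠ n in atTop, 0 < s n) (h : Tendsto (fun n => s (n + 1) / s n) atTop (𝓝 r)) :
    Tendsto (fun n : ℕ => s n ^ (1 / (n : ℝ))) atTop (𝓝 r) := by
  have h1 : Tendsto (fun n => Real.log (s (n + 1)) - Real.log (s n)) atTop (𝓝 (Real.log r)) := by
    refine ((Real.continuousAt_log hr.ne').tendsto.comp h).congr' ?_
    filter_upwards [hs, (tendsto_add_atTop_nat 1).eventually hs] with n hn hn'
    exact Real.log_div hn'.ne' hn.ne'
  have h2 := h1.cesaro
  simp_rw [Finset.sum_range_sub (fun n => Real.log (s n))] at h2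
  have h3 : Tendsto (fun n : ℕ => (n : ℝ)⁻¹ * Real.log (s 0)) atTop (𝓝 0) := by
    simpa using (tendsto_inv_atTop_nhds_zero_nat (𝕜 := ℝ)).mul_const (Real.log (s 0))
  have h4 := (Real.continuous_exp.tendsto _).comp (h2.add h3)
  rw [add_zero, Real.exp_log hr] at h4
  refine h4.congr' ?_
  filter_upwards [hs] with n hn
  simp only [Function.comp_apply]
  rw [Real.rpow_def_of_pos hn, one_div]
  ring_nf

lemma tendsto_const_root {c : ℝ} (hc : 0 < c) :
    Tendsto (fun n : ℕ => c ^ (1 / (n : ℝ))) atTop (𝓝 1) := by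
  simpa [Function.comp_def] using (Real.continuousAt_const_rpow hc.ne').tendsto.comp
    (tendsto_one_div_atTop_nhds_zero_nat (𝕜 := ℝ))

/-- **Dichotomy.** Two nonnegative sequences that grow, up to relatively small coupling, like `λ ^ n` and
`ρ ^ n` with `ρ < λ`: either the second dominates throughout, or the first one takes over. -/
lemma growth_dichotomy {X W ε : ℕ → ℝ} {ρ l : ℝ} (hX : ∀ n, 0 ≤ X n) (hW : ∀ n, 0 ≤ W n)
    (hXW : ∀ n, 0 < X n + W n) (hε : Tendsto ε atTop (𝓝 0)) (hρ : 0 < ρ) (hl : ρ < l)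
    (hWs : ∀ n, |W (n + 1) - ρ * W n| ≤ ε n * (X n + W n))
    (hXs : ∀ n, |X (n + 1) - l * X n| ≤ ε n * (X n + W n)) :
    ((∀ᶠ n in atTop, X n < W n) ∧ Tendsto (fun n => W (n + 1) / W n) atTop (𝓝 ρ)) ∨
    ((∀ᶠ n in atTop, 0 < X n) ∧ Tendsto (fun n => W n / X n) atTop (𝓝 0) ∧
      Tendsto (fun n => X (n + 1) / X n) atTop (𝓝 l)) := by
  have hε0 : ∀ n, 0 ≤ ε n := fun n => by
    by_contra! h
    nlinarith [hXW n, abs_nonneg (W (n + 1) - ρ * W n), hWs n]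
  have hε2 : Tendsto (fun n => 2 * ε n) atTop (𝓝 0) := by simpa using hε.const_mul 2
  by_cases hev : ∀ᶠ n in atTop, X n < W n
  · refine Or.inl ⟨hev, tendsto_iff_norm_sub_tendsto_zero.mpr
      (squeeze_zero' (Eventually.of_forall fun n => norm_nonneg _) ?_ hε2)⟩
    filter_upwards [hev] with n hn
    have hWn : 0 < W n := (hX n).trans_lt hn
    rw [Real.norm_eq_abs, div_sub' hWn.ne', abs_div, abs_of_pos hWn, div_le_iff₀ hWn, mul_comm (W n)]
    nlinarith [hWs n, hε0 n]
  · right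
    -- Once the coupling is below `(l - ρ) / 8`, the relation `W ≤ X` persists at all later steps.
    have hη : 0 < (l - ρ) / 8 := by linarith
    obtain ⟨N, hN⟩ := eventually_atTop.mp (hε.eventually_lt_const hη)
    obtain ⟨n₀, hn₀, hle⟩ := frequently_atTop.mp (not_eventually.mp hev) N
    have hdom : ∀ n, n₀ ≤ n → W n ≤ X n := fun n hn => by
      induction n, hn using Nat.le_induction with
      | base => exact not_lt.mp hle
      | succ n hn ih =>
        have h1 := (abs_le.mp (hWs n)).2
        have h2 := (abs_le.mp (hXs n)).1
        have h3 := hN n (by omega)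
        have h4 : ε n * (X n + W n) ≤ (l - ρ) / 8 * (2 * X n) :=
          mul_le_mul h3.le (by linarith) (hXW n).le hη.le
        have h5 : ρ * W n ≤ ρ * X n := mul_le_mul_of_nonneg_left ih hρ.le
        nlinarith [hX n]
    have hpos : ∀ n, n₀ ≤ n → 0 < X n := fun n hn => by linarith [hdom n hn, hXW n, hW n]
    refine ⟨eventually_atTop.mpr ⟨n₀, hpos⟩, ?_, ?_⟩
    · have hθl : 0 < l - (l - ρ) / 4 := by linarith
      refine tendsto_zero_of_le_mul_add (θ := ρ / (l - (l - ρ) / 4))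
        (δ := fun n => 2 * ε n / (l - (l - ρ) / 4)) (fun n => div_nonneg (hW n) (hX n))
        (div_nonneg hρ.le hθl.le) ((div_lt_one hθl).mpr (by linarith))
        (by simpa using hε2.div_const (l - (l - ρ) / 4)) ?_
      filter_upwards [eventually_ge_atTop n₀] with n hn
      have hXn := hpos n hn
      have h1 := (abs_le.mp (hWs n)).2
      have h2 := (abs_le.mp (hXs n)).1
      have h3 := hN n (by omega)
      have h4 : ε n * (X n + W n) ≤ ε n * (2 * X n) :=
        mul_le_mul_of_nonneg_left (by linarith [hdom n hn]) (hε0 n)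
      have h5 : (l - (l - ρ) / 4) * X n ≤ X (n + 1) := by nlinarith
      have h6 : W (n + 1) ≤ ρ * W n + 2 * ε n * X n := by linarith
      calc W (n + 1) / X (n + 1) ≤ (ρ * W n + 2 * ε n * X n) / ((l - (l - ρ) / 4) * X n) :=
            div_le_div₀ (by have := hW n; have := hε0 n; positivity) h6 (by positivity) h5
        _ = _ := by field_simp
    · refine tendsto_iff_norm_sub_tendsto_zero.mpr
        (squeeze_zero' (Eventually.of_forall fun n => norm_nonneg _) ?_ hε2)
      filter_upwards [eventually_ge_atTop n₀] with n hn
      have hXn := hpos n hn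
      rw [Real.norm_eq_abs, div_sub' hXn.ne', abs_div, abs_of_pos hXn, div_le_iff₀ hXn,
        mul_comm (X n)]
      nlinarith [hXs n, hε0 n, hdom n hn]

/-- If a nonnegative sequence `W` of exact growth rate `ρ` is comparable with the maximum of three
consecutive terms of `v`, then `limsup v n ^ (1 / n) = ρ`. -/
lemma limsup_root_eq {v W : ℕ → ℝ} {ρ K : ℝ} (hv : ∀ n, 0 ≤ v n) (hρ : 0 < ρ) (hK : 0 < K)
    (hW0 : ∀ᶠ n in atTop, 0 < W n) (hW : Tendsto (fun n : ℕ => W n ^ (1 / (n : ℝ))) atTop (𝓝 ρ))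
    (hup : ∀ᶠ n in atTop, v n ≤ K * W n)
    (hlow : ∀ n, W n ≤ K * (v n + v (n + 1) + v (n + 2))) :
    limsup (fun n : ℕ => ((v n ^ (1 / (n : ℝ)) : ℝ) : EReal)) atTop = ((ρ : ℝ) : EReal) := by
  apply le_antisymm
  · have h1 : Tendsto (fun n : ℕ => ((K ^ (1 / (n : ℝ)) * W n ^ (1 / (n : ℝ)) : ℝ) : EReal)) atTop
        (𝓝 ((1 * ρ : ℝ) : EReal)) :=
      (continuous_coe_real_ereal.tendsto _).comp ((tendsto_const_root hK).mul hW)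
    rw [one_mul] at h1
    rw [← h1.limsup_eq]
    refine limsup_le_limsup ?_
    filter_upwards [hup, hW0] with n hn hn'
    rw [EReal.coe_le_coe_iff, ← Real.mul_rpow hK.le hn'.le]
    exact Real.rpow_le_rpow (hv n) hn (by positivity)
  · by_contra! hlt
    have hlt' : max (limsup (fun n : ℕ => ((v n ^ (1 / (n : ℝ)) : ℝ) : EReal)) atTop) ((0 : ℝ) : EReal)
        < ((ρ : ℝ) : EReal) := max_lt hlt (EReal.coe_lt_coe_iff.mpr hρ)
    obtain ⟨c, hc1, hc2⟩ := EReal.exists_between_coe_real hlt'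
    have hc0 : 0 < c := EReal.coe_lt_coe_iff.mp ((le_max_right _ _).trans_lt hc1)
    have hcρ : c < ρ := EReal.coe_lt_coe_iff.mp hc2
    have hev := eventually_lt_of_limsup_lt ((le_max_left _ _).trans_lt hc1)
    have hev' : ∀ᶠ n : ℕ in atTop, v n ≤ c ^ n := by
      filter_upwards [hev, eventually_ge_atTop 1] with n hn h1
      have hn' := (EReal.coe_lt_coe_iff.mp hn).le
      have h2 := pow_le_pow_left₀ (Real.rpow_nonneg (hv n) _) hn' n
      rwa [one_div, Real.rpow_inv_natCast_pow (hv n) (by omega)] at h2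
    have hM : 0 < K * (1 + c + c ^ 2) := by positivity
    have hev2 : ∀ᶠ n : ℕ in atTop, W n ^ (1 / (n : ℝ)) ≤ (K * (1 + c + c ^ 2)) ^ (1 / (n : ℝ)) * c := by
      filter_upwards [hev', (tendsto_add_atTop_nat 1).eventually hev',
        (tendsto_add_atTop_nat 2).eventually hev', hW0, eventually_ge_atTop 1] with n h0 h1 h2 hp hn
      have h3 : W n ≤ (K * (1 + c + c ^ 2)) * c ^ n := by
        refine (hlow n).trans ?_
        rw [mul_assoc]
        refine mul_le_mul_of_nonneg_left ?_ hK.le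
        rw [pow_succ] at h1
        rw [pow_add] at h2
        linarith
      have h4 := Real.rpow_le_rpow hp.le h3 (by positivity : 0 ≤ 1 / (n : ℝ))
      have h5 := Real.pow_rpow_inv_natCast hc0.le (by omega : n ≠ 0)
      rw [← one_div] at h5
      rwa [Real.mul_rpow hM.le (by positivity), h5] at h4
    have := le_of_tendsto_of_tendsto hW ((tendsto_const_root hM).mul_const c) hev2
    linarith

/-- Squeezing `n`-th roots between constant multiples. -/
lemma tendsto_root_of_comparable {v X : ℕ → ℝ} {l c C : ℝ} (hc : 0 < c) (hC : 0 < C)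
    (hX : ∀ᶠ n in atTop, 0 < X n) (hlim : Tendsto (fun n : ℕ => X n ^ (1 / (n : ℝ))) atTop (𝓝 l))
    (hlow : ∀ᶠ n in atTop, c * X n ≤ v n) (hup : ∀ᶠ n in atTop, v n ≤ C * X n) :
    Tendsto (fun n : ℕ => v n ^ (1 / (n : ℝ))) atTop (𝓝 l) := by
  have h1 := (tendsto_const_root hc).mul hlim
  have h2 := (tendsto_const_root hC).mul hlim
  rw [one_mul] at h1 h2
  refine tendsto_of_tendsto_of_tendsto_of_le_of_le' h1 h2 ?_ ?_
  · filter_upwards [hX, hlow] with n hn hn'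
    rw [← Real.mul_rpow hc.le hn.le]
    exact Real.rpow_le_rpow (by positivity) hn' (by positivity)
  · filter_upwards [hX, hlow, hup] with n hn hn' hn''
    rw [← Real.mul_rpow hC.le hn.le]
    exact Real.rpow_le_rpow ((mul_pos hc hn).le.trans hn') hn'' (by positivity)

/-- **Poincaré–Perron** for a recurrence of order three whose limiting characteristic equation has one
dominant root `l₃` and two roots of equal modulus: a solution that does not vanish identically grows
either like the dominant root or, in the sense of the upper limit, like the other two.

The solution is written in the coordinates that diagonalize the limiting recurrence. -/
theorem poincare_perron {u α β γ : ℕ → ℂ} {l₁ l₂ l₃ : ℂ} (h12 : l₁ ≠ l₂) (h13 : l₁ ≠ l₃)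
    (h23 : l₂ ≠ l₃) (hn12 : ‖l₁‖ = ‖l₂‖) (h0 : 0 < ‖l₁‖) (hlt : ‖l₁‖ < ‖l₃‖)
    (hα : Tendsto α atTop (𝓝 (l₁ + l₂ + l₃)))
    (hβ : Tendsto β atTop (𝓝 (-(l₁ * l₂ + l₁ * l₃ + l₂ * l₃))))
    (hγ : Tendsto γ atTop (𝓝 (l₁ * l₂ * l₃))) (hγ0 : ∀ n, γ n ≠ 0)
    (hrec : ∀ n, u (n + 3) = α n * u (n + 2) + β n * u (n + 1) + γ n * u n)
    (hu : ¬(u 0 = 0 ∧ u 1 = 0 ∧ u 2 = 0)) :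
    limsup (fun n : ℕ => ((‖u n‖ ^ (1 / (n : ℝ)) : ℝ) : EReal)) atTop = ((‖l₁‖ : ℝ) : EReal) ∨
    Tendsto (fun n : ℕ => ‖u n‖ ^ (1 / (n : ℝ))) atTop (𝓝 ‖l₃‖) := by
  have hne : ∀ n, ¬(u n = 0 ∧ u (n + 1) = 0 ∧ u (n + 2) = 0) := fun n => by
    induction n with
    | zero => exact hu
    | succ n ih =>
      rintro ⟨e1, e2, e3⟩
      refine ih ⟨?_, e1, e2⟩
      have h := hrec n
      rw [e3, e1, show u (n + 2) = 0 from e2] at h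
      simpa [hγ0 n] using h
  -- the coordinates along the three characteristic roots
  set c₁ : ℕ → ℂ := fun n => u (n + 2) - (l₂ + l₃) * u (n + 1) + l₂ * l₃ * u n with hc₁
  set c₂ : ℕ → ℂ := fun n => u (n + 2) - (l₁ + l₃) * u (n + 1) + l₁ * l₃ * u n with hc₂
  set c₃ : ℕ → ℂ := fun n => u (n + 2) - (l₁ + l₂) * u (n + 1) + l₁ * l₂ * u n with hc₃
  set δ : ℕ → ℂ := fun n => (α n - (l₁ + l₂ + l₃)) * u (n + 2)
    + (β n - -(l₁ * l₂ + l₁ * l₃ + l₂ * l₃)) * u (n + 1) + (γ n - l₁ * l₂ * l₃) * u n with hδ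
  have s₁ : ∀ n, c₁ (n + 1) - l₁ * c₁ n = δ n := fun n => by
    simp only [hc₁, hδ]
    rw [show n + 1 + 2 = n + 3 from rfl, hrec]; ring
  have s₂ : ∀ n, c₂ (n + 1) - l₂ * c₂ n = δ n := fun n => by
    simp only [hc₂, hδ]
    rw [show n + 1 + 2 = n + 3 from rfl, hrec]; ring
  have s₃ : ∀ n, c₃ (n + 1) - l₃ * c₃ n = δ n := fun n => by
    simp only [hc₃, hδ]
    rw [show n + 1 + 2 = n + 3 from rfl, hrec]; ring
  set D₁ := (l₁ - l₂) * (l₁ - l₃) with hD₁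
  set D₂ := (l₂ - l₁) * (l₂ - l₃) with hD₂
  set D₃ := (l₃ - l₁) * (l₃ - l₂) with hD₃
  have k12 := sub_ne_zero.mpr h12
  have k13 := sub_ne_zero.mpr h13
  have k23 := sub_ne_zero.mpr h23
  have k21 := sub_ne_zero.mpr h12.symm
  have k31 := sub_ne_zero.mpr h13.symm
  have k32 := sub_ne_zero.mpr h23.symm
  have d₁ : D₁ ≠ 0 := mul_ne_zero k12 k13
  have d₂ : D₂ ≠ 0 := mul_ne_zero k21 k23
  have d₃ : D₃ ≠ 0 := mul_ne_zero k31 k32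
  -- Lagrange interpolation recovers the solution
  have hinv : ∀ n, u n = c₁ n / D₁ + c₂ n / D₂ + c₃ n / D₃ ∧
      u (n + 1) = l₁ * (c₁ n / D₁) + l₂ * (c₂ n / D₂) + l₃ * (c₃ n / D₃) ∧
      u (n + 2) = l₁ ^ 2 * (c₁ n / D₁) + l₂ ^ 2 * (c₂ n / D₂) + l₃ ^ 2 * (c₃ n / D₃) := fun n => by
    have e2 : D₂ = -((l₁ - l₂) * (l₂ - l₃)) := by rw [hD₂]; ring
    have e3 : D₃ = (l₁ - l₃) * (l₂ - l₃) := by rw [hD₃]; ring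
    rw [e2, e3, hD₁]
    simp only [hc₁, hc₂, hc₃]
    refine ⟨?_, ?_, ?_⟩ <;> field_simp <;> ring
  set X : ℕ → ℝ := fun n => ‖c₃ n‖ with hX
  set W : ℕ → ℝ := fun n => max ‖c₁ n‖ ‖c₂ n‖ with hW
  have hX0 : ∀ n, 0 ≤ X n := fun n => norm_nonneg _
  have hW0 : ∀ n, 0 ≤ W n := fun n => (norm_nonneg _).trans (le_max_left _ _)
  set K₀ := ‖D₁‖⁻¹ + ‖D₂‖⁻¹ + ‖D₃‖⁻¹ with hK₀
  have p₁ : 0 < ‖D₁‖⁻¹ := inv_pos.mpr (norm_pos_iff.mpr d₁)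
  have p₂ : 0 < ‖D₂‖⁻¹ := inv_pos.mpr (norm_pos_iff.mpr d₂)
  have p₃ : 0 < ‖D₃‖⁻¹ := inv_pos.mpr (norm_pos_iff.mpr d₃)
  set M := 1 + ‖l₃‖ with hM
  have hM1 : 1 ≤ M := by rw [hM]; linarith [norm_nonneg l₃]
  have q₁ : ‖l₁‖ ≤ M := by rw [hM]; linarith
  have q₂ : ‖l₂‖ ≤ M := by rw [hM, ← hn12]; linarith
  have q₃ : ‖l₃‖ ≤ M := by rw [hM]; linarith
  have hM2 : M ≤ M ^ 2 := by nlinarith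
  have hM3 : ‖(1 : ℂ)‖ ≤ M ^ 2 := by rw [norm_one]; linarith
  have hcomb : ∀ (n : ℕ) (x y z : ℂ), ‖x‖ ≤ M ^ 2 → ‖y‖ ≤ M ^ 2 → ‖z‖ ≤ M ^ 2 →
      ‖x * (c₁ n / D₁) + y * (c₂ n / D₂) + z * (c₃ n / D₃)‖ ≤ M ^ 2 * K₀ * (X n + W n) := by
    intro n x y z hx hy hz
    have b : ∀ w c D : ℂ, ‖w‖ ≤ M ^ 2 → ‖c‖ ≤ X n + W n →
        ‖w * (c / D)‖ ≤ M ^ 2 * ((X n + W n) * ‖D‖⁻¹) := fun w c D hw hc => by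
      rw [norm_mul, norm_div, div_eq_mul_inv]
      exact mul_le_mul hw (mul_le_mul_of_nonneg_right hc (by positivity)) (by positivity)
        (by positivity)
    refine (norm_add₃_le).trans ?_
    have b₁ := b x (c₁ n) D₁ hx ((le_max_left _ _).trans (le_add_of_nonneg_left (hX0 n)))
    have b₂ := b y (c₂ n) D₂ hy ((le_max_right _ _).trans (le_add_of_nonneg_left (hX0 n)))
    have b₃ := b z (c₃ n) D₃ hz (le_add_of_nonneg_right (hW0 n))
    calc _ ≤ M ^ 2 * ((X n + W n) * ‖D₁‖⁻¹) + M ^ 2 * ((X n + W n) * ‖D₂‖⁻¹)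
          + M ^ 2 * ((X n + W n) * ‖D₃‖⁻¹) := add_le_add (add_le_add b₁ b₂) b₃
      _ = _ := by rw [hK₀]; ring
  set K := M ^ 2 * K₀ with hK
  have hKpos : 0 < K := by positivity
  have hu0 : ∀ n, ‖u n‖ ≤ K * (X n + W n) := fun n => by
    have := hcomb n 1 1 1 hM3 hM3 hM3
    rwa [one_mul, one_mul, one_mul, ← (hinv n).1] at this
  have hu1 : ∀ n, ‖u (n + 1)‖ ≤ K * (X n + W n) := fun n => by
    rw [(hinv n).2.1]
    exact hcomb n _ _ _ (q₁.trans hM2) (q₂.trans hM2) (q₃.trans hM2)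
  have hu2 : ∀ n, ‖u (n + 2)‖ ≤ K * (X n + W n) := fun n => by
    rw [(hinv n).2.2]
    refine hcomb n _ _ _ ?_ ?_ ?_ <;> rw [norm_pow] <;>
    exact pow_le_pow_left₀ (norm_nonneg _) ‹_› 2
  have hXW : ∀ n, 0 < X n + W n := fun n => by
    by_contra! h
    have hz : ∀ w : ℂ, ‖w‖ ≤ K * (X n + W n) → w = 0 := fun w hw =>
      norm_le_zero_iff.mp (hw.trans (mul_nonpos_of_nonneg_of_nonpos hKpos.le h))
    exact hne n ⟨hz _ (hu0 n), hz _ (hu1 n), hz _ (hu2 n)⟩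
  set ε : ℕ → ℝ := fun n => (‖α n - (l₁ + l₂ + l₃)‖ + ‖β n - -(l₁ * l₂ + l₁ * l₃ + l₂ * l₃)‖
    + ‖γ n - l₁ * l₂ * l₃‖) * K with hε
  have hεlim : Tendsto ε atTop (𝓝 0) := by
    have h := (((tendsto_iff_norm_sub_tendsto_zero.mp hα).add
      (tendsto_iff_norm_sub_tendsto_zero.mp hβ)).add
      (tendsto_iff_norm_sub_tendsto_zero.mp hγ)).mul_const K
    rwa [add_zero, add_zero, zero_mul] at h
  have hδb : ∀ n, ‖δ n‖ ≤ ε n * (X n + W n) := fun n => by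
    refine (norm_add₃_le).trans ?_
    simp only [norm_mul, hε]
    rw [mul_assoc (_ + _) K, add_mul, add_mul]
    exact add_le_add (add_le_add (mul_le_mul_of_nonneg_left (hu2 n) (norm_nonneg _))
      (mul_le_mul_of_nonneg_left (hu1 n) (norm_nonneg _)))
      (mul_le_mul_of_nonneg_left (hu0 n) (norm_nonneg _))
  have hstep : ∀ (w w' l : ℂ) (n : ℕ), w' - l * w = δ n →
      |‖w'‖ - ‖l‖ * ‖w‖| ≤ ε n * (X n + W n) := fun w w' l n h => by
    rw [← norm_mul]
    exact (abs_norm_sub_norm_le _ _).trans (by rw [h]; exact hδb n)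
  have hXs : ∀ n, |X (n + 1) - ‖l₃‖ * X n| ≤ ε n * (X n + W n) := fun n => hstep _ _ _ n (s₃ n)
  have hWs : ∀ n, |W (n + 1) - ‖l₁‖ * W n| ≤ ε n * (X n + W n) := fun n => by
    simp only [hW]
    rw [mul_max_of_nonneg _ _ h0.le]
    refine (abs_max_sub_max_le_max _ _ _ _).trans (max_le (hstep _ _ _ n (s₁ n)) ?_)
    rw [hn12]
    exact hstep _ _ _ n (s₂ n)
  rcases growth_dichotomy hX0 hW0 hXW hεlim h0 hlt hWs hXs with ⟨hdom, hrat⟩ | ⟨hpos, hq, hrat⟩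
  · left
    have hWpos : ∀ᶠ n in atTop, 0 < W n := hdom.mono fun n hn => (hX0 n).trans_lt hn
    set K' := 2 * K + (M ^ 2 + 2 * M + 1) with hK'
    have hK'0 : 0 < K' := by positivity
    refine limsup_root_eq (K := K') (fun n => norm_nonneg _) h0 hK'0 hWpos
      (tendsto_root_of_tendsto_ratio h0 hWpos hrat) ?_ fun n => ?_
    · filter_upwards [hdom] with n hn
      refine (hu0 n).trans ?_
      have := hW0 n
      rw [hK']
      nlinarith [mul_le_mul_of_nonneg_left hn.le hKpos.le, mul_nonneg (by positivity :
        0 ≤ M ^ 2 + 2 * M + 1) this]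
    · have hb : ∀ a b : ℂ, ‖a‖ ≤ M → ‖b‖ ≤ M →
          ‖u (n + 2) - (a + b) * u (n + 1) + a * b * u n‖
            ≤ K' * (‖u n‖ + ‖u (n + 1)‖ + ‖u (n + 2)‖) := fun a b ha hb => by
        have t1 : ‖u (n + 2) - (a + b) * u (n + 1) + a * b * u n‖
            ≤ ‖u (n + 2)‖ + (M + M) * ‖u (n + 1)‖ + (M * M) * ‖u n‖ := by
          refine (norm_add_le _ _).trans (add_le_add ((norm_sub_le _ _).trans
            (add_le_add le_rfl ?_)) ?_)
          · rw [norm_mul]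
            exact mul_le_mul_of_nonneg_right ((norm_add_le _ _).trans (add_le_add ha hb))
              (norm_nonneg _)
          · rw [norm_mul, norm_mul]
            exact mul_le_mul_of_nonneg_right (mul_le_mul ha hb (norm_nonneg _) (by linarith))
              (norm_nonneg _)
        have a1 : 1 ≤ K' := by rw [hK']; nlinarith
        have a2 : M + M ≤ K' := by rw [hK']; nlinarith
        have a3 : M * M ≤ K' := by rw [hK']; nlinarith
        have := mul_le_mul_of_nonneg_right a1 (norm_nonneg (u (n + 2)))
        have := mul_le_mul_of_nonneg_right a2 (norm_nonneg (u (n + 1)))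
        have := mul_le_mul_of_nonneg_right a3 (norm_nonneg (u n))
        linarith
      exact max_le (hb _ _ q₂ q₃) (hb _ _ q₁ q₃)
  · right
    have hl3 : 0 < ‖l₃‖ := h0.trans hlt
    refine tendsto_root_of_comparable (c := ‖D₃‖⁻¹ / 2) (C := 2 * K) (by positivity) (by positivity)
      hpos (tendsto_root_of_tendsto_ratio hl3 hpos hrat) ?_ ?_
    · have h1 : ∀ᶠ n in atTop, W n / X n < ‖D₃‖⁻¹ / 2 / (‖D₁‖⁻¹ + ‖D₂‖⁻¹) :=
        hq.eventually_lt_const (by positivity)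
      filter_upwards [hpos, h1] with n hn hn'
      rw [div_lt_div_iff₀ hn (by positivity)] at hn'
      have h2 : c₃ n / D₃ = u n - (c₁ n / D₁ + c₂ n / D₂) := by rw [(hinv n).1]; ring
      have h3 : ‖c₃ n / D₃‖ ≤ ‖u n‖ + (W n * ‖D₁‖⁻¹ + W n * ‖D₂‖⁻¹) := by
        rw [h2]
        refine (norm_sub_le _ _).trans (add_le_add le_rfl ((norm_add_le _ _).trans ?_))
        rw [norm_div, norm_div, div_eq_mul_inv, div_eq_mul_inv]
        exact add_le_add (mul_le_mul_of_nonneg_right (le_max_left _ _) p₁.le)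
          (mul_le_mul_of_nonneg_right (le_max_right _ _) p₂.le)
      rw [norm_div, div_eq_mul_inv] at h3
      change ‖D₃‖⁻¹ / 2 * ‖c₃ n‖ ≤ ‖u n‖
      change W n * (‖D₁‖⁻¹ + ‖D₂‖⁻¹) < ‖D₃‖⁻¹ / 2 * ‖c₃ n‖ at hn'
      linarith
    · have h1 : ∀ᶠ n in atTop, W n / X n < 1 := hq.eventually_lt_const one_pos
      filter_upwards [hpos, h1] with n hn hn'
      rw [div_lt_one hn] at hn'
      refine (hu0 n).trans ?_
      nlinarith [mul_le_mul_of_nonneg_left hn'.le hKpos.le]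

/-! ### The characteristic roots -/

/-- The zeros of `4λ³ - 220λ² + 8λ - 1`: the dominant real zero `l₃` comes from a sign change, and the
other two are the zeros of the quotient `λ² - (55 - l₃) λ + 1 / (4 l₃)`. -/
lemma exists_characteristic_roots : ∃ (l₁ l₂ : ℂ) (l₃ : ℝ),
    charPoly.roots = {l₁, l₂, (l₃ : ℂ)} ∧ l₂ = (starRingEnd ℂ) l₁ ∧
    l₁.re ∈ Set.Ico (0.018152450 : ℝ) 0.018152451 ∧
    l₁.im ∈ Set.Ico (0.064953409 : ℝ) 0.064953410 ∧
    ‖l₁‖ ∈ Set.Ico (0.067442248 : ℝ) 0.067442249 ∧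
    l₃ ∈ Set.Ico (54.96369509 : ℝ) 54.96369510 ∧
    l₁ + l₂ + l₃ = 55 ∧ l₁ * l₂ + l₁ * l₃ + l₂ * l₃ = 2 ∧ l₁ * l₂ * l₃ = 1 / 4 := by
  -- The bracket for `s` is narrower than the one asserted for `l₃`, because the real part
  -- `(55 - s) / 2` of the other two roots is needed to nine decimals.
  obtain ⟨s, ⟨hs1, hs2⟩, hs⟩ : ∃ s ∈ Set.Icc (54.9636950983 : ℝ) 54.9636950984,
      4 * s ^ 3 - 220 * s ^ 2 + 8 * s - 1 = 0 := by
    have hc : ContinuousOn (fun s : ℝ => 4 * s ^ 3 - 220 * s ^ 2 + 8 * s - 1)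
        (Set.Icc (54.9636950983 : ℝ) 54.9636950984) := by fun_prop
    exact intermediate_value_Icc (by norm_num) hc ⟨by norm_num, by norm_num⟩
  have hs0 : 0 < s := by linarith
  set p : ℝ := (55 - s) / 2 with hp
  set q : ℝ := 1 / (4 * s) with hq
  have hp1 : 0.0181524508 ≤ p := by rw [hp]; linarith
  have hp2 : p ≤ 0.01815245085 := by rw [hp]; linarith
  have hq1 : 0.0045484569 ≤ q := by rw [hq, le_div_iff₀ (by positivity)]; linarith
  have hq2 : q ≤ 0.00454845694 := by rw [hq, div_le_iff₀ (by positivity)]; linarith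
  have hd : 0 ≤ q - p ^ 2 := by nlinarith
  have hsq := Real.sq_sqrt hd
  set r := Real.sqrt (q - p ^ 2) with hr
  have hr0 : 0 ≤ r := Real.sqrt_nonneg _
  have hnorm : ‖(⟨p, r⟩ : ℂ)‖ ^ 2 = q := by
    rw [Complex.sq_norm, Complex.normSq_mk]
    linear_combination hsq
  have hqs : q * s = 1 / 4 := by rw [hq]; field_simp
  have e1 : (⟨p, r⟩ : ℂ) + (starRingEnd ℂ) ⟨p, r⟩ = ((2 * p : ℝ) : ℂ) := Complex.add_conj _
  have e2 : (⟨p, r⟩ : ℂ) * (starRingEnd ℂ) ⟨p, r⟩ = ((q : ℝ) : ℂ) := by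
    rw [Complex.mul_conj, Complex.normSq_eq_norm_sq, hnorm]
  have e1' : (⟨p, r⟩ : ℂ) + (starRingEnd ℂ) ⟨p, r⟩ + s = 55 := by
    rw [e1, ← Complex.ofReal_add, hp]
    norm_num [mul_div_cancel₀]
  have e3' : (⟨p, r⟩ : ℂ) * (starRingEnd ℂ) ⟨p, r⟩ * s = 1 / 4 := by
    rw [e2, ← Complex.ofReal_mul, hqs]
    norm_num
  have e2' : (⟨p, r⟩ : ℂ) * (starRingEnd ℂ) ⟨p, r⟩ + ⟨p, r⟩ * s + (starRingEnd ℂ) ⟨p, r⟩ * s = 2 := by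
    have h : q + 2 * p * s = 2 := by
      refine mul_right_cancel₀ hs0.ne' ?_
      rw [hp]
      linear_combination hqs - hs / 4
    rw [add_assoc, ← add_mul, e1, e2]
    exact_mod_cast h
  refine ⟨⟨p, r⟩, (starRingEnd ℂ) ⟨p, r⟩, s, ?_, rfl, ⟨by simpa using by linarith,
    by simpa using by linarith⟩, ⟨?_, ?_⟩, ⟨?_, ?_⟩, ⟨by linarith, by linarith⟩, e1', e2', e3'⟩
  · generalize (⟨p, r⟩ : ℂ) = l₁ at e1' e2' e3' ⊢
    generalize (starRingEnd ℂ) l₁ = l₂ at e1' e2' e3' ⊢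
    have h : charPoly = Polynomial.C 4 * (Multiset.map (fun x => Polynomial.X - Polynomial.C x)
        ({l₁, l₂, (s : ℂ)} : Multiset ℂ)).prod := by
      have c1 := congrArg Polynomial.C e1'
      have c2 := congrArg Polynomial.C e2'
      have c3 := congrArg Polynomial.C (show 4 * (l₁ * l₂ * s) = 1 by rw [e3']; norm_num)
      have k4 : (Polynomial.C 4 : Polynomial ℂ) = 4 := rfl
      have k55 : (Polynomial.C 55 : Polynomial ℂ) = 55 := rfl
      have k2 : (Polynomial.C 2 : Polynomial ℂ) = 2 := rfl
      simp only [map_add, map_mul, map_one, k4, k55, k2] at c1 c2 c3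
      simp only [Multiset.insert_eq_cons, Multiset.map_cons, Multiset.map_singleton,
        Multiset.prod_cons, Multiset.prod_singleton, charPoly, k4]
      linear_combination (4 * Polynomial.X ^ 2) * c1 - (4 * Polynomial.X) * c2 + c3
    rw [h, Polynomial.roots_C_mul _ (by norm_num), Polynomial.roots_multiset_prod_X_sub_C]
  · change _ ≤ r
    exact Real.le_sqrt_of_sq_le (by norm_num at *; nlinarith)
  · change r < _
    exact (Real.sqrt_lt' (by norm_num)).mpr (by norm_num at *; nlinarith)
  · refine le_of_sq_le_sq ?_ (norm_nonneg _)
    rw [hnorm]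
    norm_num at *
    linarith
  · refine lt_of_pow_lt_pow_left₀ 2 (by norm_num) ?_
    rw [hnorm]
    norm_num at *
    linarith

lemma coeffA_ne_zero (m : ℕ) : coeffA (m + 2 : ℂ) ≠ 0 := by
  have h : coeffA (m + 2 : ℂ)
      = ((2 * (946 * m ^ 2 + 3053 * m + 2475) * (2 * m + 5) * (m + 3) ^ 3 : ℕ) : ℂ) := by
    unfold coeffA
    push_cast
    ring
  rw [h]
  exact Nat.cast_ne_zero.mpr (by positivity)

lemma coeffD_ne_zero (m : ℕ) : coeffD (m + 2 : ℂ) ≠ 0 := by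
  have h : coeffD (m + 2 : ℂ)
      = (((946 * (m + 2) ^ 2 + 1161 * (m + 2) + 368) * (m + 2) * (m + 1) ^ 3 : ℕ) : ℂ) := by
    unfold coeffD
    push_cast
    ring
  rw [h]
  exact Nat.cast_ne_zero.mpr (by positivity)

/-- Quotients of functions `n ^ 6 P(1 / n)` with `P` continuous at `0`. -/
lemma tendsto_coeff_div {f : ℂ → ℂ} {P Q : ℂ → ℂ} (hP : Continuous P) (hQ : Continuous Q)
    (hQ0 : Q 0 ≠ 0) (hf : ∀ x : ℂ, x ≠ 0 → f x = x ^ 6 * P x⁻¹)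
    (hA : ∀ x : ℂ, x ≠ 0 → coeffA x = x ^ 6 * Q x⁻¹) :
    Tendsto (fun m : ℕ => f (m + 2) / coeffA (m + 2 : ℂ)) atTop (𝓝 (P 0 / Q 0)) := by
  have h1 : Tendsto (fun m : ℕ => ((m : ℂ) + 2)⁻¹) atTop (𝓝 0) := by
    have := (tendsto_add_atTop_iff_nat 2).mpr (tendsto_inv_atTop_nhds_zero_nat (𝕜 := ℂ))
    simpa using this
  refine (((hP.tendsto 0).comp h1).div ((hQ.tendsto 0).comp h1) hQ0).congr fun m => ?_
  have hx : (m : ℂ) + 2 ≠ 0 := by exact_mod_cast Nat.succ_ne_zero (m + 1)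
  simp only [Function.comp_apply, Pi.div_apply]
  rw [hf _ hx, hA _ hx, mul_div_mul_left _ _ (pow_ne_zero 6 hx)]

lemma coeff_limits :
    Tendsto (fun m : ℕ => coeffB (m + 2 : ℂ) / coeffA (m + 2 : ℂ)) atTop (𝓝 55) ∧
    Tendsto (fun m : ℕ => coeffC (m + 2 : ℂ) / coeffA (m + 2 : ℂ)) atTop (𝓝 2) ∧
    Tendsto (fun m : ℕ => coeffD (m + 2 : ℂ) / coeffA (m + 2 : ℂ)) atTop (𝓝 (1 / 4)) := by
  set Q : ℂ → ℂ := fun x => 2 * (946 - 731 * x + 153 * x ^ 2) * (2 + x) * (1 + x) ^ 3 with hQ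
  have hA : ∀ x : ℂ, x ≠ 0 → coeffA x = x ^ 6 * Q x⁻¹ := fun x hx => by
    simp only [coeffA, hQ]; field_simp
  have hQc : Continuous Q := by fun_prop
  have hQ0 : Q 0 = 3784 := by simp only [hQ]; norm_num
  have hQne : Q 0 ≠ 0 := by rw [hQ0]; norm_num
  refine ⟨?_, ?_, ?_⟩
  · have h := tendsto_coeff_div (f := coeffB) (P := fun x => 2 * (104060 + 127710 * x + 12788 * x ^ 2
      - 34525 * x ^ 3 - 8482 * x ^ 4 + 3298 * x ^ 5 + 1071 * x ^ 6)) (by fun_prop) hQc hQne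
      (fun x hx => by simp only [coeffB]; field_simp) hA
    rw [hQ0] at h
    norm_num at h
    exact h
  · have h := tendsto_coeff_div (f := coeffC) (P := fun x => 2 * (3784 - 1032 * x - 1925 * x ^ 2
      + 853 * x ^ 3 + 328 * x ^ 4 - 184 * x ^ 5)) (by fun_prop) hQc hQne
      (fun x hx => by simp only [coeffC]; field_simp) hA
    rw [hQ0] at h
    norm_num at h
    exact h
  · have h := tendsto_coeff_div (f := coeffD) (P := fun x => (946 + 1161 * x + 368 * x ^ 2)
      * (1 - x) ^ 3) (by fun_prop) hQc hQne
      (fun x hx => by simp only [coeffD]; field_simp) hA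
    rw [hQ0] at h
    norm_num at h
    simpa using h

lemma Recurrence.dichotomy {u : ℕ → ℂ} (h : Recurrence u) (hu : ¬(u 0 = 0 ∧ u 1 = 0 ∧ u 2 = 0))
    {l₁ l₂ : ℂ} {l₃ : ℝ} (hconj : l₂ = (starRingEnd ℂ) l₁) (him : l₁.im ≠ 0)
    (hlt : ‖l₁‖ < l₃) (e1 : l₁ + l₂ + l₃ = 55)
    (e2 : l₁ * l₂ + l₁ * l₃ + l₂ * l₃ = 2) (e3 : l₁ * l₂ * l₃ = 1 / 4) :
    limsup (fun n : ℕ => ((‖u n‖ ^ (1 / (n : ℝ)) : ℝ) : EReal)) atTop = ((‖l₁‖ : ℝ) : EReal) ∨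
    Tendsto (fun n : ℕ => ‖u n‖ ^ (1 / (n : ℝ))) atTop (𝓝 l₃) := by
  have hl3 : ‖(l₃ : ℂ)‖ = l₃ := by
    rw [Complex.norm_real, Real.norm_of_nonneg ((norm_nonneg _).trans hlt.le)]
  have hrec := (recurrence_iff u).mp h
  have hA := coeffA_ne_zero
  have key := poincare_perron (u := u) (l₁ := l₁) (l₂ := l₂) (l₃ := l₃)
    (α := fun m => coeffB (m + 2 : ℂ) / coeffA (m + 2 : ℂ))
    (β := fun m => -(coeffC (m + 2 : ℂ) / coeffA (m + 2 : ℂ)))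
    (γ := fun m => coeffD (m + 2 : ℂ) / coeffA (m + 2 : ℂ))
    (fun h => him (by
      have := congrArg Complex.im h
      rw [hconj, Complex.conj_im] at this
      linarith))
    (fun h => him (by rw [h, Complex.ofReal_im]))
    (fun h => him (by
      have := congrArg Complex.im h
      rw [hconj, Complex.conj_im, Complex.ofReal_im] at this
      linarith))
    (by rw [hconj, Complex.norm_conj]) (norm_pos_iff.mpr fun h => him (by rw [h]; rfl))
    (by rwa [hl3])
    (by rw [e1]; exact coeff_limits.1) (by rw [e2]; exact coeff_limits.2.1.neg)
    (by rw [e3]; exact coeff_limits.2.2)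
    (fun m => div_ne_zero (coeffD_ne_zero m) (hA m))
    (fun m => by
      have h1 := hA m
      field_simp
      linear_combination hrec m) hu
  rwa [hl3] at key

/-! ### Bounded and null solutions -/

lemma not_tendsto_root_of_bounded {v : ℕ → ℝ} {C l : ℝ} (hv : ∀ n, 0 ≤ v n) (hb : ∀ n, v n ≤ C)
    (hl : 1 < l) : ¬Tendsto (fun n : ℕ => v n ^ (1 / (n : ℝ))) atTop (𝓝 l) := fun h => by
  have hC : 0 < |C| + 1 := by positivity
  have := le_of_tendsto_of_tendsto' h (tendsto_const_root hC) fun n =>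
    Real.rpow_le_rpow (hv n) ((hb n).trans ((le_abs_self C).trans (by linarith))) (by positivity)
  linarith

lemma tendsto_zero_of_limsup_root {v : ℕ → ℝ} {r : ℝ} (hv : ∀ n, 0 ≤ v n) (hr0 : 0 ≤ r) (hr : r < 1)
    (h : limsup (fun n : ℕ => ((v n ^ (1 / (n : ℝ)) : ℝ) : EReal)) atTop = ((r : ℝ) : EReal)) :
    Tendsto v atTop (𝓝 0) := by
  obtain ⟨c, hc1, hc2⟩ := exists_between hr
  have hev := eventually_lt_of_limsup_lt (h.trans_lt (EReal.coe_lt_coe_iff.mpr hc1))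
  refine squeeze_zero' (Eventually.of_forall hv) ?_
    (tendsto_pow_atTop_nhds_zero_of_lt_one (hr0.trans hc1.le) hc2)
  filter_upwards [hev, eventually_ge_atTop 1] with n hn h1
  have h2 := pow_le_pow_left₀ (Real.rpow_nonneg (hv n) _) (EReal.coe_lt_coe_iff.mp hn).le n
  rwa [one_div, Real.rpow_inv_natCast_pow (hv n) (by omega)] at h2

lemma Recurrence.eq_zero_of_succ {u : ℕ → ℂ} (h : Recurrence u) {n : ℕ}
    (h0 : u n = 0 ∧ u (n + 1) = 0 ∧ u (n + 2) = 0) : u 0 = 0 := by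
  induction n with
  | zero => exact h0.1
  | succ n ih =>
    have h1 := (recurrence_iff u).mp h n
    rw [show u (n + 3) = 0 from h0.2.2, show u (n + 2) = 0 from h0.2.1, h0.1] at h1
    have h2 : u n = 0 := by simpa [coeffD_ne_zero n] using h1
    exact ih ⟨h2, h0.1, h0.2.1⟩

/-- Nonzero integers are at least `1` in modulus. -/
lemma not_tendsto_a_zero : ¬Tendsto (fun n => ‖(a n : ℂ)‖) atTop (𝓝 0) := fun h => by
  obtain ⟨N, hN⟩ := eventually_atTop.mp (h.eventually_lt_const one_pos)
  have h0 : ∀ n, N ≤ n → ((a n : ℤ) : ℂ) = 0 := fun n hn => by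
    have h1 := hN n hn
    rw [Complex.norm_intCast, ← Int.cast_abs] at h1
    have h2 : |a n| < 1 := by exact_mod_cast h1
    rw [Int.abs_lt_one_iff.mp h2, Int.cast_zero]
  have h1 := (recurrence_a.map (Int.castRingHom ℂ)).eq_zero_of_succ (n := N)
    ⟨h0 N le_rfl, h0 _ (by omega), h0 _ (by omega)⟩
  rw [a_zero] at h1
  norm_num at h1

end SimApprox

end

theorem theorem2 :
    -- the Barnes integrals defining the two sequences converge absolutely
    (∀ n, Integrable (fun y : ℝ => SimApprox.kernelTwo n (SimApprox.line y))) ∧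
    (∀ n, Integrable (fun y : ℝ => SimApprox.kernelThree n (SimApprox.line y))) ∧
    -- and their values are the limits, as `z → 1-`, of the corresponding series expansions
    (∀ n, Tendsto
      (fun z : ℝ => SimApprox.rtSeries n z - SimApprox.rSeries n z * (Real.log z : ℂ))
      (𝓝[<] 1) (𝓝 (SimApprox.rt n))) ∧
    (∀ n, Tendsto
      (fun z : ℝ => SimApprox.rttSeries n z - SimApprox.rtSeries n z * (Real.log z : ℂ)
        + (1 / 2) * SimApprox.rSeries n z * (Real.log z : ℂ) ^ 2)
      (𝓝[<] 1) (𝓝 (SimApprox.rtt n))) ∧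
    ∃ (b bb : ℕ → ℚ) (l₁ l₂ : ℂ) (l₃ : ℝ),
      -- the linear forms in `1, ζ(2)` and in `1, ζ(3)`
      (∀ n, SimApprox.rt n = (SimApprox.a n : ℂ) * riemannZeta 2 - (b n : ℂ)) ∧
      (∀ n, SimApprox.rtt n = (SimApprox.a n : ℂ) * riemannZeta 3 - (bb n : ℂ)) ∧
      -- the recurrence
      SimApprox.Recurrence SimApprox.rt ∧
      SimApprox.Recurrence SimApprox.rtt ∧
      SimApprox.Recurrence SimApprox.a ∧
      SimApprox.Recurrence b ∧
      SimApprox.Recurrence bb ∧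
      -- the initial data
      (SimApprox.a 0 = 1 ∧ SimApprox.a 1 = 7 ∧ SimApprox.a 2 = 163) ∧
      (b 0 = 0 ∧ b 1 = 23 / 2 ∧ b 2 = 2145 / 8) ∧
      (bb 0 = 0 ∧ bb 1 = 17 / 2 ∧ bb 2 = 3135 / 16) ∧
      -- the zeros of the characteristic polynomial and their decimal expansions
      SimApprox.charPoly.roots = {l₁, l₂, (l₃ : ℂ)} ∧
      l₂ = (starRingEnd ℂ) l₁ ∧
      l₁.re ∈ Set.Ico (0.018152450 : ℝ) 0.018152451 ∧
      l₁.im ∈ Set.Ico (0.064953409 : ℝ) 0.064953410 ∧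
      ‖l₁‖ ∈ Set.Ico (0.067442248 : ℝ) 0.067442249 ∧
      l₃ ∈ Set.Ico (54.96369509 : ℝ) 54.96369510 ∧
      -- the asymptotics
      limsup (fun n : ℕ => ((‖SimApprox.rt n‖ ^ (1 / (n : ℝ)) : ℝ) : EReal)) atTop
        = ((‖l₁‖ : ℝ) : EReal) ∧
      limsup (fun n : ℕ => ((‖SimApprox.rtt n‖ ^ (1 / (n : ℝ)) : ℝ) : EReal)) atTop
        = ((‖l₁‖ : ℝ) : EReal) ∧
      Tendsto (fun n : ℕ => |(SimApprox.a n : ℝ)| ^ (1 / (n : ℝ))) atTop (𝓝 l₃) ∧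
      Tendsto (fun n : ℕ => |(b n : ℝ)| ^ (1 / (n : ℝ))) atTop (𝓝 l₃) ∧
      Tendsto (fun n : ℕ => |(bb n : ℝ)| ^ (1 / (n : ℝ))) atTop (𝓝 l₃) := by
  obtain ⟨l₁, l₂, l₃, hroots, hconj, hre, him, hnorm, hl3, e1, e2, e3⟩ :=
    SimApprox.exists_characteristic_roots
  have him0 : l₁.im ≠ 0 := by
    have := him.1
    norm_num at this
    linarith
  have hρ0 : 0 ≤ ‖l₁‖ := norm_nonneg _
  have hρ1 : ‖l₁‖ < 1 := hnorm.2.trans (by norm_num)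
  have hl1 : 1 < l₃ := lt_of_lt_of_le (by norm_num) hl3.1
  have hlt : ‖l₁‖ < l₃ := hρ1.trans hl1
  have dich : ∀ {u : ℕ → ℂ}, SimApprox.Recurrence u → ¬(u 0 = 0 ∧ u 1 = 0 ∧ u 2 = 0) → _ :=
    fun h hu => h.dichotomy hu hconj him0 hlt e1 e2 e3
  have ha0 : ((SimApprox.a 0 : ℤ) : ℂ) ≠ 0 := by rw [SimApprox.a_zero]; norm_num
  have ha : Tendsto (fun n : ℕ => ‖(SimApprox.a n : ℂ)‖ ^ (1 / (n : ℝ))) atTop (𝓝 l₃) :=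
    (dich (SimApprox.recurrence_a.map (Int.castRingHom ℂ)) fun h => ha0 h.1).resolve_left
      fun h => SimApprox.not_tendsto_a_zero
        (SimApprox.tendsto_zero_of_limsup_root (fun n => norm_nonneg _) hρ0 hρ1 h)
  -- `r n = a n * ζ - b n` with bounded `r` that does not vanish at `n = 0`
  have main : ∀ (r : ℕ → ℂ) (ζ : ℂ) (b : ℕ → ℚ), ζ ≠ 0 → SimApprox.Recurrence r →
      SimApprox.Recurrence b → (∃ C : ℝ, ∀ n, ‖r n‖ ≤ C) → b 0 = 0 → b 1 ≠ 0 →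
      (∀ n, r n = (SimApprox.a n : ℂ) * ζ - (b n : ℂ)) →
      limsup (fun n : ℕ => ((‖r n‖ ^ (1 / (n : ℝ)) : ℝ) : EReal)) atTop = ((‖l₁‖ : ℝ) : EReal) ∧
      Tendsto (fun n : ℕ => |(b n : ℝ)| ^ (1 / (n : ℝ))) atTop (𝓝 l₃) := by
    intro r ζ b hζ hr hb ⟨C, hC⟩ hb0 hb1 heq
    have hr0 : r 0 ≠ 0 := by
      rw [heq, hb0, SimApprox.a_zero]
      simpa using hζ
    have h1 := (dich hr fun h => hr0 h.1).resolve_right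
      (SimApprox.not_tendsto_root_of_bounded (fun n => norm_nonneg _) hC hl1)
    refine ⟨h1, ?_⟩
    have h2 := (dich (hb.map (algebraMap ℚ ℂ)) fun h => hb1 (by
      have := h.2.1
      rwa [map_eq_zero] at this)).resolve_left fun h => by
        have t1 := SimApprox.tendsto_zero_of_limsup_root (fun n => norm_nonneg _) hρ0 hρ1 h
        have t2 := SimApprox.tendsto_zero_of_limsup_root (fun n => norm_nonneg _) hρ0 hρ1 h1
        rw [← tendsto_zero_iff_norm_tendsto_zero] at t1 t2
        have t3 := (t2.add t1).div_const ζ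
        refine SimApprox.not_tendsto_a_zero (tendsto_zero_iff_norm_tendsto_zero.mp ?_)
        rw [add_zero, zero_div] at t3
        refine t3.congr fun n => ?_
        rw [heq, div_eq_iff hζ]
        exact sub_add_cancel _ _
    refine h2.congr fun n => ?_
    rw [eq_ratCast, Complex.norm_ratCast]
  obtain ⟨m2, m2'⟩ := main SimApprox.rt (riemannZeta 2) SimApprox.bTwo
    (riemannZeta_ne_zero_of_one_le_re (by norm_num)) SimApprox.recurrence_rt
    SimApprox.recurrence_bTwo SimApprox.exists_bound_rt SimApprox.b_zero.1
    (by rw [SimApprox.b_one.1]; norm_num) SimApprox.rt_eq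
  obtain ⟨m3, m3'⟩ := main SimApprox.rtt (riemannZeta 3) SimApprox.bThree
    (riemannZeta_ne_zero_of_one_le_re (by norm_num)) SimApprox.recurrence_rtt
    SimApprox.recurrence_bThree SimApprox.exists_bound_rtt SimApprox.b_zero.2
    (by rw [SimApprox.b_one.2]; norm_num) SimApprox.rtt_eq
  refine ⟨SimApprox.integrable_kernelTwo, SimApprox.integrable_kernelThree, SimApprox.tendsto_rt,
    SimApprox.tendsto_rtt, SimApprox.bTwo, SimApprox.bThree, l₁, l₂, l₃, SimApprox.rt_eq,
    SimApprox.rtt_eq, SimApprox.recurrence_rt, SimApprox.recurrence_rtt, SimApprox.recurrence_a,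
    SimApprox.recurrence_bTwo, SimApprox.recurrence_bThree,
    ⟨SimApprox.a_zero, SimApprox.a_one, SimApprox.a_two⟩,
    ⟨SimApprox.b_zero.1, SimApprox.b_one.1, SimApprox.b_two.1⟩,
    ⟨SimApprox.b_zero.2, SimApprox.b_one.2, SimApprox.b_two.2⟩,
    hroots, hconj, hre, him, hnorm, hl3, m2, m3, ha.congr fun n => ?_, m2', m3'⟩
  rw [Complex.norm_intCast]
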